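/- A \emph{self-deleting graph} is a pair $(G,f)$, where $G=(V,E)$ is a finite simple undirected graph and $f\colon V\to 2^E$ is any function; put $|f|=\sum_{v\in V}|f(v)|$. A path $(v_1,e_1,v_2,\ldots,e_{k-1},v_k)$ in $G$ is \emph{$f$-conforming} if $e_i\notin f(v_j)$ for all $j\le i$. In the problem \textsc{Self-Deleting $s$-$t$-path}, given $(G,f)$ and two vertices $s,t\in V$, one has to decide whether there is an $f$-conforming path from $s$ to $t$ in $G$. A graph is a \emph{cactus} if every edge lies on at most one cycle. \textbf{Theorem.} \textsc{Self-Deleting $s$-$t$-path} can be solved in linear time if the underlying graph is a cactus. That is, there is an algorithm that, given a self-deleting graph $(G,f)$ such that $G=(V,E)$ is a cactus and vertices $s,t\in V$, decides whether $G$ has an $f$-conforming path from $s$ to $t$ in time $O(|V|+|E|+|f|)$, on a unit-cost random access machine with words of $O(\log(|V|+|E|+|f|+1))$ bits; the input consists of the numbers $|V|$, $|E|$, $|f|$, $s$, $t$, the list of the edges (as pairs of vertices) and the list of the pairs $(v,e)$ with $e\in f(v)$, where edges are referred to by their position in the list of edges. -/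

import Mathlib

/-- A self-deleting graph `(G, f)`: a simple graph together with a deletion function that assigns
to every vertex a set of edges of the graph (not necessarily incident to that vertex). -/
structure SelfDeletingGraph (V : Type*) where
  graph : SimpleGraph V
  del : V → Set (Sym2 V)
  del_subset : ∀ v, del v ⊆ graph.edgeSet

namespace SelfDeletingGraph

variable {V : Type*}

/-- A walk `(v₀, e₀, v₁, e₁, …)` is `f`-conforming if `eᵢ ∉ f(vⱼ)` for all `j ≤ i`. -/
def Conforming (S : SelfDeletingGraph V) {u v : V} (p : S.graph.Walk u v) : Prop :=
  ∀ (i : ℕ) (hi : i < p.edges.length) (j : ℕ), j ≤ i → p.edges[i] ∉ S.del (p.getVert j)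

/-- The question of the decision problem: is there an `f`-conforming `s`-`t` path? -/
def HasConformingPath (S : SelfDeletingGraph V) (s t : V) : Prop :=
  ∃ p : S.graph.Walk s t, p.IsPath ∧ S.Conforming p

/-- The size `|V| + |E| + |f|`, where `|f|` is the sum of all `|f(v)|`. -/
noncomputable def size [Fintype V] (S : SelfDeletingGraph V) : ℕ :=
  Fintype.card V + S.graph.edgeSet.ncard + ∑ v, (S.del v).ncard

end SelfDeletingGraph

/-- A graph is a cactus if every edge lies on at most one cycle. Cycles are compared as subgraphs,
so that the starting vertex and the direction of traversal do not matter. -/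
def SimpleGraph.IsCactus {V : Type*} (G : SimpleGraph V) : Prop :=
  ∀ e ∈ G.edgeSet, ∀ (u v : V) (p : G.Walk u u) (q : G.Walk v v),
    p.IsCycle → q.IsCycle → e ∈ p.edges → e ∈ q.edges → p.toSubgraph = q.toSubgraph

/-! ### Random access machines

A structured random access machine with unit costs. It has scalar registers and arrays of words
(a program mentions only finitely many of each by name; array cells are addressed indirectly, by
computed indices). Words are natural numbers below a bound `B`; a computation that produces a
larger number is stuck. There is no multiplication. -/

namespace Ram

/-- The contents of the scalar registers and of the arrays. -/
structure State where
  reg : ℕ → ℕ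
  arr : ℕ → ℕ → ℕ

/-- The binary operations of the machine. -/
inductive Op where
  | add
  | sub
  | lt
  | eq

/-- Subtraction is truncated, and a comparison yields `1` for true and `0` for false. -/
def Op.eval : Op → ℕ → ℕ → ℕ
  | .add, x, y => x + y
  | .sub, x, y => x - y
  | .lt, x, y => if x < y then 1 else 0
  | .eq, x, y => if x = y then 1 else 0

/-- Expressions: constants, scalar registers, array cells, and binary operations. -/
inductive Expr where
  | const (c : ℕ)
  | reg (x : ℕ)
  | get (a : ℕ) (i : Expr)
  | bin (o : Op) (e₁ e₂ : Expr)

namespace Expr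

/-- The value of an expression. -/
def val (σ : State) : Expr → ℕ
  | const c => c
  | reg x => σ.reg x
  | get a i => σ.arr a (i.val σ)
  | bin o e₁ e₂ => o.eval (e₁.val σ) (e₂.val σ)

/-- The number of elementary operations needed to evaluate an expression. -/
def cost : Expr → ℕ
  | const _ => 1
  | reg _ => 1
  | get _ i => i.cost + 1
  | bin _ e₁ e₂ => e₁.cost + e₂.cost + 1

/-- All intermediate results (addresses included) are words, that is, numbers below `B`. -/
def Fits (B : ℕ) (σ : State) : Expr → Prop
  | const c => c < B
  | reg x => σ.reg x < B
  | get a i => i.Fits B σ ∧ σ.arr a (i.val σ) < B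
  | bin o e₁ e₂ => e₁.Fits B σ ∧ e₂.Fits B σ ∧ o.eval (e₁.val σ) (e₂.val σ) < B

end Expr

/-- Write the value `w` to the scalar register `x`. -/
def State.setReg (σ : State) (x w : ℕ) : State :=
  { σ with reg := Function.update σ.reg x w }

/-- Write the value `w` to cell `i` of the array `a`. -/
def State.setArr (σ : State) (a i w : ℕ) : State :=
  { σ with arr := Function.update σ.arr a (Function.update (σ.arr a) i w) }

/-- Programs. -/
inductive Prog where
  | skip
  | set (x : ℕ) (e : Expr)
  | put (a : ℕ) (i e : Expr)
  | seq (P Q : Prog)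
  | cond (e : Expr) (P Q : Prog)
  | loop (e : Expr) (P : Prog)

/-- `Exec B P σ k σ'`: on a machine whose words are the numbers below `B`, the program `P` started
in state `σ` halts in state `σ'` after exactly `k` elementary steps. The condition of a branch or
of a loop counts as true if its value is nonzero. -/
inductive Exec (B : ℕ) : Prog → State → ℕ → State → Prop where
  | skip (σ : State) : Exec B .skip σ 1 σ
  | set (x : ℕ) (e : Expr) (σ : State) (he : e.Fits B σ) :
      Exec B (.set x e) σ (e.cost + 1) (σ.setReg x (e.val σ))
  | put (a : ℕ) (i e : Expr) (σ : State) (hi : i.Fits B σ) (he : e.Fits B σ) :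
      Exec B (.put a i e) σ (i.cost + e.cost + 1) (σ.setArr a (i.val σ) (e.val σ))
  | seq {P Q : Prog} {σ₁ σ₂ σ₃ : State} {k l : ℕ}
      (hP : Exec B P σ₁ k σ₂) (hQ : Exec B Q σ₂ l σ₃) :
      Exec B (.seq P Q) σ₁ (k + l) σ₃
  | condTrue {e : Expr} {P Q : Prog} {σ σ' : State} {k : ℕ}
      (he : e.Fits B σ) (h : e.val σ ≠ 0) (hP : Exec B P σ k σ') :
      Exec B (.cond e P Q) σ (e.cost + 1 + k) σ'
  | condFalse {e : Expr} {P Q : Prog} {σ σ' : State} {k : ℕ}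
      (he : e.Fits B σ) (h : e.val σ = 0) (hQ : Exec B Q σ k σ') :
      Exec B (.cond e P Q) σ (e.cost + 1 + k) σ'
  | loopDone {e : Expr} {P : Prog} {σ : State} (he : e.Fits B σ) (h : e.val σ = 0) :
      Exec B (.loop e P) σ (e.cost + 1) σ
  | loopStep {e : Expr} {P : Prog} {σ₁ σ₂ σ₃ : State} {k l : ℕ}
      (he : e.Fits B σ₁) (h : e.val σ₁ ≠ 0)
      (hP : Exec B P σ₁ k σ₂) (hL : Exec B (.loop e P) σ₂ l σ₃) :
      Exec B (.loop e P) σ₁ (e.cost + 1 + k + l) σ₃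

end Ram

namespace SelfDeletingGraph

variable {V : Type*}

/-- A presentation of a self-deleting graph as input data: a numbering of the vertices, a list of
the edges (each one once, in any order, its two ends in any order), and a list of the pairs
`(v, e)` with `e ∈ f(v)` (each one once, in any order). -/
structure Presentation (S : SelfDeletingGraph V) where
  n : ℕ
  m : ℕ
  k : ℕ
  vertex : V ≃ Fin n
  edge : Fin m ≃ S.graph.edgeSet
  fst : Fin m → V
  snd : Fin m → V
  edge_eq : ∀ i, (edge i : Sym2 V) = s(fst i, snd i)
  deletion : Fin k ≃ (Σ v : V, S.del v)

namespace Presentation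

variable {S : SelfDeletingGraph V}

/-- The vertex of the `i`-th pair `(v, e)` with `e ∈ f(v)`. -/
def delVertex (I : S.Presentation) (i : Fin I.k) : V := (I.deletion i).1

/-- The index, in the list of edges, of the edge of the `i`-th pair `(v, e)` with `e ∈ f(v)`. -/
def delEdge (I : S.Presentation) (i : Fin I.k) : Fin I.m :=
  I.edge.symm ⟨(I.deletion i).2, S.del_subset _ (I.deletion i).2.2⟩

/-- An array that holds the numbers `g 0, …, g (l - 1)`, and `0` elsewhere. -/
def toArr {l : ℕ} (g : Fin l → ℕ) (i : ℕ) : ℕ := if h : i < l then g ⟨i, h⟩ else 0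

/-- The initial state of the machine on the instance `(G, f, s, t)`. Registers `0, …, 4` hold
`|V|`, `|E|`, `|f|` and the numbers of `s` and `t`; arrays `0` and `1` hold the ends of the edges;
arrays `2` and `3` hold the vertices and the edge indices of the pairs `(v, e)` with `e ∈ f(v)`.
Everything else is zero. -/
def input (I : S.Presentation) (s t : V) : Ram.State where
  reg
    | 0 => I.n
    | 1 => I.m
    | 2 => I.k
    | 3 => I.vertex s
    | 4 => I.vertex t
    | _ => 0
  arr
    | 0 => toArr fun i => I.vertex (I.fst i)
    | 1 => toArr fun i => I.vertex (I.snd i)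
    | 2 => toArr fun i => I.vertex (I.delVertex i)
    | 3 => toArr fun i => I.delEdge i
    | _ => fun _ => 0

end Presentation

end SelfDeletingGraph

/-! Take a spanning tree of the component of `s`, found by graph search; if `t` is not in it, there
is no path at all. In a cactus, the fundamental cycles of the edges outside of the tree are pairwise
edge-disjoint: two of them that share a tree edge are equal, and each contains only one edge outside
of the tree (`cover_unique`). So the boundary of the subtree below a vertex `c ≠ s` consists of the
tree edge above `c` and at most one further edge.

This makes paths a matter of local choices. If `t` lies below `c`, a path from `s` to `t` enters the
subtree of `c` exactly once and never leaves it, hence uses exactly one of the boundary edges. If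
`t` does not lie below `c`, the subtree is left as often as it is entered, so using the boundary
edge outside of the tree forces the use of the tree edge. These conditions form `IsFlow`. They hold
for the edges of every path (`isFlow_of_isPath`), and conversely every edge set with these
properties contains a path (`exists_path`). Each of them is a conjunction of clauses with at most
two literals.

Deletions are two-literal clauses as well, because the order of traversal does not depend on the
path. Every path enters a given edge at the same end, its tail, and visits its vertices in the order
of a fixed key (`dart_of_isPath`). The key consists of the number of the last ancestor on the tree
path from `s` to `t`, and of a rank that grows or falls along a side branch according to the
direction in which the cycle through it is traversed. Hence a pair with `e ∈ f(v)` matters only if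
the key of `v` is at most that of the tail of `e`, and then it forbids that `v` and `e` are both
used. With a variable for every edge and every vertex, and implications from edges to their tails, a
conforming path exists if and only if the clauses are satisfiable (`hasConformingPath_iff`). Surplus
edges and vertices in a solution do no harm, so implications in one direction suffice.

For linear time, the clauses are produced by two walkers that climb from the ends of each edge
outside of the tree until they meet; as the cycles are edge-disjoint, all these walks together take
O(|V|) steps (`cover_run`). Satisfiability is decided by the method of Even, Itai and Shamir
(`solve_run`): for a variable without a value, the consequences of both of its literals are explored
in lockstep, and a side that ends without contradiction is kept for good. The time is charged to the
literals and implications that receive their values. The step counts are carried through loop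
invariants, mostly in amortized form. -/

/-! ### A program logic for the machine -/

namespace Ram

@[simp] theorem State.setReg_reg (σ : State) (x w y : ℕ) :
    (σ.setReg x w).reg y = if y = x then w else σ.reg y := by
  simp [State.setReg, Function.update_apply]

@[simp] theorem State.setReg_arr (σ : State) (x w : ℕ) : (σ.setReg x w).arr = σ.arr := rfl

@[simp] theorem State.setArr_reg (σ : State) (a i w : ℕ) : (σ.setArr a i w).reg = σ.reg := rfl

@[simp] theorem State.setArr_arr (σ : State) (a i w b : ℕ) :
    (σ.setArr a i w).arr b = if b = a then Function.update (σ.arr a) i w else σ.arr b := by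
  simp [State.setArr, Function.update_apply]

/-- All registers and all array cells hold words. -/
structure State.Bdd (B : ℕ) (σ : State) : Prop where
  reg : ∀ x, σ.reg x < B
  arr : ∀ a i, σ.arr a i < B

/-- The part of `Expr.Fits` that is not automatic in a state that holds only words. -/
def Expr.Ok (B : ℕ) (σ : State) : Expr → Prop
  | const c => c < B
  | reg _ => True
  | get _ i => i.Ok B σ
  | bin .add e₁ e₂ => e₁.Ok B σ ∧ e₂.Ok B σ ∧ e₁.val σ + e₂.val σ < B
  | bin .sub e₁ e₂ => e₁.Ok B σ ∧ e₂.Ok B σ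
  | bin .lt e₁ e₂ => e₁.Ok B σ ∧ e₂.Ok B σ
  | bin .eq e₁ e₂ => e₁.Ok B σ ∧ e₂.Ok B σ

theorem Expr.Fits.val_lt {B : ℕ} {σ : State} {e : Expr} (h : e.Fits B σ) : e.val σ < B := by
  cases e with
  | const c => exact h
  | reg x => exact h
  | get a i => exact h.2
  | bin o e₁ e₂ => exact h.2.2

theorem Expr.Ok.fits {B : ℕ} {σ : State} (hB : 1 < B) (hσ : σ.Bdd B) {e : Expr}
    (h : e.Ok B σ) : e.Fits B σ := by
  induction e with
  | const c => exact h
  | reg x => exact hσ.reg x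
  | get a i ih => exact ⟨ih h, hσ.arr _ _⟩
  | bin o e₁ e₂ ih₁ ih₂ =>
    cases o with
    | add => exact ⟨ih₁ h.1, ih₂ h.2.1, h.2.2⟩
    | sub => exact ⟨ih₁ h.1, ih₂ h.2, lt_of_le_of_lt (Nat.sub_le _ _) (ih₁ h.1).val_lt⟩
    | lt =>
      refine ⟨ih₁ h.1, ih₂ h.2, ?_⟩
      simp only [Op.eval]; split <;> omega
    | eq =>
      refine ⟨ih₁ h.1, ih₂ h.2, ?_⟩
      simp only [Op.eval]; split <;> omega

/-! ### Loop-free programs and syntactic write sets. -/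

namespace Prog

/-- The registers that a program may write. -/
def wregs : Prog → List ℕ
  | skip => []
  | set x _ => [x]
  | put _ _ _ => []
  | seq P Q => P.wregs ++ Q.wregs
  | cond _ P Q => P.wregs ++ Q.wregs
  | loop _ P => P.wregs

/-- The arrays that a program may write. -/
def warrs : Prog → List ℕ
  | skip => []
  | set _ _ => []
  | put a _ _ => [a]
  | seq P Q => P.warrs ++ Q.warrs
  | cond _ P Q => P.warrs ++ Q.warrs
  | loop _ P => P.warrs

/-- The result of a program without loops. -/
def eval : Prog → State → State
  | skip, σ => σ
  | set x e, σ => σ.setReg x (e.val σ)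
  | put a i e, σ => σ.setArr a (i.val σ) (e.val σ)
  | seq P Q, σ => Q.eval (P.eval σ)
  | cond e P Q, σ => if e.val σ ≠ 0 then P.eval σ else Q.eval σ
  | loop _ _, σ => σ

/-- An upper bound for the number of steps of a program without loops. -/
def time : Prog → ℕ
  | skip => 1
  | set _ e => e.cost + 1
  | put _ i e => i.cost + e.cost + 1
  | seq P Q => P.time + Q.time
  | cond e P Q => e.cost + 1 + max P.time Q.time
  | loop _ _ => 0

/-- A program without loops does not get stuck. -/
def Ok (B : ℕ) : Prog → State → Prop
  | skip, _ => True
  | set _ e, σ => e.Ok B σ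
  | put _ i e, σ => i.Ok B σ ∧ e.Ok B σ
  | seq P Q, σ => P.Ok B σ ∧ Q.Ok B (P.eval σ)
  | cond e P Q, σ => e.Ok B σ ∧ (e.val σ ≠ 0 → P.Ok B σ) ∧ (e.val σ = 0 → Q.Ok B σ)
  | loop _ _, _ => False

end Prog

/-- Two states agree outside of what `P` may write. -/
structure Frame (P : Prog) (σ σ' : State) : Prop where
  reg : ∀ x, x ∉ P.wregs → σ'.reg x = σ.reg x
  arr : ∀ a, a ∉ P.warrs → σ'.arr a = σ.arr a

theorem Frame.refl (P : Prog) (σ : State) : Frame P σ σ := ⟨fun _ _ => rfl, fun _ _ => rfl⟩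

theorem Frame.trans {P : Prog} {σ₁ σ₂ σ₃ : State} (h₁ : Frame P σ₁ σ₂) (h₂ : Frame P σ₂ σ₃) :
    Frame P σ₁ σ₃ :=
  ⟨fun x hx => (h₂.reg x hx).trans (h₁.reg x hx), fun a ha => (h₂.arr a ha).trans (h₁.arr a ha)⟩

theorem Frame.mono {P Q : Prog} {σ σ' : State} (h : Frame P σ σ')
    (hr : ∀ x ∈ P.wregs, x ∈ Q.wregs) (ha : ∀ x ∈ P.warrs, x ∈ Q.warrs) : Frame Q σ σ' :=
  ⟨fun x hx => h.reg x fun hx' => hx (hr x hx'), fun a h' => h.arr a fun h'' => h' (ha a h'')⟩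

/-- Writing is visible in the syntax. For a concrete program, membership in `wregs` and `warrs` is
decidable, so that preservation of data across whole phases of the algorithm is proved by `decide`
or `simp`. -/
theorem Exec.frame {B : ℕ} {P : Prog} {σ σ' : State} {k : ℕ} (h : Exec B P σ k σ') :
    Frame P σ σ' := by
  induction h with
  | skip σ => exact Frame.refl _ _
  | set x e σ he =>
    refine ⟨fun y hy => ?_, fun _ _ => rfl⟩
    simp only [Prog.wregs, List.mem_singleton] at hy
    simp [hy]
  | put a i e σ hi he =>
    refine ⟨fun _ _ => rfl, fun b hb => ?_⟩
    simp only [Prog.warrs, List.mem_singleton] at hb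
    simp [hb]
  | seq hP hQ ihP ihQ =>
    refine (ihP.mono ?_ ?_).trans (ihQ.mono ?_ ?_) <;> intro x hx <;>
      simp [Prog.wregs, Prog.warrs, hx]
  | condTrue he h hP ih => refine ih.mono ?_ ?_ <;> intro x hx <;> simp [Prog.wregs, Prog.warrs, hx]
  | condFalse he h hP ih =>
    refine ih.mono ?_ ?_ <;> intro x hx <;> simp [Prog.wregs, Prog.warrs, hx]
  | loopDone he h => exact Frame.refl _ _
  | loopStep he h hP hL ihP ihL =>
    exact Frame.trans (P := Prog.loop _ _) (ihP.mono (fun _ h => h) fun _ h => h) ihL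

theorem State.Bdd.setReg {B : ℕ} {σ : State} (h : σ.Bdd B) (x : ℕ) {w : ℕ} (hw : w < B) :
    (σ.setReg x w).Bdd B := by
  refine ⟨fun y => ?_, h.arr⟩
  rw [State.setReg_reg]
  split
  exacts [hw, h.reg y]

theorem State.Bdd.setArr {B : ℕ} {σ : State} (h : σ.Bdd B) (a i : ℕ) {w : ℕ} (hw : w < B) :
    (σ.setArr a i w).Bdd B := by
  refine ⟨h.reg, fun b j => ?_⟩
  rw [State.setArr_arr]
  split
  · rw [Function.update_apply]
    split
    exacts [hw, h.arr a j]
  · exact h.arr b j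

/-- Every value that is written has passed `Fits`. Therefore reads never need a bound of their own,
and `Ok` has to examine only constants and additions. -/
theorem Exec.bdd {B : ℕ} {P : Prog} {σ σ' : State} {k : ℕ} (h : Exec B P σ k σ')
    (hσ : σ.Bdd B) : σ'.Bdd B := by
  induction h with
  | skip σ => exact hσ
  | set x e σ he => exact hσ.setReg x he.val_lt
  | put a i e σ hi he => exact hσ.setArr a _ he.val_lt
  | seq hP hQ ihP ihQ => exact ihQ (ihP hσ)
  | condTrue he h hP ih => exact ih hσ
  | condFalse he h hP ih => exact ih hσ
  | loopDone he h => exact hσ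
  | loopStep he h hP hL ihP ihL => exact ihL (ihP hσ)

/-- Loop-free code is thus verified by computing `Ok`, `eval` and `time` symbolically; only loops
need invariants. -/
theorem Prog.Ok.exec {B : ℕ} (hB : 1 < B) {P : Prog} :
    ∀ {σ : State}, σ.Bdd B → P.Ok B σ → ∃ k ≤ P.time, Exec B P σ k (P.eval σ) := by
  induction P with
  | skip => exact fun _ _ => ⟨1, le_rfl, Exec.skip _⟩
  | set x e => exact fun hσ h => ⟨_, le_rfl, Exec.set x e _ (h.fits hB hσ)⟩
  | put a i e => exact fun hσ h => ⟨_, le_rfl, Exec.put a i e _ (h.1.fits hB hσ) (h.2.fits hB hσ)⟩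
  | seq P Q ihP ihQ =>
    intro σ hσ h
    obtain ⟨k, hk, hP⟩ := ihP hσ h.1
    obtain ⟨l, hl, hQ⟩ := ihQ (hP.bdd hσ) h.2
    exact ⟨k + l, Nat.add_le_add hk hl, hP.seq hQ⟩
  | cond e P Q ihP ihQ =>
    intro σ hσ h
    by_cases he : e.val σ = 0
    · obtain ⟨k, hk, hQ⟩ := ihQ hσ (h.2.2 he)
      refine ⟨e.cost + 1 + k, ?_, ?_⟩
      · simp only [Prog.time]; omega
      · simpa [Prog.eval, he] using Exec.condFalse (h.1.fits hB hσ) he hQ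
    · obtain ⟨k, hk, hP⟩ := ihP hσ (h.2.1 he)
      refine ⟨e.cost + 1 + k, ?_, ?_⟩
      · simp only [Prog.time]; omega
      · simpa [Prog.eval, he] using Exec.condTrue (h.1.fits hB hσ) he hP
  | loop e P => exact fun _ h => h.elim

/-- The program halts, and the number of steps and the final state satisfy `Q`. -/
def Run (B : ℕ) (P : Prog) (σ : State) (Q : ℕ → State → Prop) : Prop :=
  ∃ k σ', Exec B P σ k σ' ∧ Q k σ'

variable {B : ℕ} {P P' : Prog} {σ : State} {Q Q' : ℕ → State → Prop}

theorem Run.mono (h : Run B P σ Q) (hQ : ∀ k σ', Q k σ' → Q' k σ') : Run B P σ Q' := by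
  obtain ⟨k, σ', he, hq⟩ := h
  exact ⟨k, σ', he, hQ k σ' hq⟩

/-- The postcondition may assume that all values are words, and that nothing outside of what `P`
writes has changed. -/
theorem Run.mono_frame (hσ : σ.Bdd B) (h : Run B P σ Q)
    (hQ : ∀ k σ', Q k σ' → σ'.Bdd B → Frame P σ σ' → Q' k σ') : Run B P σ Q' := by
  obtain ⟨k, σ', he, hq⟩ := h
  exact ⟨k, σ', he, hQ k σ' hq (he.bdd hσ) he.frame⟩

theorem Run.of_ok (hB : 1 < B) (hσ : σ.Bdd B) (h : P.Ok B σ)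
    (hQ : ∀ k ≤ P.time, Q k (P.eval σ)) : Run B P σ Q := by
  obtain ⟨k, hk, he⟩ := h.exec hB hσ
  exact ⟨k, _, he, hQ k hk⟩

theorem Run.seq (h : Run B P σ fun k σ' => Run B P' σ' fun l σ'' => Q (k + l) σ'') :
    Run B (P.seq P') σ Q := by
  obtain ⟨k, σ', he, l, σ'', he', hq⟩ := h
  exact ⟨k + l, σ'', he.seq he', hq⟩

theorem Run.cond {e : Expr} (hB : 1 < B) (hσ : σ.Bdd B) (he : e.Ok B σ)
    (ht : e.val σ ≠ 0 → Run B P σ fun k => Q (e.cost + 1 + k))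
    (hf : e.val σ = 0 → Run B P' σ fun k => Q (e.cost + 1 + k)) :
    Run B (.cond e P P') σ Q := by
  by_cases h : e.val σ = 0
  · obtain ⟨k, σ', hx, hq⟩ := hf h
    exact ⟨_, σ', Exec.condFalse (he.fits hB hσ) h hx, hq⟩
  · obtain ⟨k, σ', hx, hq⟩ := ht h
    exact ⟨_, σ', Exec.condTrue (he.fits hB hσ) h hx, hq⟩

/-- The loop rule: `I n k σ` is the invariant, where `n` is a variant and `k` is the number of
steps made so far. -/
theorem Run.loop {e : Expr} (hB : 1 < B) (hσ : σ.Bdd B) (I : ℕ → ℕ → State → Prop) (n₀ : ℕ)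
    (h₀ : I n₀ 0 σ)
    (hI : ∀ n k σ', σ'.Bdd B → Frame P σ σ' → I n k σ' → e.Ok B σ' ∧
      (e.val σ' = 0 → Q (k + (e.cost + 1)) σ') ∧
      (e.val σ' ≠ 0 → Run B P σ' fun l σ'' => ∃ n' < n, I n' (k + (e.cost + 1 + l)) σ'')) :
    Run B (.loop e P) σ Q := by
  -- The claim is generalized over the number `k` of steps already made. So the invariant may bound
  -- the total time by a potential instead of bounding each round separately.
  suffices H : ∀ n k σ', σ'.Bdd B → Frame P σ σ' → I n k σ' →
      Run B (.loop e P) σ' fun l σ'' => Q (k + l) σ'' by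
    simpa using H n₀ 0 σ hσ (Frame.refl _ _) h₀
  intro n
  induction n using Nat.strong_induction_on with
  | _ n ih =>
    intro k σ' hb hf hi
    obtain ⟨hok, hd, hs⟩ := hI n k σ' hb hf hi
    by_cases h : e.val σ' = 0
    · exact ⟨_, σ', Exec.loopDone (hok.fits hB hb) h, hd h⟩
    · obtain ⟨l, σ'', he, n', hn, hi'⟩ := hs h
      obtain ⟨l', σ₃, he', hq⟩ := ih n' hn _ σ'' (he.bdd hb) (hf.trans he.frame) hi'
      refine ⟨_, σ₃, Exec.loopStep (hok.fits hB hb) h he he', ?_⟩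
      convert hq using 1
      omega

/-- A loop in which the register `x` counts up to the value of the register `y`. The number `k` in
`I i k σ` is the number of steps made so far. -/
theorem Run.for {x y : ℕ} (hB : 1 < B) (hσ : σ.Bdd B) (I : ℕ → ℕ → State → Prop) (a n : ℕ)
    (hx : ∀ i k σ', I i k σ' → σ'.reg x = i) (hy : σ.reg y = n) (hyP : y ∉ P.wregs)
    (han : a ≤ n) (h₀ : I a 0 σ)
    (hI : ∀ i k σ', σ'.Bdd B → Frame P σ σ' → I i k σ' → a ≤ i → i < n →
      Run B P σ' fun l σ'' => I (i + 1) (k + (l + 4)) σ'') :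
    Run B (.loop (.bin .lt (.reg x) (.reg y)) P) σ fun k σ' => ∃ l, k = l + 4 ∧ I n l σ' := by
  -- The number `4` in the statement is the price of one loop test: three for comparing two
  -- registers and one for the branch. The last, failing test is paid separately.
  refine Run.loop hB hσ (fun v k σ' => ∃ i, a ≤ i ∧ i ≤ n ∧ v = n - i ∧ I i k σ') (n - a)
    ⟨a, le_rfl, han, rfl, h₀⟩ ?_
  rintro v k σ' hb hf ⟨i, hai, hin, rfl, hi⟩
  have hxi := hx i k σ' hi
  have hyn : σ'.reg y = n := (hf.reg y hyP).trans hy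
  refine ⟨⟨trivial, trivial⟩, fun h => ?_, fun h => ?_⟩
  · simp only [Expr.val, Op.eval, hxi, hyn] at h
    have : i = n := by
      by_contra hne
      simp [show i < n by omega] at h
    subst this
    exact ⟨k, rfl, hi⟩
  · simp only [Expr.val, Op.eval, hxi, hyn] at h
    have hlt : i < n := by
      by_contra hne
      simp [hne] at h
    refine (hI i k σ' hb hf hi hai hlt).mono fun l σ'' h' => ?_
    refine ⟨n - (i + 1), by omega, i + 1, by omega, by omega, rfl, ?_⟩
    convert h' using 1
    simp only [Expr.cost]
    omega

end Ram

/-! ### Adjacency lists and graph search -/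

namespace Ram

/-- The successor (`0` for none) of the last position below `M` at which the value of `src` is
`v`. -/
def ptr (src : ℕ → ℕ) : ℕ → ℕ → ℕ
  | 0, _ => 0
  | M + 1, v => if src M = v then M + 1 else ptr src M v

/-- The number of positions below `M` at which the value of `src` is `v`. -/
def cnt (src : ℕ → ℕ) : ℕ → ℕ → ℕ
  | 0, _ => 0
  | M + 1, v => cnt src M v + if src M = v then 1 else 0

section ptr

variable {src src' : ℕ → ℕ} {M v : ℕ}

theorem ptr_congr (h : ∀ j < M, src j = src' j) : ptr src M v = ptr src' M v := by
  induction M with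
  | zero => rfl
  | succ M ih =>
    simp only [ptr]
    rw [ih fun j hj => h j (by omega), h M (by omega)]

theorem ptr_le : ptr src M v ≤ M := by
  induction M with
  | zero => simp [ptr]
  | succ M ih =>
    simp only [ptr]
    split <;> omega

theorem src_ptr (h : ptr src M v ≠ 0) : src (ptr src M v - 1) = v := by
  induction M with
  | zero => simp [ptr] at h
  | succ M ih =>
    by_cases hs : src M = v
    · simp [ptr, hs]
    · simp only [ptr, hs, if_false] at h ⊢
      exact ih h

theorem lt_ptr {j : ℕ} (hj : j < M) (h : src j = v) : j < ptr src M v := by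
  induction M with
  | zero => omega
  | succ M ih =>
    simp only [ptr]
    split
    · omega
    · rename_i hM
      refine ih (lt_of_le_of_ne (by omega) ?_)
      rintro rfl
      exact hM h

/-- The positions that `ptr` skips have other sources, so `cnt` at a pointer counts exactly the
entries that remain in the list. -/
theorem cnt_ptr : cnt src (ptr src M v) v = cnt src M v := by
  induction M with
  | zero => rfl
  | succ M ih =>
    by_cases hs : src M = v
    · simp [ptr, hs]
    · simp [ptr, cnt, hs, ih]

/-- One step along a list consumes one entry. This is the unit of work in `SearchInv.work`. -/
theorem cnt_of_pos {p : ℕ} (hp : p ≠ 0) (h : src (p - 1) = v) :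
    cnt src p v = cnt src (ptr src (p - 1) v) v + 1 := by
  obtain ⟨p, rfl⟩ := Nat.exists_eq_succ_of_ne_zero hp
  simp only [Nat.succ_eq_add_one, Nat.add_sub_cancel] at h
  simp [cnt, cnt_ptr, h]

theorem sum_cnt_le {N : ℕ} (M : ℕ) : ∑ v ∈ Finset.range N, cnt src M v ≤ M := by
  induction M with
  | zero => simp [cnt]
  | succ M ih =>
    simp only [cnt, Finset.sum_add_distrib, Finset.sum_ite_eq]
    split <;> omega

end ptr

/-- `head` and `nxt` form linked lists of the positions below `M` by their value under `src`.
Pointers are positions plus one, and `0` is the end of a list. -/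
structure AdjRep (head nxt src : ℕ → ℕ) (M : ℕ) : Prop where
  head_eq : ∀ v, head v = ptr src M v
  nxt_eq : ∀ j < M, nxt j = ptr src j (src j)

/-- The new arc is put in front of the list of its source. The link stored at a position depends
only on earlier positions, so the old links stay correct. -/
theorem AdjRep.add {head nxt src : ℕ → ℕ} {M : ℕ} (h : AdjRep head nxt src M) (x : ℕ) :
    AdjRep (Function.update head x (M + 1)) (Function.update nxt M (head x))
      (Function.update src M x) (M + 1) := by
  have hc : ∀ j ≤ M, ∀ v, ptr (Function.update src M x) j v = ptr src j v := fun j hj v =>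
    ptr_congr fun i hi => Function.update_of_ne (by omega) _ _
  refine ⟨fun v => ?_, fun j hj => ?_⟩
  · by_cases hv : v = x
    · simp [hv, ptr]
    · simp [ptr, hv, hc M le_rfl, h.head_eq, Ne.symm hv]
  · rw [hc j (by omega)]
    by_cases hj' : j = M
    · subst hj'
      simp [h.head_eq]
    · simp only [Function.update_of_ne hj']
      exact h.nxt_eq j (by omega)

/-- The state of a search in the graph with the arcs `src j → dst j` for `j < M`, which starts at
`root`, does not enter vertices with a nonzero value of `val`, and marks vertices by `st`.
The queue is `q 0, …, q (qt - 1)`, the arcs out of `q 0, …, q (qh - 1)` have been inspected,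
except for those from the pointer `p` on in the list of `cur`, and `w` is the number of steps. -/
structure SearchInv (src dst val : ℕ → ℕ) (M N root st : ℕ) (mark q num pv pj : ℕ → ℕ)
    (p qh qt cur w : ℕ) : Prop where
  num_q : ∀ i < qt, num (q i) = i
  mark_q : ∀ i < qt, mark (q i) = st
  mark_le : ∀ v, mark v ≤ st
  val_q : ∀ i < qt, val (q i) = 0
  q_lt : ∀ i < qt, q i < N
  num_lt : ∀ v, mark v = st → num v < qt
  q_num : ∀ v, mark v = st → q (num v) = v
  qt_pos : 0 < qt
  q_zero : q 0 = root
  qh_le : qh ≤ qt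
  p_le : p ≤ M
  qh_pos : p ≠ 0 → 0 < qh
  q_cur : p ≠ 0 → q (qh - 1) = cur
  src_p : p ≠ 0 → src (p - 1) = cur
  closed : ∀ j < M, mark (src j) = st → num (src j) < qh → src j = cur ∧ j < p ∨
    mark (dst j) = st ∨ val (dst j) ≠ 0
  tree : ∀ v, mark v = st → v ≠ root → pj v < M ∧ src (pj v) = pv v ∧ dst (pj v) = v ∧
    mark (pv v) = st ∧ num (pv v) < num v
  work : w + cnt src p cur = ∑ i ∈ Finset.range qh, (1 + cnt src M (q i))

/-! ### Preservation and consequences of the search invariant. -/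

section SearchInv

variable {src dst val : ℕ → ℕ} {M N root st : ℕ} {mark q num pv pj : ℕ → ℕ} {p qh qt cur w : ℕ}

/-- The mark is a time stamp larger than all earlier ones. Raising it unmarks all vertices at once,
so many searches can share the arrays without clearing them. -/
theorem SearchInv.start (hst : ∀ v, mark v < st) (hr : root < N) (hv : val root = 0) :
    SearchInv src dst val M N root st (Function.update mark root st) (Function.update q 0 root)
      (Function.update num root 0) pv pj 0 0 1 cur 0 := by
  have hm : ∀ v, Function.update mark root st v = st → v = root := by
    intro v h
    by_contra hne
    rw [Function.update_of_ne hne] at h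
    exact (hst v).ne h
  constructor <;> try (simp [cnt, hr, hv]; done)
  · intro v
    by_cases hvr : v = root
    · simp [hvr]
    · simpa [hvr] using (hst v).le
  · intro v h; simp [hm v h]
  · intro v h; simp [hm v h]
  · intro v h h'; exact absurd (hm v h) h'

/-- No vertex is queued twice, because `num` inverts `q` on the queue. -/
theorem SearchInv.qt_le (h : SearchInv src dst val M N root st mark q num pv pj p qh qt cur w) :
    qt ≤ N := by
  have := Finset.card_le_card_of_injOn (s := Finset.range qt) (t := Finset.range N) q
    (fun i hi => by simpa using h.q_lt i (by simpa using hi))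
    (fun i hi j hj hij => by
      rw [← h.num_q i (by simpa using hi), ← h.num_q j (by simpa using hj)]
      exact congrArg num hij)
  simpa using this

theorem SearchInv.q_injOn
    (h : SearchInv src dst val M N root st mark q num pv pj p qh qt cur w) :
    Set.InjOn q (Finset.range qt) := fun i hi j hj hij => by
  rw [← h.num_q i (by simpa using hi), ← h.num_q j (by simpa using hj)]
  exact congrArg num hij

theorem SearchInv.work_le
    (h : SearchInv src dst val M N root st mark q num pv pj p qh qt cur w) :
    w ≤ ∑ i ∈ Finset.range qt, (1 + cnt src M (q i)) :=
  calc w ≤ w + cnt src p cur := Nat.le_add_right _ _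
    _ = _ := h.work
    _ ≤ _ := Finset.sum_le_sum_of_subset (Finset.range_subset_range.2 h.qh_le)

/-- Each vertex is taken from the queue at most once and each arc belongs to the list of one vertex,
so the work is at most the size of the graph. This also bounds the variant of the search loop. -/
theorem SearchInv.work_le_size
    (h : SearchInv src dst val M N root st mark q num pv pj p qh qt cur w) : w ≤ N + M := by
  refine h.work_le.trans ?_
  rw [← Finset.sum_image (f := fun v => 1 + cnt src M v) h.q_injOn]
  calc _ ≤ ∑ v ∈ Finset.range N, (1 + cnt src M v) := by
        refine Finset.sum_le_sum_of_subset fun v hv => ?_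
        obtain ⟨i, hi, rfl⟩ := Finset.mem_image.1 hv
        exact Finset.mem_range.2 (h.q_lt i (Finset.mem_range.1 hi))
    _ ≤ N + M := by
        rw [Finset.sum_add_distrib]
        simpa using sum_cnt_le M

/-- The next arc leads to a vertex that is not to be entered. -/
theorem SearchInv.pass (h : SearchInv src dst val M N root st mark q num pv pj p qh qt cur w)
    (hp : p ≠ 0) (hy : mark (dst (p - 1)) = st ∨ val (dst (p - 1)) ≠ 0) :
    SearchInv src dst val M N root st mark q num pv pj (ptr src (p - 1) cur) qh qt cur
      (w + 1) := by
  have hsrc := h.src_p hp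
  refine { h with
    p_le := ptr_le.trans (by have := h.p_le; omega)
    qh_pos := fun _ => h.qh_pos hp
    q_cur := fun _ => h.q_cur hp
    src_p := fun h' => src_ptr h'
    closed := fun j hj hm hn => ?_
    work := ?_ }
  · rcases h.closed j hj hm hn with ⟨h1, h2⟩ | h1
    · by_cases hjp : j = p - 1
      · subst hjp
        exact Or.inr hy
      · exact Or.inl ⟨h1, lt_ptr (by omega) h1⟩
    · exact Or.inr h1
  · have := h.work
    rw [cnt_of_pos hp hsrc] at this
    omega

/-- The next arc leads to a vertex that is to be entered. -/
theorem SearchInv.visit (h : SearchInv src dst val M N root st mark q num pv pj p qh qt cur w)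
    (hp : p ≠ 0) {y : ℕ} (hy : dst (p - 1) = y) (hm : mark y ≠ st) (hv : val y = 0)
    (hN : y < N) :
    SearchInv src dst val M N root st (Function.update mark y st) (Function.update q qt y)
      (Function.update num y qt) (Function.update pv y cur) (Function.update pj y (p - 1))
      (ptr src (p - 1) cur) qh (qt + 1) cur (w + 1) := by
  have hsrc := h.src_p hp
  have hmu : ∀ {v}, Function.update mark y st v = st → v ≠ y → mark v = st := by
    intro v h hne
    rwa [Function.update_of_ne hne] at h
  have hcm : mark cur = st := by
    rw [← h.q_cur hp]
    exact h.mark_q _ (by have := h.qh_pos hp; have := h.qh_le; omega)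
  have hcn : num cur < qt := h.num_lt cur hcm
  have hqy : ∀ i < qt, q i ≠ y := fun i hi he => hm (he ▸ h.mark_q i hi)
  have hcy : cur ≠ y := fun he => hm (he ▸ hcm)
  have hqh := h.qh_le
  have hpos := h.qh_pos hp
  constructor
  · intro i hi
    by_cases hiq : i = qt
    · simp [hiq]
    · simp [hiq, hqy i (by omega), h.num_q i (by omega)]
  · intro i hi
    by_cases hiq : i = qt
    · simp [hiq]
    · simp [hiq, hqy i (by omega), h.mark_q i (by omega)]
  · intro v
    by_cases hvy : v = y
    · simp [hvy]
    · simpa [hvy] using h.mark_le v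
  · intro i hi
    by_cases hiq : i = qt
    · simp [hiq, hv]
    · simp [hiq, h.val_q i (by omega)]
  · intro i hi
    by_cases hiq : i = qt
    · simp [hiq, hN]
    · simp [hiq, h.q_lt i (by omega)]
  · intro v hv'
    by_cases hvy : v = y
    · simp [hvy]
    · have := h.num_lt v (hmu hv' hvy)
      simp [hvy]; omega
  · intro v hv'
    by_cases hvy : v = y
    · simp [hvy]
    · have := h.num_lt v (hmu hv' hvy)
      have h2 := h.q_num v (hmu hv' hvy)
      simp [hvy, this.ne, h2]
  · omega
  · rw [Function.update_of_ne (by omega)]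
    exact h.q_zero
  · omega
  · exact ptr_le.trans (by have := h.p_le; omega)
  · exact fun _ => hpos
  · intro _
    rw [Function.update_of_ne (by omega)]
    exact h.q_cur hp
  · exact fun h' => src_ptr h'
  · intro j hj hm' hn
    by_cases hjy : dst j = y
    · right; left; simp [hjy]
    -- Arcs out of the new vertex are not yet claimed to be closed: its number `qt` is not below
    -- `qh`.
    · by_cases hsy : src j = y
      · simp only [hsy, Function.update_self] at hn
        omega
      · rw [Function.update_of_ne hsy] at hn
        rcases h.closed j hj (hmu hm' hsy) hn with ⟨h1, h2⟩ | h1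
        · by_cases hjp : j = p - 1
          · subst hjp
            exact absurd hy hjy
          · exact Or.inl ⟨h1, lt_ptr (by omega) h1⟩
        · right
          rwa [Function.update_of_ne hjy]
  · intro v hv' hvr
    by_cases hvy : v = y
    · subst hvy
      have := h.p_le
      simp only [Function.update_self, Function.update_of_ne hcy, hsrc, hy, hcm, hcn, and_self,
        and_true]
      omega
    · obtain ⟨h1, h2, h3, h4, h5⟩ := h.tree v (hmu hv' hvy) hvr
      have h6 : pv v ≠ y := fun he => hm (he ▸ h4)
      simp only [Function.update_of_ne hvy, Function.update_of_ne h6]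
      exact ⟨h1, h2, h3, h4, h5⟩
  · have h1 := h.work
    rw [cnt_of_pos hp hsrc] at h1
    rw [Finset.sum_congr rfl (g := fun i => 1 + cnt src M (q i))]
    · omega
    · intro i hi
      rw [Function.update_of_ne]
      have := Finset.mem_range.1 hi
      omega

/-- The list of the current vertex is exhausted, and the next vertex is taken from the queue. -/
theorem SearchInv.pop (h : SearchInv src dst val M N root st mark q num pv pj 0 qh qt cur w)
    (hq : qh < qt) :
    SearchInv src dst val M N root st mark q num pv pj (ptr src M (q qh)) (qh + 1) qt (q qh)
      (w + 1) := by
  refine { h with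
    qh_le := hq
    p_le := ptr_le
    qh_pos := fun _ => by omega
    q_cur := fun _ => by simp
    src_p := fun h' => src_ptr h'
    closed := fun j hj hm hn => ?_
    work := ?_ }
  -- Only the arcs out of `q qh` come under the claim now, and all of them are still ahead of the
  -- new pointer. For the others the exception `j < p` was void, since the pointer was `0`.
  · by_cases hj' : num (src j) = qh
    · have : src j = q qh := by rw [← hj', h.q_num _ hm]
      exact Or.inl ⟨this, lt_ptr hj this⟩
    · rcases h.closed j hj hm (by omega) with ⟨_, h2⟩ | h1
      · omega
      · exact Or.inr h1
  · have := h.work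
    rw [Finset.sum_range_succ, cnt_ptr]
    simp only [cnt] at this
    omega

/-- At the end, the set of the marked vertices is closed. -/
theorem SearchInv.closed_of_done
    (h : SearchInv src dst val M N root st mark q num pv pj 0 qt qt cur w) {j : ℕ} (hj : j < M)
    (hm : mark (src j) = st) : mark (dst j) = st ∨ val (dst j) ≠ 0 := by
  rcases h.closed j hj hm (h.num_lt _ hm) with ⟨_, h2⟩ | h1
  · omega
  · exact h1

/-- Marked vertices are reachable. -/
theorem SearchInv.reach (h : SearchInv src dst val M N root st mark q num pv pj p qh qt cur w)
    {v : ℕ} (hv : mark v = st) :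
    Relation.ReflTransGen (fun x y => ∃ j < M, src j = x ∧ dst j = y) root v := by
  induction hn : num v using Nat.strong_induction_on generalizing v with
  | _ n ih =>
    by_cases hr : v = root
    · rw [hr]
    · obtain ⟨h1, h2, h3, h4, h5⟩ := h.tree v hv hr
      exact (ih _ (hn ▸ h5) h4 rfl).tail ⟨_, h1, h2, h3⟩

theorem SearchInv.mark_root
    (h : SearchInv src dst val M N root st mark q num pv pj p qh qt cur w) : mark root = st := by
  rw [← h.q_zero]
  exact h.mark_q 0 h.qt_pos

end SearchInv

-- Programs for adjacency lists and for the search.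

infixr:60 "⨟" => Prog.seq

open Ram.Expr Ram.Prog

/-- Append an arc from `reg x` to `reg y` to the adjacency lists that are kept in the arrays
`g, …, g + 3` (`head`, `nxt`, `src` and `dst`); the register `c` holds the number of the arcs. -/
def addArc (g c x y : ℕ) : Prog :=
  put (g + 1) (reg c) (get g (reg x)) ⨟ put g (reg x) (bin .add (reg c) (const 1)) ⨟
  put (g + 2) (reg c) (reg x) ⨟ put (g + 3) (reg c) (reg y) ⨟ set c (bin .add (reg c) (const 1))

/-- Start a search at the vertex in the register `x`. Registers `r, …, r + 4` hold the values `p`,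
`qh`, `qt` and `cur` of `SearchInv` and a flag for the end, arrays `a, …, a + 4` hold `mark`, `q`,
`num`, `pv` and `pj`, and the register `s` holds the mark. -/
def searchInit (r a s x : ℕ) : Prog :=
  put (a + 1) (const 0) (reg x) ⨟ put (a + 2) (reg x) (const 0) ⨟ put a (reg x) (reg s) ⨟
  set r (const 0) ⨟ set (r + 1) (const 0) ⨟ set (r + 2) (const 1) ⨟ set (r + 4) (const 0)

/-- One step of a search in the graph in the arrays `g, …, g + 3`, where the array `v` marks the
vertices not to be entered. -/
def searchStep (r a g v s : ℕ) : Prog :=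
  cond (reg r)
    (cond (bin .eq (get a (get (g + 3) (bin .sub (reg r) (const 1)))) (reg s)) skip
      (cond (get v (get (g + 3) (bin .sub (reg r) (const 1)))) skip
        (put (a + 1) (reg (r + 2)) (get (g + 3) (bin .sub (reg r) (const 1))) ⨟
         put (a + 2) (get (g + 3) (bin .sub (reg r) (const 1))) (reg (r + 2)) ⨟
         put (a + 3) (get (g + 3) (bin .sub (reg r) (const 1))) (reg (r + 3)) ⨟
         put (a + 4) (get (g + 3) (bin .sub (reg r) (const 1))) (bin .sub (reg r) (const 1)) ⨟
         put a (get (g + 3) (bin .sub (reg r) (const 1))) (reg s) ⨟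
         set (r + 2) (bin .add (reg (r + 2)) (const 1)))) ⨟
     set r (get (g + 1) (bin .sub (reg r) (const 1))))
    (cond (bin .lt (reg (r + 1)) (reg (r + 2)))
      (set (r + 3) (get (a + 1) (reg (r + 1))) ⨟ set r (get g (reg (r + 3))) ⨟
       set (r + 1) (bin .add (reg (r + 1)) (const 1)))
      (set (r + 4) (const 1)))

/-- Run a search to its end. -/
def searchLoop (r a g v s : ℕ) : Prog :=
  loop (bin .eq (reg (r + 4)) (const 0)) (searchStep r a g v s)

/-- The arcs of the graph in the arrays `g, …, g + 3` are well represented. -/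
structure GraphRep (g M N : ℕ) (σ : State) : Prop where
  adj : AdjRep (σ.arr g) (σ.arr (g + 1)) (σ.arr (g + 2)) M
  dst_lt : ∀ j < M, σ.arr (g + 3) j < N

/-- `SearchInv` for the values in the given registers and arrays. -/
structure SearchAt (r a g v s M N root w : ℕ) (σ : State) : Prop where
  inv : SearchInv (σ.arr (g + 2)) (σ.arr (g + 3)) (σ.arr v) M N root (σ.reg s) (σ.arr a)
    (σ.arr (a + 1)) (σ.arr (a + 2)) (σ.arr (a + 3)) (σ.arr (a + 4)) (σ.reg r) (σ.reg (r + 1))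
    (σ.reg (r + 2)) (σ.reg (r + 3)) w
  done : σ.reg (r + 4) ≠ 0 → σ.reg r = 0 ∧ σ.reg (r + 1) = σ.reg (r + 2)

/-- Registers and arrays of a search are disjoint from those of the graph. -/
structure SearchSep (r a g v s : ℕ) : Prop where
  hs : s < r ∨ r + 4 < s
  hg : g + 3 < a ∨ a + 4 < g
  hv : v < a ∨ a + 4 < v

theorem addArc_run {B : ℕ} {g c x y M N : ℕ} {σ : State} (hB : 1 < B) (hσ : σ.Bdd B)
    (hM : σ.reg c = M) (hMB : M + 1 < B) (hr : GraphRep g M N σ)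
    (hy : σ.reg y < N) :
    Run B (addArc g c x y) σ fun k σ' => k ≤ 30 ∧ GraphRep g (M + 1) N σ' ∧ σ'.reg c = M + 1 ∧
      σ'.arr (g + 2) = Function.update (σ.arr (g + 2)) M (σ.reg x) ∧
      σ'.arr (g + 3) = Function.update (σ.arr (g + 3)) M (σ.reg y) := by
  subst hM
  refine Run.of_ok hB hσ ?_ fun k hk => ⟨hk.trans ?_, ⟨?_, ?_⟩, ?_, ?_, ?_⟩
  · simp [addArc, Prog.Ok, Expr.Ok, Expr.val, Op.eval, Prog.eval, hMB, hB]
  · simp [addArc, Prog.time, Expr.cost]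
  · simpa [addArc, Prog.eval, Expr.val, Op.eval] using hr.adj.add (σ.reg x)
  · intro j hj
    by_cases hj' : j = σ.reg c
    · simp [addArc, Prog.eval, Expr.val, Op.eval, hj', hy]
    · simpa [addArc, Prog.eval, Expr.val, Op.eval, hj'] using hr.dst_lt j (by omega)
  all_goals simp [addArc, Prog.eval, Expr.val, Op.eval]

theorem searchInit_run {B : ℕ} {r a g v s x M N : ℕ} {σ : State} (hB : 1 < B) (hσ : σ.Bdd B)
    (hsep : SearchSep r a g v s) (hst : ∀ i, σ.arr a i < σ.reg s)
    (hx : σ.reg x < N) (hv : σ.arr v (σ.reg x) = 0) :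
    Run B (searchInit r a s x) σ fun k σ' => k ≤ 30 ∧
      SearchAt r a g v s M N (σ.reg x) 0 σ' ∧ σ'.reg (r + 4) = 0 := by
  obtain ⟨hs, hg, hv'⟩ := hsep
  refine Run.of_ok hB hσ ?_ fun k hk => ⟨hk.trans ?_, ⟨?_, ?_⟩, ?_⟩
  · simp [searchInit, Prog.Ok, Expr.Ok, hB]; omega
  · simp [searchInit, Prog.time, Expr.cost]
  · have h1 : g ≠ a ∧ g + 2 ≠ a ∧ g + 2 ≠ a + 1 ∧ g + 2 ≠ a + 2 ∧ g + 3 ≠ a ∧ g + 3 ≠ a + 1 ∧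
        g + 3 ≠ a + 2 ∧ v ≠ a ∧ v ≠ a + 1 ∧ v ≠ a + 2 ∧ s ≠ r ∧ s ≠ r + 1 ∧ s ≠ r + 2 ∧
        s ≠ r + 4 := by omega
    have := SearchInv.start (src := σ.arr (g + 2)) (dst := σ.arr (g + 3)) (val := σ.arr v)
      (mark := σ.arr a) (q := σ.arr (a + 1)) (num := σ.arr (a + 2)) (pv := σ.arr (a + 3))
      (pj := σ.arr (a + 4)) (cur := σ.reg (r + 3)) (M := M) (N := N) hst hx hv
    simpa [searchInit, Prog.eval, Expr.val, h1] using this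
  · simp [searchInit, Prog.eval, Expr.val]
  · simp [searchInit, Prog.eval, Expr.val]

theorem searchStep_run {B : ℕ} {r a g v s M N root w : ℕ} {σ : State} (hB : 1 < B)
    (hσ : σ.Bdd B) (hNB : N + 1 < B) (hsep : SearchSep r a g v s) (hr : GraphRep g M N σ)
    (h : SearchAt r a g v s M N root w σ) (hd : σ.reg (r + 4) = 0) :
    Run B (searchStep r a g v s) σ fun k σ' => k ≤ 90 ∧
      (SearchAt r a g v s M N root (w + 1) σ' ∧ σ'.reg (r + 4) = 0 ∨
       SearchAt r a g v s M N root w σ' ∧ σ'.reg (r + 4) ≠ 0) := by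
  obtain ⟨hs, hg, hv'⟩ := hsep
  have hi := h.inv
  have hqN := hi.qt_le
  have hqh := hi.qh_le
  have hpM := hi.p_le
  have h1 : g ≠ a ∧ g ≠ a + 1 ∧ g ≠ a + 2 ∧ g ≠ a + 3 ∧ g ≠ a + 4 ∧
      g + 1 ≠ a ∧ g + 1 ≠ a + 1 ∧ g + 1 ≠ a + 2 ∧ g + 1 ≠ a + 3 ∧ g + 1 ≠ a + 4 ∧
      g + 2 ≠ a ∧ g + 2 ≠ a + 1 ∧ g + 2 ≠ a + 2 ∧ g + 2 ≠ a + 3 ∧ g + 2 ≠ a + 4 ∧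
      g + 3 ≠ a ∧ g + 3 ≠ a + 1 ∧ g + 3 ≠ a + 2 ∧ g + 3 ≠ a + 3 ∧ g + 3 ≠ a + 4 ∧
      v ≠ a ∧ v ≠ a + 1 ∧ v ≠ a + 2 ∧ v ≠ a + 3 ∧ v ≠ a + 4 ∧
      s ≠ r ∧ s ≠ r + 1 ∧ s ≠ r + 2 ∧ s ≠ r + 3 ∧ s ≠ r + 4 := by omega
  refine Run.of_ok hB hσ ?_ fun k hk => ⟨hk.trans ?_, ?_⟩
  · simp [searchStep, Prog.Ok, Expr.Ok, Expr.val, Op.eval, Prog.eval, hB]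
    omega
  · simp [searchStep, Prog.time, Expr.cost]
  · by_cases hp : σ.reg r = 0
    · by_cases hq : σ.reg (r + 1) < σ.reg (r + 2)
      · left
        have hpop := (hp ▸ hi).pop hq
        refine ⟨⟨?_, ?_⟩, ?_⟩
        · simpa [searchStep, Prog.eval, Expr.val, Op.eval, hp, hq, h1, hr.adj.head_eq] using hpop
        · simp [searchStep, Prog.eval, Expr.val, Op.eval, hp, hq, hd]
        · simp [searchStep, Prog.eval, Expr.val, Op.eval, hp, hq, hd]
      · right
        refine ⟨⟨?_, ?_⟩, ?_⟩
        · simpa [searchStep, Prog.eval, Expr.val, Op.eval, hp, hq, h1] using hp ▸ hi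
        · simp [searchStep, Prog.eval, Expr.val, Op.eval, hp, hq]
          omega
        · simp [searchStep, Prog.eval, Expr.val, Op.eval, hp, hq]
    · left
      have hnx : σ.arr (g + 1) (σ.reg r - 1) = ptr (σ.arr (g + 2)) (σ.reg r - 1) (σ.reg (r + 3)) := by
        rw [hr.adj.nxt_eq _ (by omega), hi.src_p hp]
      by_cases hm : σ.arr a (σ.arr (g + 3) (σ.reg r - 1)) = σ.reg s
      · have := hi.pass hp (Or.inl hm)
        refine ⟨⟨?_, ?_⟩, ?_⟩
        · simpa [searchStep, Prog.eval, Expr.val, Op.eval, hp, hm, h1, hnx] using this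
        · simp [searchStep, Prog.eval, Expr.val, Op.eval, hp, hm, hd]
        · simp [searchStep, Prog.eval, Expr.val, Op.eval, hp, hm, hd]
      · by_cases hvy : σ.arr v (σ.arr (g + 3) (σ.reg r - 1)) = 0
        · have := hi.visit hp rfl hm hvy (hr.dst_lt _ (by omega))
          refine ⟨⟨?_, ?_⟩, ?_⟩
          · simpa [searchStep, Prog.eval, Expr.val, Op.eval, hp, hm, hvy, h1, hnx] using this
          · simp [searchStep, Prog.eval, Expr.val, Op.eval, hp, hm, hvy, hd]
          · simp [searchStep, Prog.eval, Expr.val, Op.eval, hp, hm, hvy, hd]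
        · have := hi.pass hp (Or.inr hvy)
          refine ⟨⟨?_, ?_⟩, ?_⟩
          · simpa [searchStep, Prog.eval, Expr.val, Op.eval, hp, hm, hvy, h1, hnx] using this
          · simp [searchStep, Prog.eval, Expr.val, Op.eval, hp, hm, hvy, hd]
          · simp [searchStep, Prog.eval, Expr.val, Op.eval, hp, hm, hvy, hd]

theorem searchStep_frame {r a g v s : ℕ} {σ σ' : State}
    (h : Frame (searchStep r a g v s) σ σ') :
    (∀ x, x < r ∨ r + 4 < x → σ'.reg x = σ.reg x) ∧
      ∀ b, b < a ∨ a + 4 < b → σ'.arr b = σ.arr b := by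
  refine ⟨fun x hx => h.reg x ?_, fun b hb => h.arr b ?_⟩
  · simp [searchStep, wregs]; omega
  · simp [searchStep, warrs]; omega

theorem GraphRep.congr {g M N : ℕ} {σ σ' : State} (h : GraphRep g M N σ)
    (h' : ∀ i < 4, σ'.arr (g + i) = σ.arr (g + i)) : GraphRep g M N σ' := by
  have h0 := h' 0 (by omega)
  have h1 := h' 1 (by omega)
  have h2 := h' 2 (by omega)
  have h3 := h' 3 (by omega)
  simp only [add_zero] at h0
  exact ⟨by rw [h0, h1, h2]; exact h.adj, by rw [h3]; exact h.dst_lt⟩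

theorem SearchAt.congr {r a g v s M N root w : ℕ} {σ σ' : State}
    (h : SearchAt r a g v s M N root w σ) (hr : ∀ i < 5, σ'.reg (r + i) = σ.reg (r + i))
    (ha : ∀ i < 5, σ'.arr (a + i) = σ.arr (a + i)) (hg : ∀ i < 4, σ'.arr (g + i) = σ.arr (g + i))
    (hv : σ'.arr v = σ.arr v) (hs : σ'.reg s = σ.reg s) :
    SearchAt r a g v s M N root w σ' := by
  have r0 := hr 0 (by omega)
  have a0 := ha 0 (by omega)
  simp only [add_zero] at r0 a0
  constructor
  · rw [hg 2 (by omega), hg 3 (by omega), hv, hs, a0, ha 1 (by omega), ha 2 (by omega),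
      ha 3 (by omega), ha 4 (by omega), r0, hr 1 (by omega), hr 2 (by omega), hr 3 (by omega)]
    exact h.inv
  · rw [r0, hr 1 (by omega), hr 2 (by omega), hr 4 (by omega)]
    exact h.done

/-- Every round but the last raises the work counter by one and costs at most 94 steps with its
test; the additive 100 pays for the round that sets the flag and for the final test. The initial `w`
is arbitrary because this loop also resumes a search that was interrupted. -/
theorem searchLoop_run {B : ℕ} {r a g v s M N root w : ℕ} {σ : State} (hB : 1 < B)
    (hσ : σ.Bdd B) (hNB : N + 1 < B) (hsep : SearchSep r a g v s) (hr : GraphRep g M N σ)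
    (h : SearchAt r a g v s M N root w σ) :
    Run B (searchLoop r a g v s) σ fun k σ' => ∃ w', w ≤ w' ∧ k + 100 * w ≤ 100 * w' + 100 ∧
      SearchAt r a g v s M N root w' σ' ∧ σ'.reg (r + 4) ≠ 0 := by
  refine Run.loop hB hσ (fun n k σ' => ∃ w', w ≤ w' ∧ SearchAt r a g v s M N root w' σ' ∧
    (σ'.reg (r + 4) = 0 ∧ k + 100 * w ≤ 100 * w' ∧ n = N + M - w' + 1 ∨
      σ'.reg (r + 4) ≠ 0 ∧ k + 100 * w ≤ 100 * w' + 94 ∧ n = 0))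
    (if σ.reg (r + 4) = 0 then N + M - w + 1 else 0)
    ⟨w, le_rfl, h, ?_⟩ ?_
  · split_ifs with hd
    · exact Or.inl ⟨hd, by omega, rfl⟩
    · exact Or.inr ⟨hd, by omega, rfl⟩
  · rintro n k σ' hb hf ⟨w', hw, hS, hd⟩
    refine ⟨by simp [Expr.Ok]; omega, fun h0 => ?_, fun h0 => ?_⟩
    · simp only [Expr.val, Op.eval] at h0
      rcases hd with ⟨hd, hk, rfl⟩ | ⟨hd, hk, rfl⟩
      · simp [hd] at h0
      · exact ⟨w', hw, by simp only [Expr.cost]; omega, hS, hd⟩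
    · simp only [Expr.val, Op.eval] at h0
      rcases hd with ⟨hd, hk, rfl⟩ | ⟨hd, hk, rfl⟩
      · have hr' : GraphRep g M N σ' := hr.congr fun i hi => by
          refine (searchStep_frame hf).2 _ ?_
          have := hsep.hg
          omega
        refine (searchStep_run hB hb hNB hsep hr' hS hd).mono ?_
        rintro l σ'' ⟨hl, ⟨hS', hd'⟩ | ⟨hS', hd'⟩⟩
        · have := hS'.inv.work_le_size
          exact ⟨N + M - (w' + 1) + 1, by omega, w' + 1, by omega, hS',
            Or.inl ⟨hd', by simp only [Expr.cost]; omega, rfl⟩⟩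
        · exact ⟨0, by omega, w', hw, hS',
            Or.inr ⟨hd', by simp only [Expr.cost]; omega, rfl⟩⟩
      · simp [hd] at h0

end Ram

/-! ### Satisfiability of conjunctions of two-literal clauses -/

namespace Ram

open Ram.Expr Ram.Prog

/-- The negation of a literal: the variables are `0, …, N - 1`, and the literals are the numbers
`x` and `x + N` for each variable `x`. -/
def neg (N l : ℕ) : ℕ := if l < N then l + N else l - N

/-- The truth value of a literal. -/
def lit (N : ℕ) (τ : ℕ → Prop) (l : ℕ) : Prop := if l < N then τ l else ¬ τ (l - N)

/-- An assignment satisfies the implications `src j → dst j` for `j < M`. -/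
def Sat (N : ℕ) (src dst : ℕ → ℕ) (M : ℕ) (τ : ℕ → Prop) : Prop :=
  ∀ j < M, lit N τ (src j) → lit N τ (dst j)

/-- The set of implications consists of literals and is closed under contraposition. -/
structure Skew (N : ℕ) (src dst : ℕ → ℕ) (M : ℕ) : Prop where
  src_lt : ∀ j < M, src j < 2 * N
  dst_lt : ∀ j < M, dst j < 2 * N
  contra : ∀ j < M, ∃ i < M, src i = neg N (dst j) ∧ dst i = neg N (src j)

variable {N : ℕ}

theorem neg_lt {l : ℕ} (h : l < 2 * N) : neg N l < 2 * N := by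
  unfold neg; split <;> omega

theorem neg_neg {l : ℕ} (h : l < 2 * N) : neg N (neg N l) = l := by
  unfold neg; split_ifs <;> omega

theorem lit_neg {l : ℕ} {τ : ℕ → Prop} (h : l < 2 * N) : lit N τ (neg N l) ↔ ¬ lit N τ l := by
  unfold lit neg
  split_ifs
  · omega
  · simp
  · simp
  · omega

/-- The literals with a nonzero value of `val` form a consistent set of literals which is closed
under the implications. -/
structure PartialSol (N : ℕ) (src dst : ℕ → ℕ) (M : ℕ) (val : ℕ → ℕ) : Prop where
  lt : ∀ l, val l ≠ 0 → l < 2 * N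
  closed : ∀ j < M, val (src j) ≠ 0 → val (dst j) ≠ 0
  cons : ∀ l, val l ≠ 0 → val (neg N l) = 0

section

variable {src dst val : ℕ → ℕ} {M root st : ℕ} {mark q num pv pj : ℕ → ℕ} {p qh qt cur w : ℕ}

/-- If every variable has a value, consistency makes the literals with nonzero `val` exactly the
true ones, and closedness becomes satisfaction. -/
theorem PartialSol.sat (h : PartialSol N src dst M val) (hs : Skew N src dst M)
    (ht : ∀ x < N, val x ≠ 0 ∨ val (x + N) ≠ 0) : Sat N src dst M fun x => val x ≠ 0 := by
  have key : ∀ l < 2 * N, (lit N (fun x => val x ≠ 0) l ↔ val l ≠ 0) := by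
    intro l hl
    unfold lit
    split
    · exact Iff.rfl
    · have h1 := ht (l - N) (by omega)
      have h2 := h.cons l
      rw [show l - N + N = l by omega] at h1
      rw [neg, if_neg (by assumption)] at h2
      tauto
  intro j hj
  rw [key _ (hs.src_lt j hj), key _ (hs.dst_lt j hj)]
  exact h.closed j hj

theorem Sat.reach {τ : ℕ → Prop} (h : Sat N src dst M τ) {x y : ℕ}
    (hxy : Relation.ReflTransGen (fun x y => ∃ j < M, src j = x ∧ dst j = y) x y)
    (hx : lit N τ x) : lit N τ y := by
  induction hxy with
  | refl => exact hx
  | tail _ hyz ih =>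
    obtain ⟨j, hj, rfl, rfl⟩ := hyz
    exact h j hj ih

/-- A chain of implications can be read backwards with negated literals. -/
theorem Skew.reach (hs : Skew N src dst M) {x y : ℕ}
    (hxy : Relation.ReflTransGen (fun x y => ∃ j < M, src j = x ∧ dst j = y) x y) :
    Relation.ReflTransGen (fun x y => ∃ j < M, src j = x ∧ dst j = y) (neg N y) (neg N x) := by
  induction hxy with
  | refl => exact .refl
  | tail _ hyz ih =>
    obtain ⟨j, hj, rfl, rfl⟩ := hyz
    obtain ⟨i, hi, h1, h2⟩ := hs.contra j hj
    exact ih.head ⟨i, hi, h1, h2⟩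

theorem PartialSol.reach (h : PartialSol N src dst M val) {x y : ℕ}
    (hxy : Relation.ReflTransGen (fun x y => ∃ j < M, src j = x ∧ dst j = y) x y)
    (hx : val x ≠ 0) : val y ≠ 0 := by
  induction hxy with
  | refl => exact hx
  | tail _ hyz ih =>
    obtain ⟨j, hj, rfl, rfl⟩ := hyz
    exact h.closed j hj ih

/-- A consistent closed set of literals may be added to a partial solution. -/
theorem PartialSol.commit (h : PartialSol N src dst M val) (hs : Skew N src dst M)
    (hS : SearchInv src dst val M (2 * N) root st mark q num pv pj 0 qt qt cur w)
    (hr : val (neg N root) = 0) (hc : ∀ v, mark v = st → mark (neg N v) ≠ st)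
    {val' : ℕ → ℕ} (hval : ∀ l, val' l ≠ 0 ↔ val l ≠ 0 ∨ mark l = st) :
    PartialSol N src dst M val' := by
  have hlt : ∀ l, mark l = st → l < 2 * N := fun l hl => by
    rw [← hS.q_num l hl]; exact hS.q_lt _ (hS.num_lt l hl)
  -- If the negation of a marked literal already had a value, the reversed chain would lead from it
  -- to the negation of the root, which would then have a value too.
  have hno : ∀ l, mark l = st → val (neg N l) = 0 := by
    intro l hl
    by_contra hne
    exact h.reach (hs.reach (hS.reach hl)) hne hr
  refine ⟨fun l hl => ?_, fun j hj hj' => ?_, fun l hl => ?_⟩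
  · rcases (hval l).1 hl with h1 | h1
    exacts [h.lt l h1, hlt l h1]
  · rw [hval] at hj' ⊢
    rcases hj' with h1 | h1
    · exact Or.inl (h.closed j hj h1)
    · exact (hS.closed_of_done hj h1).symm
  · by_contra hne
    have hl2 : l < 2 * N := by
      rcases (hval l).1 hl with h1 | h1
      exacts [h.lt l h1, hlt l h1]
    rcases (hval l).1 hl with h1 | h1 <;> rcases (hval _).1 hne with h2 | h2
    · exact h2 (h.cons l h1)
    · have := hno _ h2
      rw [neg_neg hl2] at this
      exact h1 this
    · exact h2 (hno l h1)
    · exact hc l h1 h2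

/-- The number of vertices and arcs that a partial solution accounts for. -/
def weight (N : ℕ) (src : ℕ → ℕ) (M : ℕ) (val : ℕ → ℕ) : ℕ :=
  ∑ l ∈ Finset.range (2 * N) with val l ≠ 0, (1 + cnt src M l)

theorem weight_le : weight N src M val ≤ 2 * N + M := by
  refine (Finset.sum_le_sum_of_subset (Finset.filter_subset _ _)).trans ?_
  rw [Finset.sum_add_distrib]
  simpa using sum_cnt_le M

/-- A search does not enter literals that have a value, so the committed set is disjoint from the
old one. The weight therefore grows by precisely the work of a completed search, which pays for it.
-/
theorem weight_commit
    (hS : SearchInv src dst val M (2 * N) root st mark q num pv pj p qh qt cur w)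
    {val' : ℕ → ℕ} (hval : ∀ l, val' l ≠ 0 ↔ val l ≠ 0 ∨ mark l = st) :
    weight N src M val' =
      weight N src M val + ∑ i ∈ Finset.range qt, (1 + cnt src M (q i)) := by
  rw [← Finset.sum_image (f := fun v => 1 + cnt src M v) hS.q_injOn, weight, weight,
    ← Finset.sum_union]
  · congr 1
    ext l
    simp only [Finset.mem_filter, Finset.mem_range, hval, Finset.mem_union, Finset.mem_image]
    constructor
    · rintro ⟨h1, h2 | h2⟩
      · exact Or.inl ⟨h1, h2⟩
      · exact Or.inr ⟨num l, hS.num_lt l h2, hS.q_num l h2⟩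
    · rintro (⟨h1, h2⟩ | ⟨i, h1, rfl⟩)
      · exact ⟨h1, Or.inl h2⟩
      · exact ⟨hS.q_lt i h1, Or.inr (hS.mark_q i h1)⟩
  · rw [Finset.disjoint_left]
    intro l h1 h2
    obtain ⟨i, hi, rfl⟩ := Finset.mem_image.1 h2
    exact (Finset.mem_filter.1 h1).2 (hS.val_q i (Finset.mem_range.1 hi))

/-- The root implies every marked literal, hence a literal and its negation. This uses implications
only and not the partial solution, so it excludes the root for all satisfying assignments. -/
theorem SearchInv.not_lit_root
    (hS : SearchInv src dst val M (2 * N) root st mark q num pv pj p qh qt cur w)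
    {v : ℕ} (h1 : mark v = st) (h2 : mark (neg N v) = st) {τ : ℕ → Prop}
    (hτ : Sat N src dst M τ) : ¬ lit N τ root := by
  intro hr
  have hl : v < 2 * N := by
    rw [← hS.q_num v h1]; exact hS.q_lt _ (hS.num_lt v h1)
  exact (lit_neg hl).1 (hτ.reach (hS.reach h2) hr) (hτ.reach (hS.reach h1) hr)

end

/-! ### Deciding satisfiability in linear time. -/

/-- Set the register `16` to `1` if the search in the registers and arrays `r, …, r + 4` has marked
the negation of the literal at position `reg 19` of its queue, and increase the register `19`. -/
def checkStep (r : ℕ) : Prog :=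
  set 18 (get (r + 1) (reg 19)) ⨟
  cond (bin .lt (reg 18) (reg 5)) (set 18 (bin .add (reg 18) (reg 5)))
    (set 18 (bin .sub (reg 18) (reg 5))) ⨟
  cond (bin .eq (get r (reg 18)) (reg 14)) (set 16 (const 1)) skip ⨟
  set 19 (bin .add (reg 19) (const 1))

/-- Set the register `16` to `1` if the search in the registers and arrays `r, …, r + 4` has marked
a literal together with its negation, and to `0` otherwise. -/
def checkSide (r : ℕ) : Prog :=
  set 16 (const 0) ⨟ set 19 (const 0) ⨟ loop (bin .lt (reg 19) (reg (r + 2))) (checkStep r)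

/-- Add the literals that were found by a search to the partial solution in the array `50`. -/
def commitSide (r : ℕ) : Prog :=
  set 19 (const 0) ⨟
  loop (bin .lt (reg 19) (reg (r + 2)))
    (put 50 (get (r + 1) (reg 19)) (const 1) ⨟ set 19 (bin .add (reg 19) (const 1)))

/-- Commit the search `r` if it is consistent; otherwise, run the search `r'` to its end and commit
that one if it is consistent; otherwise, set the register `15`. -/
def finishTrial (r r' : ℕ) : Prog :=
  checkSide r ⨟
  cond (reg 16)
    (searchLoop r' r' 24 50 14 ⨟ checkSide r' ⨟ cond (reg 16) (set 15 (const 1)) (commitSide r'))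
    (commitSide r)

/-- Run two searches in parallel until one of them ends. -/
def lockstep : Prog :=
  loop (bin .sub (bin .eq (reg 34) (const 0)) (reg 44))
    (searchStep 30 30 24 50 14 ⨟ searchStep 40 40 24 50 14)

/-- Find a value for the variable in the register `13`. -/
def trial : Prog :=
  set 14 (bin .add (reg 13) (const 1)) ⨟ set 18 (bin .add (reg 13) (reg 5)) ⨟
  searchInit 30 30 14 13 ⨟ searchInit 40 40 14 18 ⨟ lockstep ⨟
  cond (reg 34) (finishTrial 30 40) (finishTrial 40 30)

/-- Decide satisfiability of the implications in the arrays `24, …, 27`; the register `5` holds the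
number of variables. The register `15` is nonzero in the end if they are not satisfiable. -/
def solve : Prog :=
  set 13 (const 0) ⨟ set 15 (const 0) ⨟
  loop (bin .sub (bin .lt (reg 13) (reg 5)) (reg 15))
    (cond (get 50 (reg 13)) skip
      (cond (get 50 (bin .add (reg 13) (reg 5))) skip trial) ⨟
     set 13 (bin .add (reg 13) (const 1)))

theorem checkStep_run {B : ℕ} {r i : ℕ} {σ : State} (hB : 1 < B) (hσ : σ.Bdd B)
    (hNB : 2 * N + 1 < B) (h5 : σ.reg 5 = N) (hi : σ.reg 19 = i) (hiN : i < 2 * N) :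
    Run B (checkStep r) σ fun k σ' => k ≤ 40 ∧ σ'.reg 19 = i + 1 ∧
      σ'.reg 16 = if σ.arr r (neg N (σ.arr (r + 1) i)) = σ.reg 14 then 1 else σ.reg 16 := by
  refine Run.of_ok hB hσ ?_ fun k hk =>
    ⟨hk.trans (by simp [checkStep, Prog.time, Expr.cost]), ?_, ?_⟩ <;>
  by_cases hlt : σ.arr (r + 1) i < N <;>
  by_cases hm : σ.arr r (neg N (σ.arr (r + 1) i)) = σ.reg 14 <;>
  rw [neg] at hm <;>
  simp only [hlt, if_true, if_false] at hm <;>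
  simp [checkStep, Prog.Ok, Expr.Ok, Expr.val, Op.eval, Prog.eval, hi, h5, hlt, hm, neg] <;>
  omega

/-- Only the queue is scanned, never the whole set of literals, so the cost is bounded by the work
of the search. -/
theorem checkSide_run {B : ℕ} {r M root w : ℕ} {σ : State} (hB : 1 < B) (hσ : σ.Bdd B)
    (hNB : 2 * N + 1 < B) (h5 : σ.reg 5 = N) (hr : r = 30 ∨ r = 40)
    (hS : SearchAt r r 24 50 14 M (2 * N) root w σ) :
    Run B (checkSide r) σ fun k σ' => k ≤ 50 * σ.reg (r + 2) + 20 ∧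
      ((σ'.reg 16 = 0 ∧ ∀ v, σ.arr r v = σ.reg 14 → σ.arr r (neg N v) ≠ σ.reg 14) ∨
       σ'.reg 16 ≠ 0 ∧ ∃ v, σ.arr r v = σ.reg 14 ∧ σ.arr r (neg N v) = σ.reg 14) := by
  have hqt := hS.inv.qt_le
  refine Run.seq (Run.of_ok hB hσ (by simp [Prog.Ok, Expr.Ok]; omega) fun k₁ hk₁ => ?_)
  refine Run.seq (Run.of_ok hB (hσ.setReg 16 (by simp [Expr.val]; omega))
    (by simp [Prog.Ok, Expr.Ok]; omega) fun k₂ hk₂ => ?_)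
  simp only [Prog.time, Expr.cost] at hk₁ hk₂
  simp only [Prog.eval, Expr.val]
  have hb : ((σ.setReg 16 0).setReg 19 0).Bdd B :=
    (hσ.setReg 16 (by omega)).setReg 19 (by omega)
  refine (Run.for hB hb (fun i k σ' => σ'.reg 19 = i ∧ k ≤ 50 * i ∧
    ((σ'.reg 16 = 0 ∧ ∀ j < i, σ.arr r (neg N (σ.arr (r + 1) j)) ≠ σ.reg 14) ∨
       σ'.reg 16 ≠ 0 ∧ ∃ j < σ.reg (r + 2), σ.arr r (neg N (σ.arr (r + 1) j)) = σ.reg 14))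
    0 (σ.reg (r + 2)) (fun i k σ' h => h.1) ?_ ?_ (Nat.zero_le _) ?_ ?_).mono ?_
  · rcases hr with rfl | rfl <;> simp
  · rcases hr with rfl | rfl <;> simp [wregs, checkStep]
  · simp
  · rintro i k σ' hb' hf ⟨h1, h2, h3⟩ - hi
    have e5 : σ'.reg 5 = N := by rw [hf.reg 5 (by simp [wregs, checkStep])]; simpa using h5
    have e14 : σ'.reg 14 = σ.reg 14 := by rw [hf.reg 14 (by simp [wregs, checkStep])]; simp
    have ea : σ'.arr = σ.arr := by
      funext a; rw [hf.arr a (by simp [warrs, checkStep])]; rfl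
    refine (checkStep_run hB hb' hNB e5 h1 (by omega)).mono ?_
    rintro l σ'' ⟨hl, h19, h16⟩
    refine ⟨h19, by omega, ?_⟩
    rw [ea, e14] at h16
    split_ifs at h16 with hm
    · exact Or.inr ⟨by omega, i, hi, hm⟩
    · rw [h16]
      refine h3.imp (fun h => ⟨h.1, fun j hj => ?_⟩) id
      rcases Nat.lt_succ_iff_lt_or_eq.1 hj with h' | rfl
      exacts [h.2 j h', hm]
  · rintro k σ' ⟨l, rfl, -, hl, h3⟩
    refine ⟨by omega, h3.imp (fun h => ⟨h.1, fun v hv => ?_⟩) fun h => ⟨h.1, ?_⟩⟩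
    · have := h.2 _ (hS.inv.num_lt v hv)
      rwa [hS.inv.q_num v hv] at this
    · obtain ⟨j, hj, hj'⟩ := h.2
      exact ⟨_, hS.inv.mark_q j hj, hj'⟩

theorem commitSide_run {B : ℕ} {r M root w : ℕ} {σ : State} (hB : 1 < B) (hσ : σ.Bdd B)
    (hNB : 2 * N + 1 < B) (hr : r = 30 ∨ r = 40)
    (hS : SearchAt r r 24 50 14 M (2 * N) root w σ) :
    Run B (commitSide r) σ fun k σ' => k ≤ 20 * σ.reg (r + 2) + 20 ∧
      ∀ l, σ'.arr 50 l ≠ 0 ↔ σ.arr 50 l ≠ 0 ∨ σ.arr r l = σ.reg 14 := by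
  have hqt := hS.inv.qt_le
  refine Run.seq (Run.of_ok hB hσ (by simp [Prog.Ok, Expr.Ok]; omega) fun k₁ hk₁ => ?_)
  simp only [Prog.time, Expr.cost] at hk₁
  simp only [Prog.eval, Expr.val]
  refine (Run.for hB (hσ.setReg 19 (by omega)) (fun i k σ' => σ'.reg 19 = i ∧ k ≤ 20 * i ∧
    ∀ l, σ'.arr 50 l ≠ 0 ↔ σ.arr 50 l ≠ 0 ∨ ∃ j < i, σ.arr (r + 1) j = l)
    0 (σ.reg (r + 2)) (fun i k σ' h => h.1) ?_ ?_ (Nat.zero_le _) ?_ ?_).mono ?_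
  · rcases hr with rfl | rfl <;> simp
  · rcases hr with rfl | rfl <;> simp [wregs]
  · simp
  · rintro i k σ' hb' hf ⟨h1, h2, h3⟩ - hi
    have ea : σ'.arr (r + 1) = σ.arr (r + 1) := by
      rw [hf.arr _ (by simp [warrs]; omega)]; rfl
    refine Run.of_ok hB hb' ?_ fun l hl => ⟨?_, ?_, ?_⟩
    · simp [Prog.Ok, Expr.Ok, Expr.val, Prog.eval, h1]; omega
    · simp [Expr.val, Prog.eval, Op.eval, h1]
    · simp only [Prog.time, Expr.cost] at hl; omega
    · intro l
      simp only [Prog.eval, Expr.val, h1, ea, State.setReg_arr, State.setArr_arr, if_true]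
      by_cases hl' : l = σ.arr (r + 1) i
      · simp only [hl', Function.update_self]
        exact ⟨fun _ => Or.inr ⟨i, by omega, rfl⟩, fun _ => one_ne_zero⟩
      · rw [Function.update_of_ne hl', h3]
        refine or_congr Iff.rfl ⟨fun ⟨j, hj, h⟩ => ⟨j, by omega, h⟩, fun ⟨j, hj, h⟩ => ⟨j, ?_, h⟩⟩
        rcases Nat.lt_succ_iff_lt_or_eq.1 hj with h' | rfl
        exacts [h', absurd h.symm hl']
  · rintro k σ' ⟨l, rfl, -, hl, h3⟩
    refine ⟨by omega, fun l => (h3 l).trans (or_congr Iff.rfl ⟨?_, fun h => ?_⟩)⟩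
    · rintro ⟨j, hj, rfl⟩
      exact hS.inv.mark_q j hj
    · exact ⟨_, hS.inv.num_lt l h, hS.inv.q_num l h⟩

theorem SearchAt.work_eq {r M root w : ℕ} {σ : State}
    (h : SearchAt r r 24 50 14 M (2 * N) root w σ) (hd : σ.reg (r + 4) ≠ 0) :
    w = ∑ i ∈ Finset.range (σ.reg (r + 2)), (1 + cnt (σ.arr 26) M (σ.arr (r + 1) i)) := by
  have h1 := h.inv.work
  rw [(h.done hd).1, (h.done hd).2] at h1
  simpa [cnt] using h1

theorem SearchAt.qt_le_sum {r M : ℕ} {σ : State} :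
    σ.reg (r + 2) ≤
      ∑ i ∈ Finset.range (σ.reg (r + 2)), (1 + cnt (σ.arr 26) M (σ.arr (r + 1) i)) := by
  rw [Finset.sum_add_distrib]
  simp

/-- Registers and arrays that `checkSide` leaves alone. -/
theorem checkSide_frame {r : ℕ} {σ σ' : State} (h : Frame (checkSide r) σ σ') :
    (∀ x, x ≠ 16 → x ≠ 18 → x ≠ 19 → σ'.reg x = σ.reg x) ∧ σ'.arr = σ.arr := by
  refine ⟨fun x h1 h2 h3 => h.reg x ?_, funext fun a => h.arr a ?_⟩
  · simp [checkSide, checkStep, wregs]; omega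
  · simp [checkSide, checkStep, warrs]

theorem commitSide_frame {r : ℕ} {σ σ' : State} (h : Frame (commitSide r) σ σ') :
    (∀ x, x ≠ 19 → σ'.reg x = σ.reg x) ∧ ∀ a, a ≠ 50 → σ'.arr a = σ.arr a := by
  refine ⟨fun x h1 => h.reg x ?_, fun a ha => h.arr a ?_⟩
  · simp [commitSide, wregs]; omega
  · simp [commitSide, warrs]; omega

/-- The search ended and found a consistent set of literals, which is then committed. -/
theorem commitSide_run_of_cons {B : ℕ} {r M root w : ℕ} {σ : State} (hB : 1 < B)
    (hσ : σ.Bdd B) (hNB : 2 * N + 1 < B) (hr : r = 30 ∨ r = 40)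
    (hS : SearchAt r r 24 50 14 M (2 * N) root w σ) (hd : σ.reg (r + 4) ≠ 0)
    (hs : Skew N (σ.arr 26) (σ.arr 27) M) (hp : PartialSol N (σ.arr 26) (σ.arr 27) M (σ.arr 50))
    (hv : σ.arr 50 (neg N root) = 0)
    (hc : ∀ v, σ.arr r v = σ.reg 14 → σ.arr r (neg N v) ≠ σ.reg 14) :
    Run B (commitSide r) σ fun k σ' => k ≤ 20 * w + 20 ∧
      PartialSol N (σ.arr 26) (σ.arr 27) M (σ'.arr 50) ∧
      (∀ l, σ.arr 50 l ≠ 0 → σ'.arr 50 l ≠ 0) ∧ σ'.arr 50 root ≠ 0 ∧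
      weight N (σ.arr 26) M (σ'.arr 50) = weight N (σ.arr 26) M (σ.arr 50) + w := by
  refine (commitSide_run hB hσ hNB hr hS).mono fun k σ' ⟨hk, hval⟩ => ?_
  have hw := hS.work_eq hd
  have hqw := SearchAt.qt_le_sum (r := r) (M := M) (σ := σ)
  rw [← hw] at hqw
  refine ⟨by omega, ?_, fun l hl => (hval l).2 (Or.inl hl),
    (hval root).2 (Or.inr hS.inv.mark_root), ?_⟩
  · have := hS.inv
    rw [(hS.done hd).1, (hS.done hd).2] at this
    exact hp.commit hs this hv hc hval
  · rw [weight_commit hS.inv hval, ← hw]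

/-- Here `R` is the number of lockstep rounds. Both searches have done at least `R - 1` units of
work, so whichever side is committed raises the weight by at least `R - 1`. At 600 steps per unit,
this pays for finishing, checking and committing that side, for checking a first side that failed,
and leaves the surplus `300 * R` for the lockstep phase. If both sides fail, the answer is known and
the total size of the instance pays once. -/
theorem finishTrial_run {B : ℕ} {r r' M root root' w w' R : ℕ} {σ : State} (hB : 1 < B)
    (hσ : σ.Bdd B) (hNB : 2 * N + 1 < B) (h5 : σ.reg 5 = N)
    (hr : r = 30 ∧ r' = 40 ∨ r = 40 ∧ r' = 30)
    (hS : SearchAt r r 24 50 14 M (2 * N) root w σ) (hd : σ.reg (r + 4) ≠ 0)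
    (hS' : SearchAt r' r' 24 50 14 M (2 * N) root' w' σ) (hg : GraphRep 24 M (2 * N) σ)
    (hs : Skew N (σ.arr 26) (σ.arr 27) M) (hp : PartialSol N (σ.arr 26) (σ.arr 27) M (σ.arr 50))
    (hv : σ.arr 50 (neg N root) = 0) (hv' : σ.arr 50 (neg N root') = 0) (h15 : σ.reg 15 = 0)
    (hwR : w ≤ R) (hRw : R ≤ w + 1) (hRw' : R ≤ w' + 1) :
    Run B (finishTrial r r') σ fun k σ' => (∀ v, σ'.arr r' v ≤ σ.reg 14) ∧
      ((σ'.reg 15 = 0 ∧ PartialSol N (σ.arr 26) (σ.arr 27) M (σ'.arr 50) ∧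
        (∀ l, σ.arr 50 l ≠ 0 → σ'.arr 50 l ≠ 0) ∧ (σ'.arr 50 root ≠ 0 ∨ σ'.arr 50 root' ≠ 0) ∧
        k + 300 * R + 600 * weight N (σ.arr 26) M (σ.arr 50) ≤
          600 * weight N (σ.arr 26) M (σ'.arr 50) + 1000) ∨
       (σ'.reg 15 ≠ 0 ∧ (∀ τ, Sat N (σ.arr 26) (σ.arr 27) M τ → ¬ lit N τ root ∧ ¬ lit N τ root') ∧
        k + 300 * R ≤ 600 * (2 * N + M) + 1000)) := by
  have hr1 : r = 30 ∨ r = 40 := by omega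
  have hr2 : r' = 30 ∨ r' = 40 := by omega
  have hqw := SearchAt.qt_le_sum (r := r) (M := M) (σ := σ)
  rw [← hS.work_eq hd] at hqw
  refine Run.seq ((checkSide_run hB hσ hNB h5 hr1 hS).mono_frame hσ ?_)
  rintro k₁ σ₁ ⟨hk₁, hc⟩ hb₁ hf₁
  obtain ⟨fr₁, fa₁⟩ := checkSide_frame hf₁
  have hS₁ : SearchAt r r 24 50 14 M (2 * N) root w σ₁ :=
    hS.congr (fun i hi => fr₁ _ (by omega) (by omega) (by omega)) (fun i hi => by rw [fa₁])
      (fun i hi => by rw [fa₁]) (by rw [fa₁]) (fr₁ _ (by omega) (by omega) (by omega))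
  have hS₁' : SearchAt r' r' 24 50 14 M (2 * N) root' w' σ₁ :=
    hS'.congr (fun i hi => fr₁ _ (by omega) (by omega) (by omega)) (fun i hi => by rw [fa₁])
      (fun i hi => by rw [fa₁]) (by rw [fa₁]) (fr₁ _ (by omega) (by omega) (by omega))
  have e14 : σ₁.reg 14 = σ.reg 14 := fr₁ _ (by omega) (by omega) (by omega)
  have e15 : σ₁.reg 15 = 0 := (fr₁ 15 (by omega) (by omega) (by omega)).trans h15
  have hd₁ : σ₁.reg (r + 4) ≠ 0 := by rwa [fr₁ _ (by omega) (by omega) (by omega)]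
  refine Run.cond hB hb₁ trivial (fun h16 => ?_) (fun h16 => ?_)
  · replace hc := hc.resolve_left fun h => h16 h.1
    obtain ⟨-, v, hv1, hv2⟩ := hc
    have hsep : SearchSep r' r' 24 50 14 := ⟨by omega, by omega, by omega⟩
    refine Run.seq ((searchLoop_run hB hb₁ hNB hsep (hg.congr fun i hi => by rw [fa₁])
      hS₁').mono_frame hb₁ ?_)
    rintro k₂ σ₂ ⟨w₂, hw₂, hk₂, hS₂, hd₂⟩ hb₂ hf₂
    obtain ⟨fr₂, fa₂⟩ := searchStep_frame (⟨hf₂.reg, hf₂.arr⟩ :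
      Frame (searchStep r' r' 24 50 14) σ₁ σ₂)
    have a26 : σ₂.arr 26 = σ.arr 26 := by rw [fa₂ _ (by omega), fa₁]
    have a27 : σ₂.arr 27 = σ.arr 27 := by rw [fa₂ _ (by omega), fa₁]
    have a50 : σ₂.arr 50 = σ.arr 50 := by rw [fa₂ _ (by omega), fa₁]
    have f14 : σ₂.reg 14 = σ.reg 14 := by rw [fr₂ _ (by omega), e14]
    have f15 : σ₂.reg 15 = 0 := by rw [fr₂ _ (by omega), e15]
    have f5 : σ₂.reg 5 = N := by
      rw [fr₂ _ (by omega), fr₁ _ (by omega) (by omega) (by omega), h5]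
    have hqw₂ := SearchAt.qt_le_sum (r := r') (M := M) (σ := σ₂)
    rw [← hS₂.work_eq hd₂] at hqw₂
    have hwN := hS₂.inv.work_le_size
    refine Run.seq ((checkSide_run hB hb₂ hNB f5 hr2 hS₂).mono_frame hb₂ ?_)
    rintro k₃ σ₃ ⟨hk₃, hc₃⟩ hb₃ hf₃
    obtain ⟨fr₃, fa₃⟩ := checkSide_frame hf₃
    have hS₃ : SearchAt r' r' 24 50 14 M (2 * N) root' w₂ σ₃ :=
      hS₂.congr (fun i hi => fr₃ _ (by omega) (by omega) (by omega)) (fun i hi => by rw [fa₃])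
        (fun i hi => by rw [fa₃]) (by rw [fa₃]) (fr₃ _ (by omega) (by omega) (by omega))
    have g14 : σ₃.reg 14 = σ.reg 14 := by rw [fr₃ _ (by omega) (by omega) (by omega), f14]
    have g15 : σ₃.reg 15 = 0 := by rw [fr₃ _ (by omega) (by omega) (by omega), f15]
    refine Run.cond hB hb₃ trivial (fun h16' => ?_) (fun h16' => ?_)
    · replace hc₃ := hc₃.resolve_left fun h => h16' h.1
      obtain ⟨-, v', hv1', hv2'⟩ := hc₃
      refine Run.of_ok hB hb₃ (by simp [Prog.Ok, Expr.Ok]; omega) fun k₄ hk₄ =>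
        ⟨?_, Or.inr ⟨?_, ?_, ?_⟩⟩
      · intro u
        have := hS₃.inv.mark_le u
        simpa [Prog.eval, g14] using this
      · simp [Prog.eval, Expr.val]
      · intro τ hτ
        refine ⟨hS.inv.not_lit_root hv1 hv2 hτ, hS₂.inv.not_lit_root hv1' hv2' ?_⟩
        rw [show 24 + 2 = 26 from rfl, show 24 + 3 = 27 from rfl, a26, a27]
        exact hτ
      · simp only [Prog.time, Expr.cost] at hk₄ ⊢
        omega
    · replace hc₃ := (hc₃.resolve_right fun h => h.1 h16').2
      have hd₃ : σ₃.reg (r' + 4) ≠ 0 := by rwa [fr₃ _ (by omega) (by omega) (by omega)]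
      refine (commitSide_run_of_cons hB hb₃ hNB hr2 hS₃ hd₃ ?_ ?_ ?_ ?_).mono_frame hb₃ ?_
      · rwa [fa₃, a26, a27]
      · rwa [fa₃, a26, a27, a50]
      · rwa [fa₃, a50]
      · rwa [fa₃, g14, ← f14]
      · rw [fa₃, a26, a27, a50]
        rintro k₄ σ₄ ⟨hk₄, h1, h2, h3, h4⟩ - hf₄
        obtain ⟨fr₄, fa₄⟩ := commitSide_frame hf₄
        refine ⟨fun u => ?_, Or.inl ⟨?_, h1, h2, Or.inr h3, ?_⟩⟩
        · have := hS₃.inv.mark_le u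
          rwa [fa₄ _ (by omega), ← g14]
        · rw [fr₄ _ (by omega), g15]
        · simp only [Expr.cost]
          omega
  · replace hc := (hc.resolve_right fun h => h.1 h16).2
    refine (commitSide_run_of_cons hB hb₁ hNB hr1 hS₁ hd₁ ?_ ?_ ?_ ?_).mono_frame hb₁ ?_
    · rwa [fa₁]
    · rwa [fa₁]
    · rwa [fa₁]
    · rwa [fa₁, e14]
    · rw [fa₁]
      rintro k₄ σ₄ ⟨hk₄, h1, h2, h3, h4⟩ - hf₄
      obtain ⟨fr₄, fa₄⟩ := commitSide_frame hf₄
      refine ⟨fun u => ?_, Or.inl ⟨?_, h1, h2, Or.inl h3, ?_⟩⟩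
      · have := hS₁'.inv.mark_le u
        rwa [fa₄ _ (by omega), ← e14]
      · rw [fr₄ _ (by omega), e15]
      · simp only [Expr.cost]
        omega

/-- The two counters advance together. A search that notices its end sets its flag without raising
its counter, so on exit each counter may lag behind the number `R` of rounds by one. -/
theorem lockstep_run {B : ℕ} {M x y : ℕ} {σ : State} (hB : 1 < B)
    (hσ : σ.Bdd B) (hNB : 2 * N + 1 < B) (hg : GraphRep 24 M (2 * N) σ)
    (hS : SearchAt 30 30 24 50 14 M (2 * N) x 0 σ) (hd : σ.reg 34 = 0)
    (hS' : SearchAt 40 40 24 50 14 M (2 * N) y 0 σ) (hd' : σ.reg 44 = 0) :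
    Run B lockstep σ fun k σ' => ∃ w w' R, k ≤ 200 * R + 10 ∧
      SearchAt 30 30 24 50 14 M (2 * N) x w σ' ∧ SearchAt 40 40 24 50 14 M (2 * N) y w' σ' ∧
      w ≤ R ∧ w' ≤ R ∧ R ≤ w + 1 ∧ R ≤ w' + 1 ∧ (σ'.reg 34 ≠ 0 ∨ σ'.reg 44 ≠ 0) := by
  refine Run.loop hB hσ (fun n k σ' => ∃ w w' R, k ≤ 200 * R ∧
      SearchAt 30 30 24 50 14 M (2 * N) x w σ' ∧ SearchAt 40 40 24 50 14 M (2 * N) y w' σ' ∧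
      w ≤ R ∧ w' ≤ R ∧ R ≤ w + 1 ∧ R ≤ w' + 1 ∧ ((σ'.reg 34 ≠ 0 ∨ σ'.reg 44 ≠ 0) ∨
        σ'.reg 34 = 0 ∧ σ'.reg 44 = 0 ∧ w = R ∧ w' = R) ∧ n = 2 * N + M + 1 - R)
      (2 * N + M + 1) ⟨0, 0, 0, by omega, hS, hS', by omega, by omega, by omega, by omega,
        Or.inr ⟨hd, hd', rfl, rfl⟩, rfl⟩ ?_
  rintro n k σ₁ hb₁ hf₁ ⟨w, w', R, hk, hS₁, hS₁', h1, h2, h3, h4, hdone, rfl⟩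
  refine ⟨by simp [Expr.Ok]; omega, fun h0 => ?_, fun h0 => ?_⟩
  · refine ⟨w, w', R, by simp only [Expr.cost]; omega, hS₁, hS₁', h1, h2, h3, h4, ?_⟩
    refine hdone.resolve_right fun h => ?_
    simp [Expr.val, Op.eval, h.1, h.2.1] at h0
  · have h0' : σ₁.reg 34 = 0 ∧ σ₁.reg 44 = 0 := by
      by_cases h34 : σ₁.reg 34 = 0
      · simp [Expr.val, Op.eval, h34] at h0
        exact ⟨h34, by omega⟩
      · simp [Expr.val, Op.eval, h34] at h0
    replace hdone := hdone.resolve_left fun h => by omega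
    obtain ⟨hd₁, hd₁', rfl, rfl⟩ := hdone
    have hg₁ : GraphRep 24 M (2 * N) σ₁ := hg.congr fun i hi => hf₁.arr _ (by
      simp [searchStep, warrs]; omega)
    refine Run.seq ((searchStep_run hB hb₁ hNB ⟨by omega, by omega, by omega⟩ hg₁ hS₁
      hd₁).mono_frame hb₁ ?_)
    rintro k₂ σ₂ ⟨hk₂, hS₂⟩ hb₂ hf₂
    obtain ⟨fr₂, fa₂⟩ := searchStep_frame hf₂
    have hS₂' := hS₁'.congr (fun i hi => fr₂ _ (by omega)) (fun i hi => fa₂ _ (by omega))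
      (fun i hi => fa₂ _ (by omega)) (fa₂ _ (by omega)) (fr₂ _ (by omega))
    have hd₂' : σ₂.reg 44 = 0 := by rw [fr₂ _ (by omega), hd₁']
    refine (searchStep_run hB hb₂ hNB ⟨by omega, by omega, by omega⟩
      (hg₁.congr fun i hi => fa₂ _ (by omega)) hS₂' hd₂').mono_frame hb₂ ?_
    rintro k₃ σ₃ ⟨hk₃, hS₃'⟩ hb₃ hf₃
    obtain ⟨fr₃, fa₃⟩ := searchStep_frame hf₃
    have hS₃ : SearchAt 30 30 24 50 14 M (2 * N) x (w' + 1) σ₃ ∧ σ₃.reg 34 = 0 ∨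
        SearchAt 30 30 24 50 14 M (2 * N) x w' σ₃ ∧ σ₃.reg 34 ≠ 0 := by
      have e34 : σ₃.reg 34 = σ₂.reg 34 := fr₃ _ (by omega)
      rw [e34]
      refine hS₂.imp (fun h => ⟨?_, h.2⟩) fun h => ⟨?_, h.2⟩
      all_goals
        exact h.1.congr (fun i hi => fr₃ _ (by omega)) (fun i hi => fa₃ _ (by omega))
          (fun i hi => fa₃ _ (by omega)) (fa₃ _ (by omega)) (fr₃ _ (by omega))
    have hwN := hS₁.inv.work_le_size
    refine ⟨2 * N + M + 1 - (w' + 1), by omega, ?_⟩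
    simp only [Expr.cost]
    rcases hS₃ with ⟨a1, a2⟩ | ⟨a1, a2⟩ <;> rcases hS₃' with ⟨b1, b2⟩ | ⟨b1, b2⟩
    · exact ⟨_, _, w' + 1, by omega, a1, b1, by omega, by omega, by omega, by omega,
        Or.inr ⟨a2, b2, rfl, rfl⟩, rfl⟩
    · exact ⟨_, _, w' + 1, by omega, a1, b1, by omega, by omega, by omega, by omega,
        Or.inl (Or.inr b2), rfl⟩
    · exact ⟨_, _, w' + 1, by omega, a1, b1, by omega, by omega, by omega, by omega,
        Or.inl (Or.inl a2), rfl⟩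
    · exact ⟨_, _, w' + 1, by omega, a1, b1, by omega, by omega, by omega, by omega,
        Or.inl (Or.inl a2), rfl⟩

theorem searchInit_frame {r a s x : ℕ} {σ σ' : State} (h : Frame (searchInit r a s x) σ σ') :
    (∀ x, x < r ∨ r + 4 < x → σ'.reg x = σ.reg x) ∧
      ∀ b, b < a ∨ a + 4 < b → σ'.arr b = σ.arr b := by
  refine ⟨fun x hx => h.reg x ?_, fun b hb => h.arr b ?_⟩
  · simp [searchInit, wregs]; omega
  · simp [searchInit, warrs]; omega

/-- The stamp `x + 1` exceeds all marks left by the variables before `x`. If both searches find a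
contradiction, no assignment satisfies the implications, as it would make one of the two literals
true. -/
theorem trial_run {B : ℕ} {M x : ℕ} {σ : State} (hB : 1 < B)
    (hσ : σ.Bdd B) (hNB : 2 * N + 1 < B) (h5 : σ.reg 5 = N) (h13 : σ.reg 13 = x) (hx : x < N)
    (hg : GraphRep 24 M (2 * N) σ) (hs : Skew N (σ.arr 26) (σ.arr 27) M)
    (hp : PartialSol N (σ.arr 26) (σ.arr 27) M (σ.arr 50))
    (hv : σ.arr 50 x = 0) (hv' : σ.arr 50 (x + N) = 0) (h15 : σ.reg 15 = 0)
    (hm : ∀ v, σ.arr 30 v ≤ x) (hm' : ∀ v, σ.arr 40 v ≤ x) :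
    Run B trial σ fun k σ' => (∀ v, σ'.arr 30 v ≤ x + 1) ∧ (∀ v, σ'.arr 40 v ≤ x + 1) ∧
      ((σ'.reg 15 = 0 ∧ PartialSol N (σ.arr 26) (σ.arr 27) M (σ'.arr 50) ∧
        (∀ l, σ.arr 50 l ≠ 0 → σ'.arr 50 l ≠ 0) ∧ (σ'.arr 50 x ≠ 0 ∨ σ'.arr 50 (x + N) ≠ 0) ∧
        k + 600 * weight N (σ.arr 26) M (σ.arr 50) ≤
          600 * weight N (σ.arr 26) M (σ'.arr 50) + 1200) ∨
       (σ'.reg 15 ≠ 0 ∧ (∀ τ, ¬ Sat N (σ.arr 26) (σ.arr 27) M τ) ∧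
        k ≤ 600 * (2 * N + M) + 1200)) := by
  refine Run.seq (Run.of_ok hB hσ (by simp [Prog.Ok, Expr.Ok, Expr.val]; omega) fun k₁ hk₁ => ?_)
  simp only [Prog.eval, Expr.val, Op.eval, h13]
  have hb₁ : (σ.setReg 14 (x + 1)).Bdd B := hσ.setReg _ (by omega)
  refine Run.seq (Run.of_ok hB hb₁ (by simp [Prog.Ok, Expr.Ok, Expr.val]; omega) fun k₂ hk₂ => ?_)
  simp only [Prog.eval, Expr.val, Op.eval, State.setReg_reg]
  simp only [show (13 : ℕ) ≠ 14 by omega, show (5 : ℕ) ≠ 14 by omega, if_false, h13, h5]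
  simp only [Prog.time, Expr.cost] at hk₁ hk₂
  generalize hσ₂ : (σ.setReg 14 (x + 1)).setReg 18 (x + N) = σ₂
  have hb₂ : σ₂.Bdd B := by
    rw [← hσ₂]
    exact hb₁.setReg _ (by omega)
  have ha₂ : σ₂.arr = σ.arr := by rw [← hσ₂]; rfl
  have r14 : σ₂.reg 14 = x + 1 := by simp [← hσ₂]
  have r18 : σ₂.reg 18 = x + N := by simp [← hσ₂]
  have r13 : σ₂.reg 13 = x := by simp [← hσ₂, h13]
  have r5 : σ₂.reg 5 = N := by simp [← hσ₂, h5]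
  have r15 : σ₂.reg 15 = 0 := by simp [← hσ₂, h15]
  refine Run.seq ((searchInit_run (g := 24) (v := 50) (M := M) (N := 2 * N) hB hb₂
    ⟨by omega, by omega, by omega⟩ (fun i => by rw [ha₂, r14]; have := hm i; omega) (by omega)
    (by rw [r13, ha₂, hv])).mono_frame hb₂ ?_)
  rintro k₃ σ₃ ⟨hk₃, hS₃, hd₃⟩ hb₃ hf₃
  obtain ⟨fr₃, fa₃⟩ := searchInit_frame hf₃
  rw [r13] at hS₃
  refine Run.seq ((searchInit_run (g := 24) (v := 50) (M := M) (N := 2 * N) hB hb₃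
    ⟨by omega, by omega, by omega⟩
    (fun i => by rw [fa₃ _ (by omega), fr₃ _ (by omega), ha₂, r14]; have := hm' i; omega)
    (by rw [fr₃ _ (by omega)]; omega)
    (by rw [fr₃ _ (by omega), r18, fa₃ _ (by omega), ha₂, hv'])).mono_frame hb₃ ?_)
  rintro k₄ σ₄ ⟨hk₄, hS₄, hd₄⟩ hb₄ hf₄
  obtain ⟨fr₄, fa₄⟩ := searchInit_frame hf₄
  rw [fr₃ _ (by omega), r18] at hS₄
  have hS₃' := hS₃.congr (fun i hi => fr₄ _ (by omega)) (fun i hi => fa₄ _ (by omega))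
      (fun i hi => fa₄ _ (by omega)) (fa₄ _ (by omega)) (fr₄ _ (by omega))
  have hg₄ : GraphRep 24 M (2 * N) σ₄ := hg.congr fun i hi => by
    rw [fa₄ _ (by omega), fa₃ _ (by omega), ha₂]
  refine Run.seq ((lockstep_run hB hb₄ hNB hg₄ hS₃' ((fr₄ _ (by omega)).trans hd₃) hS₄
    hd₄).mono_frame hb₄ ?_)
  rintro k₅ σ₅ ⟨w, w', R, hk₅, hS₅, hS₅', h1, h2, h3, h4, hd₅⟩ hb₅ hf₅
  have fr₅ : ∀ i, i < 30 → σ₅.reg i = σ₂.reg i := by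
    intro i hi
    rw [hf₅.reg _ (by simp [lockstep, searchStep, wregs]; omega), fr₄ _ (by omega),
      fr₃ _ (by omega)]
  have fa₅ : ∀ i, i < 30 ∨ 44 < i → σ₅.arr i = σ.arr i := by
    intro i hi
    rw [hf₅.arr _ (by simp [lockstep, searchStep, warrs]; omega), fa₄ _ (by omega),
      fa₃ _ (by omega), ha₂]
  have hs₅ : Skew N (σ₅.arr 26) (σ₅.arr 27) M := by rwa [fa₅ _ (by omega), fa₅ _ (by omega)]
  have hp₅ : PartialSol N (σ₅.arr 26) (σ₅.arr 27) M (σ₅.arr 50) := by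
    rwa [fa₅ _ (by omega), fa₅ _ (by omega), fa₅ _ (by omega)]
  have hg₅ : GraphRep 24 M (2 * N) σ₅ := hg.congr fun i hi => fa₅ _ (by omega)
  have n1 : neg N x = x + N := by simp [neg, hx]
  have n2 : neg N (x + N) = x := by simp [neg]
  have v1 : σ₅.arr 50 (neg N x) = 0 := by rw [n1, fa₅ _ (by omega), hv']
  have v2 : σ₅.arr 50 (neg N (x + N)) = 0 := by rw [n2, fa₅ _ (by omega), hv]
  have e5 : σ₅.reg 5 = N := (fr₅ 5 (by omega)).trans r5
  have e14 : σ₅.reg 14 = x + 1 := (fr₅ 14 (by omega)).trans r14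
  have e15 : σ₅.reg 15 = 0 := (fr₅ 15 (by omega)).trans r15
  have hlit : ∀ τ, lit N τ x ∨ lit N τ (x + N) := by
    intro τ
    rw [← n1, lit_neg (by omega)]
    exact em _
  have e26 := fa₅ 26 (by omega)
  have e27 := fa₅ 27 (by omega)
  have e50 := fa₅ 50 (by omega)
  refine Run.cond hB hb₅ trivial (fun h34 => ?_) (fun h34 => ?_)
  · refine (finishTrial_run hB hb₅ hNB e5 (Or.inl ⟨rfl, rfl⟩) hS₅ h34 hS₅' hg₅ hs₅ hp₅ v1 v2 e15
      h1 h3 h4).mono_frame hb₅ ?_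
    rw [e26, e27, e50, e14]
    rintro k₆ σ₆ ⟨hm₆, h⟩ - hf₆
    refine ⟨fun v => ?_, hm₆, h.imp ?_ ?_⟩
    · rw [hf₆.arr 30 (by simp [finishTrial, checkSide, checkStep, commitSide, searchLoop,
        searchStep, warrs])]
      have := hS₅.inv.mark_le v
      omega
    · rintro ⟨a1, a2, a3, a4, a5⟩
      exact ⟨a1, a2, a3, a4, by simp only [Expr.cost]; omega⟩
    · rintro ⟨a1, a2, a3⟩
      refine ⟨a1, fun τ hτ => ?_, by simp only [Expr.cost]; omega⟩
      have := a2 τ hτ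
      have := hlit τ
      tauto
  · refine (finishTrial_run hB hb₅ hNB e5 (Or.inr ⟨rfl, rfl⟩) hS₅'
      (hd₅.resolve_left fun h => h h34) hS₅ hg₅ hs₅ hp₅ v2 v1 e15 h2 h4 h3).mono_frame hb₅ ?_
    rw [e26, e27, e50, e14]
    rintro k₆ σ₆ ⟨hm₆, h⟩ - hf₆
    refine ⟨hm₆, fun v => ?_, h.imp ?_ ?_⟩
    · rw [hf₆.arr 40 (by simp [finishTrial, checkSide, checkStep, commitSide, searchLoop,
        searchStep, warrs])]
      have := hS₅'.inv.mark_le v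
      omega
    · rintro ⟨a1, a2, a3, a4, a5⟩
      exact ⟨a1, a2, a3, a4.symm, by simp only [Expr.cost]; omega⟩
    · rintro ⟨a1, a2, a3⟩
      refine ⟨a1, fun τ hτ => ?_, by simp only [Expr.cost]; omega⟩
      have := a2 τ hτ
      have := hlit τ
      tauto

theorem trial_frame {σ σ' : State} (h : Frame trial σ σ') : σ'.reg 5 = σ.reg 5 ∧
    σ'.reg 13 = σ.reg 13 ∧ (∀ a, a < 30 → σ'.arr a = σ.arr a) := by
  refine ⟨h.reg 5 ?_, h.reg 13 ?_, fun a ha => h.arr a ?_⟩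
  · simp [trial, searchInit, lockstep, searchStep, finishTrial, checkSide, checkStep, searchLoop,
      commitSide, wregs]
  · simp [trial, searchInit, lockstep, searchStep, finishTrial, checkSide, checkStep, searchLoop,
      commitSide, wregs]
  · simp [trial, searchInit, lockstep, searchStep, finishTrial, checkSide, checkStep, searchLoop,
      commitSide, warrs]
    omega

/-- No choice is ever revised: a committed set is closed and consistent, and a failure of both
literals refutes the whole instance. The times of the trials telescope in `weight`, which never
exceeds `2 * N + M`; each variable adds a constant, and a final failing trial costs at most one more
multiple of `2 * N + M`. -/
theorem solve_run {B : ℕ} {M : ℕ} {σ : State} (hB : 1 < B)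
    (hσ : σ.Bdd B) (hNB : 2 * N + 1 < B) (h5 : σ.reg 5 = N)
    (hg : GraphRep 24 M (2 * N) σ) (hs : Skew N (σ.arr 26) (σ.arr 27) M)
    (h50 : ∀ l, σ.arr 50 l = 0) (h30 : ∀ l, σ.arr 30 l = 0) (h40 : ∀ l, σ.arr 40 l = 0) :
    Run B solve σ fun k σ' => (σ'.reg 15 = 0 ↔ ∃ τ, Sat N (σ.arr 26) (σ.arr 27) M τ) ∧
      k ≤ 1300 * (2 * N + M) + 1300 * N + 2000 := by
  refine Run.seq (Run.of_ok hB hσ (by simp [Prog.Ok, Expr.Ok]; omega) fun k₁ hk₁ => ?_)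
  have hb₁ : (σ.setReg 13 0).Bdd B := hσ.setReg _ (by omega)
  simp only [Prog.eval, Expr.val]
  refine Run.seq (Run.of_ok hB hb₁ (by simp [Prog.Ok, Expr.Ok]; omega) fun k₂ hk₂ => ?_)
  simp only [Prog.eval, Expr.val]
  simp only [Prog.time, Expr.cost] at hk₁ hk₂
  have hb₂ : ((σ.setReg 13 0).setReg 15 0).Bdd B := hb₁.setReg _ (by omega)
  have hw := fun val => weight_le (N := N) (src := σ.arr 26) (M := M) (val := val)
  refine Run.loop hB hb₂ (fun n k σ' => ∃ x ≤ N, σ'.reg 5 = N ∧ σ'.reg 13 = x ∧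
    (∀ a, a < 30 → σ'.arr a = σ.arr a) ∧ (∀ v, σ'.arr 30 v ≤ x) ∧ (∀ v, σ'.arr 40 v ≤ x) ∧
    ((σ'.reg 15 = 0 ∧ PartialSol N (σ.arr 26) (σ.arr 27) M (σ'.arr 50) ∧
      (∀ y < x, σ'.arr 50 y ≠ 0 ∨ σ'.arr 50 (y + N) ≠ 0) ∧
      k ≤ 600 * weight N (σ.arr 26) M (σ'.arr 50) + 1300 * x ∧ n = N - x + 1) ∨
     (σ'.reg 15 ≠ 0 ∧ (∀ τ, ¬ Sat N (σ.arr 26) (σ.arr 27) M τ) ∧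
        k ≤ 1200 * (2 * N + M) + 1300 * x ∧ n = 0))) (N + 1) ?_ ?_
  · refine ⟨0, by omega, by simpa using h5, by simp, fun a ha => rfl, ?_, ?_,
      Or.inl ⟨by simp, ?_, by simp, by omega, rfl⟩⟩
    · simp [h30]
    · simp [h40]
    · constructor <;> simp [h50]
  rintro n k σ₁ hb₃ - ⟨x, hxN, e5, e13, ea, m30, m40, hst⟩
  refine ⟨by simp [Expr.Ok], fun h0 => ?_, fun h0 => ?_⟩
  · simp only [Expr.cost]
    rcases hst with ⟨e15, hp, hall, hk, rfl⟩ | ⟨e15, hun, hk, rfl⟩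
    · have hx : x = N := by
        by_contra hne
        have : x < N := by omega
        simp [Expr.val, Op.eval, e5, e13, e15, this] at h0
      subst hx
      have := hw (σ₁.arr 50)
      exact ⟨⟨fun _ => ⟨_, hp.sat hs hall⟩, fun _ => e15⟩, by omega⟩
    · refine ⟨⟨fun h => absurd h e15, fun ⟨τ, hτ⟩ => absurd hτ (hun τ)⟩, ?_⟩
      have : 1300 * x ≤ 1300 * N := by omega
      omega
  · rcases hst with ⟨e15, hp, hall, hk, rfl⟩ | ⟨e15, hun, hk, rfl⟩
    swap
    · exfalso
      apply h0
      by_cases h : x < N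
      · simp [Expr.val, Op.eval, e5, e13, h]
        omega
      · simp [Expr.val, Op.eval, e5, e13, h]
    have hx : x < N := by
      by_contra hne
      simp [Expr.val, Op.eval, e5, e13, hne] at h0
    have hp' : PartialSol N (σ₁.arr 26) (σ₁.arr 27) M (σ₁.arr 50) := by
      rwa [ea _ (by omega), ea _ (by omega)]
    have incr : ∀ (σ' : State), σ'.Bdd B → σ'.reg 13 = x → ∀ Q : ℕ → State → Prop,
        (∀ l ≤ 4, Q l (σ'.setReg 13 (x + 1))) →
        Run B (set 13 (bin .add (reg 13) (const 1))) σ' Q := by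
      intro σ' hb' h13 Q hQ
      refine Run.of_ok hB hb' (by simp [Prog.Ok, Expr.Ok, Expr.val]; omega) fun l hl => ?_
      simpa only [Prog.eval, Expr.val, Op.eval, h13] using hQ l hl
    simp only [Expr.cost]
    -- the variable has a value already
    have hskip : (σ₁.arr 50 x ≠ 0 ∨ σ₁.arr 50 (x + N) ≠ 0) → ∀ l ≤ 30, ∃ n' < N - x + 1,
        ∃ y ≤ N, (σ₁.setReg 13 (x + 1)).reg 5 = N ∧ (σ₁.setReg 13 (x + 1)).reg 13 = y ∧
        (∀ a < 30, (σ₁.setReg 13 (x + 1)).arr a = σ.arr a) ∧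
        (∀ v, (σ₁.setReg 13 (x + 1)).arr 30 v ≤ y) ∧
        (∀ v, (σ₁.setReg 13 (x + 1)).arr 40 v ≤ y) ∧
        (((σ₁.setReg 13 (x + 1)).reg 15 = 0 ∧
          PartialSol N (σ.arr 26) (σ.arr 27) M ((σ₁.setReg 13 (x + 1)).arr 50) ∧
          (∀ z < y, (σ₁.setReg 13 (x + 1)).arr 50 z ≠ 0 ∨
            (σ₁.setReg 13 (x + 1)).arr 50 (z + N) ≠ 0) ∧
          k + (1 + 1 + 1 + 1 + 1 + 1 + l) ≤
            600 * weight N (σ.arr 26) M ((σ₁.setReg 13 (x + 1)).arr 50) + 1300 * y ∧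
            n' = N - y + 1) ∨
         ((σ₁.setReg 13 (x + 1)).reg 15 ≠ 0 ∧ (∀ τ, ¬ Sat N (σ.arr 26) (σ.arr 27) M τ) ∧
          k + (1 + 1 + 1 + 1 + 1 + 1 + l) ≤ 1200 * (2 * N + M) + 1300 * y ∧ n' = 0)) := by
      intro hor l hl
      refine ⟨N - (x + 1) + 1, by omega, x + 1, by omega, by simpa using e5, by simp, ?_, ?_, ?_,
        Or.inl ⟨by simpa using e15, hp, ?_, ?_, rfl⟩⟩
      · exact ea
      · exact fun v => (m30 v).trans (by omega)
      · exact fun v => (m40 v).trans (by omega)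
      · intro z hz
        rcases Nat.lt_succ_iff_lt_or_eq.1 hz with h' | rfl
        exacts [hall z h', hor]
      · simp only [State.setReg_arr]; omega
    refine Run.seq (Run.cond hB hb₃ (by simp [Expr.Ok]) (fun hc => ?_) fun hc => ?_)
    · simp only [Expr.val, e13] at hc
      refine Run.of_ok hB hb₃ (by simp [Prog.Ok]) fun l hl => incr _ hb₃ e13 _ fun l' hl' => ?_
      refine hskip (Or.inl hc) _ ?_
      simp only [Prog.time, Expr.cost] at hl ⊢; omega
    · simp only [Expr.val, e13] at hc
      refine Run.cond hB hb₃ (by simp [Expr.Ok, Expr.val]; omega) (fun hc' => ?_) fun hc' => ?_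
      · simp only [Expr.val, Op.eval, e13, e5] at hc'
        refine Run.of_ok hB hb₃ (by simp [Prog.Ok]) fun l hl => incr _ hb₃ e13 _ fun l' hl' => ?_
        refine hskip (Or.inr hc') _ ?_
        simp only [Prog.time, Expr.cost] at hl ⊢; omega
      · simp only [Expr.val, Op.eval, e13, e5] at hc'
        refine (trial_run hB hb₃ hNB e5 e13 hx (hg.congr fun i hi => ea _ (by omega))
          (by rwa [ea _ (by omega), ea _ (by omega)]) hp' hc hc' e15 m30 m40).mono_frame hb₃ ?_
        rw [ea 26 (by omega), ea 27 (by omega)]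
        rintro l σ₂ ⟨m30', m40', h⟩ hb₂ hf
        obtain ⟨f5, f13, fa⟩ := trial_frame hf
        refine incr _ hb₂ (by rw [f13, e13]) _ fun l' hl' => ?_
        simp only [Expr.cost]
        rcases h with ⟨a1, a2, a3, a4, a5⟩ | ⟨a1, a2, a3⟩
        · refine ⟨N - (x + 1) + 1, by omega, x + 1, by omega, by simp [f5, e5], by simp, ?_, m30',
            m40', Or.inl ⟨by simpa using a1, a2, ?_, ?_, rfl⟩⟩
          · exact fun a ha => (fa a ha).trans (ea a ha)
          · intro z hz
            rcases Nat.lt_succ_iff_lt_or_eq.1 hz with h' | rfl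
            exacts [(hall z h').imp (a3 _) (a3 _), a4]
          · simp only [State.setReg_arr]; omega
        · refine ⟨0, by omega, x + 1, by omega, by simp [f5, e5], by simp, ?_, m30', m40',
            Or.inr ⟨by simpa using a1, a2, ?_, rfl⟩⟩
          · exact fun a ha => (fa a ha).trans (ea a ha)
          · have := hw (σ₁.arr 50)
            omega

end Ram

/-! ### Paths in a cactus -/

/-- A rooted spanning tree of the component of `s`, whose vertices are numbered such that every
vertex comes after its parent. -/
structure SearchTree {V : Type*} (G : SimpleGraph V) (s : V) where
  verts : Set V
  par : V → V
  num : V → ℕ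
  root_mem : s ∈ verts
  par_mem : ∀ v ∈ verts, v ≠ s → par v ∈ verts
  adj : ∀ v ∈ verts, v ≠ s → G.Adj (par v) v
  num_par : ∀ v ∈ verts, v ≠ s → num (par v) < num v
  closed : ∀ u ∈ verts, ∀ w, G.Adj u w → w ∈ verts
  num_inj : Set.InjOn num verts

namespace SearchTree

variable {V : Type*} {G : SimpleGraph V} {s t : V} (T : SearchTree G s)

/-- The vertex `v` belongs to the subtree of `c`. -/
def Sub (c v : V) : Prop :=
  Relation.ReflTransGen (fun x y => x ∈ T.verts ∧ x ≠ s ∧ T.par x = y) v c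

/-- The vertices `u` and `w` are joined by an edge of the tree. -/
def IsTreeEdge (u w : V) : Prop :=
  (u ∈ T.verts ∧ u ≠ s ∧ T.par u = w) ∨ (w ∈ T.verts ∧ w ≠ s ∧ T.par w = u)

/-- The vertices `u` and `w` are joined by an edge in the component of `s` that is not an edge of
the tree. -/
def NonTree (u w : V) : Prop := G.Adj u w ∧ u ∈ T.verts ∧ ¬ T.IsTreeEdge u w

variable {T} {a b c d u v w x : V}

theorem Sub.refl (v : V) : T.Sub v v := Relation.ReflTransGen.refl

theorem Sub.trans (h : T.Sub a b) (h' : T.Sub b c) : T.Sub a c := Relation.ReflTransGen.trans h' h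

theorem Sub.mem (h : T.Sub c v) (hv : v ∈ T.verts) : c ∈ T.verts := by
  induction h with
  | refl => exact hv
  | tail _ h _ => exact h.2.2 ▸ T.par_mem _ h.1 h.2.1

theorem sub_par (hv : v ∈ T.verts) (hs : v ≠ s) : T.Sub (T.par v) v :=
  Relation.ReflTransGen.single ⟨hv, hs, rfl⟩

theorem sub_iff (hv : v ∈ T.verts) (hs : v ≠ s) : T.Sub c v ↔ c = v ∨ T.Sub c (T.par v) := by
  constructor
  · intro h
    rcases Relation.ReflTransGen.cases_head h with h | ⟨y, ⟨-, -, rfl⟩, h⟩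
    exacts [Or.inl h.symm, Or.inr h]
  · rintro (rfl | h)
    exacts [Sub.refl _, h.trans (sub_par hv hs)]

theorem Sub.num_le (h : T.Sub c v) : T.num c ≤ T.num v := by
  induction h with
  | refl => exact le_rfl
  | tail _ h ih => exact (h.2.2 ▸ T.num_par _ h.1 h.2.1).le.trans ih

/-- The child of `c` in the direction of `v`. -/
theorem Sub.exists_child (h : T.Sub c v) (hne : c ≠ v) :
    ∃ d ∈ T.verts, d ≠ s ∧ T.par d = c ∧ T.Sub d v := by
  rcases Relation.ReflTransGen.cases_tail h with h | ⟨d, h, h1, h2, h3⟩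
  exacts [absurd h hne, ⟨d, h1, h2, h3, h⟩]

theorem Sub.total (h : T.Sub a v) (h' : T.Sub b v) : T.Sub a b ∨ T.Sub b a :=
  (Relation.ReflTransGen.total_of_right_unique
    (fun _ _ _ h1 h2 => h1.2.2.symm.trans h2.2.2) h h').symm

theorem Sub.of_num_le (h : T.Sub a v) (h' : T.Sub b v) (hv : v ∈ T.verts)
    (hn : T.num a ≤ T.num b) : T.Sub a b := by
  rcases h.total h' with h1 | h1
  · exact h1
  · have := T.num_inj (h.mem hv) (h'.mem hv) (le_antisymm hn h1.num_le)
    rw [this]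
    exact Sub.refl b

theorem sub_root (hv : v ∈ T.verts) : T.Sub s v := by
  induction hn : T.num v using Nat.strong_induction_on generalizing v with
  | _ n ih =>
    by_cases hs : v = s
    · rw [hs]; exact Sub.refl s
    · exact (ih _ (hn ▸ T.num_par v hv hs) (T.par_mem v hv hs) rfl).trans (sub_par hv hs)

theorem not_sub_par (hc : c ∈ T.verts) (hs : c ≠ s) : ¬ T.Sub c (T.par c) := fun h => by
  have := h.num_le
  have := T.num_par c hc hs
  omega

theorem Sub.eq_root (h : T.Sub c s) : c = s := by
  by_contra hne
  rcases Relation.ReflTransGen.cases_head h with h | ⟨y, ⟨-, h, -⟩, -⟩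
  exacts [hne h.symm, h rfl]

/-- Distinct children have disjoint subtrees. -/
theorem Sub.eq_of_par_eq (h : T.Sub c v) (h' : T.Sub d v) (hv : v ∈ T.verts) (hc : c ≠ s)
    (hd : d ≠ s) (he : T.par c = T.par d) : c = d := by
  have hc' := h.mem hv
  have hd' := h'.mem hv
  rcases h.total h' with h1 | h1
  · rcases (sub_iff hd' hd).1 h1 with h2 | h2
    · exact h2
    · exact absurd (he ▸ h2) (not_sub_par hc' hc)
  · rcases (sub_iff hc' hc).1 h1 with h2 | h2
    · exact h2.symm
    · exact absurd (he ▸ h2) (not_sub_par hd' hd)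

/-- The lowest common ancestor. -/
theorem exists_lca (hu : u ∈ T.verts) (hw : w ∈ T.verts) :
    ∃ y, T.Sub y u ∧ T.Sub y w ∧ ∀ z, T.Sub z u → T.Sub z w → T.Sub z y := by
  induction hn : T.num u using Nat.strong_induction_on generalizing u with
  | _ n ih =>
    by_cases h : T.Sub u w
    · exact ⟨u, Sub.refl u, h, fun z hz _ => hz⟩
    · have hs : u ≠ s := by
        rintro rfl
        exact h (sub_root hw)
      obtain ⟨y, h1, h2, h3⟩ := ih _ (hn ▸ T.num_par u hu hs) (T.par_mem u hu hs) rfl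
      refine ⟨y, h1.trans (sub_par hu hs), h2, fun z hz hz' => h3 z ?_ hz'⟩
      rcases (sub_iff hu hs).1 hz with rfl | h'
      exacts [absurd hz' h, h']

theorem IsTreeEdge.symm (h : T.IsTreeEdge u w) : T.IsTreeEdge w u := Or.symm h

theorem NonTree.symm (h : T.NonTree u w) : T.NonTree w u :=
  ⟨h.1.symm, T.closed _ h.2.1 _ h.1, fun h' => h.2.2 h'.symm⟩

theorem NonTree.mem_left (h : T.NonTree u w) : u ∈ T.verts := h.2.1

theorem NonTree.mem_right (h : T.NonTree u w) : w ∈ T.verts := h.symm.2.1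

/-- A tree edge that enters the subtree of `c` is the one above `c`. -/
theorem IsTreeEdge.eq_of_cross (h : T.IsTreeEdge u w) (hu : ¬ T.Sub c u) (hw : T.Sub c w) :
    u = T.par c ∧ w = c := by
  rcases h with ⟨h1, h2, rfl⟩ | ⟨h1, h2, rfl⟩
  · exact absurd (hw.trans (sub_par h1 h2)) hu
  · rcases (sub_iff h1 h2).1 hw with rfl | h
    exacts [⟨rfl, rfl⟩, absurd h hu]

theorem isTreeEdge_par (hc : c ∈ T.verts) (hs : c ≠ s) : T.IsTreeEdge c (T.par c) :=
  Or.inl ⟨hc, hs, rfl⟩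

/-- The tree as a graph. -/
def treeGraph (T : SearchTree G s) : SimpleGraph V where
  Adj u w := T.IsTreeEdge u w
  symm := ⟨fun _ _ h => h.symm⟩
  loopless := ⟨fun u h => by
    rcases h with ⟨h1, h2, h3⟩ | ⟨h1, h2, h3⟩ <;>
    · have := T.num_par u h1 h2
      rw [h3] at this
      exact lt_irrefl _ this⟩

theorem treeGraph_le : T.treeGraph ≤ G := by
  rintro u w (⟨h1, h2, rfl⟩ | ⟨h1, h2, rfl⟩)
  exacts [(T.adj u h1 h2).symm, T.adj w h1 h2]

theorem reachable_root (hv : v ∈ T.verts) : T.treeGraph.Reachable s v := by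
  induction hn : T.num v using Nat.strong_induction_on generalizing v with
  | _ n ih =>
    by_cases hs : v = s
    · rw [hs]
    · refine (ih _ (hn ▸ T.num_par v hv hs) (T.par_mem v hv hs) rfl).trans ?_
      exact SimpleGraph.Adj.reachable (G := T.treeGraph) (Or.inr ⟨hv, hs, rfl⟩)

/-- The fundamental cycle of an edge outside of the tree. -/
theorem NonTree.exists_cycle (h : T.NonTree u w) (hu : T.Sub c u) (hw : ¬ T.Sub c w) :
    ∃ p : G.Walk w w, p.IsCycle ∧ s(c, T.par c) ∈ p.edges ∧ s(u, w) ∈ p.edges ∧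
      ∀ a b, s(a, b) ∈ p.edges → s(a, b) = s(u, w) ∨ T.IsTreeEdge a b := by
  classical
  obtain ⟨p⟩ := (reachable_root h.mem_left).symm.trans (reachable_root h.mem_right)
  have hpath := p.bypass_isPath
  generalize p.bypass = p at hpath
  have hT : ∀ a b, s(a, b) ∈ p.edges → T.IsTreeEdge a b := fun a b hab =>
    p.adj_of_mem_edges hab
  refine ⟨.cons h.1.symm (p.mapLe treeGraph_le), ?_, ?_, ?_, ?_⟩
  · rw [SimpleGraph.Walk.cons_isCycle_iff]
    refine ⟨hpath.mapLe treeGraph_le, ?_⟩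
    rw [SimpleGraph.Walk.edges_mapLe_eq_edges]
    intro hm
    exact h.2.2 (hT _ _ hm).symm
  -- The tree path has to leave the subtree of `c`, and the only tree edge that does so is the one
  -- above `c`.
  · obtain ⟨d, hd, hd1, hd2⟩ := p.exists_boundary_dart {v | T.Sub c v} hu hw
    have := (d.adj.symm : T.IsTreeEdge _ _).eq_of_cross hd2 hd1
    rw [SimpleGraph.Walk.edges_cons, SimpleGraph.Walk.edges_mapLe_eq_edges]
    refine List.mem_cons_of_mem _ (List.mem_map.2 ⟨d, hd, ?_⟩)
    change s(d.fst, d.snd) = _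
    rw [this.1, this.2]
  · simp [Sym2.eq_swap]
  · intro a b hab
    rw [SimpleGraph.Walk.edges_cons, SimpleGraph.Walk.edges_mapLe_eq_edges] at hab
    rcases List.mem_cons.1 hab with hab | hab
    · exact Or.inl (hab.trans Sym2.eq_swap)
    · exact Or.inr (hT a b hab)

/-- In a cactus, every edge of the tree is covered by at most one edge outside of the tree. -/
theorem cover_unique (hG : G.IsCactus) (hc : c ∈ T.verts) (hs : c ≠ s) {u' w' : V}
    (h : T.NonTree u w) (hu : T.Sub c u) (hw : ¬ T.Sub c w)
    (h' : T.NonTree u' w') (hu' : T.Sub c u') (hw' : ¬ T.Sub c w') : u = u' ∧ w = w' := by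
  obtain ⟨p, hp, hp1, hp2, hp3⟩ := h.exists_cycle hu hw
  obtain ⟨q, hq, hq1, hq2, hq3⟩ := h'.exists_cycle hu' hw'
  -- Both fundamental cycles contain the edge above `c`, so the cactus property makes them equal as
  -- subgraphs. Since the first one has only one edge outside of the tree, the two edges agree; the
  -- sides on which their ends lie fix the order of the ends.
  have heq := hG _ (T.adj c hc hs).symm _ _ p q hp hq hp1 hq1
  have : s(u', w') ∈ p.edges := by
    rw [← SimpleGraph.Walk.mem_edges_toSubgraph, heq, SimpleGraph.Walk.mem_edges_toSubgraph]
    exact hq2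
  rcases hp3 _ _ this with h1 | h1
  · rcases Sym2.eq_iff.1 h1 with ⟨rfl, rfl⟩ | ⟨rfl, rfl⟩
    exacts [⟨rfl, rfl⟩, absurd hu' hw]
  · exact absurd h1 h'.2.2

end SearchTree

/-! ### Crossings of a vertex set, and monotone functions along a path. -/

namespace SimpleGraph.Walk

variable {V : Type*} {G : SimpleGraph V}

open Classical in
/-- A walk enters a set as often as it leaves it, up to its ends. -/
theorem countP_darts_cross {u v : V} (p : G.Walk u v) (A : V → Prop) :
    (p.darts.countP fun d => ¬ A d.fst ∧ A d.snd) + (if A u then 1 else 0) =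
      (p.darts.countP fun d => A d.fst ∧ ¬ A d.snd) + if A v then 1 else 0 := by
  induction p with
  | nil => simp
  | @cons u w v h p ih =>
    simp only [darts_cons, List.countP_cons]
    by_cases hu : A u <;> by_cases hw : A w <;> simp_all
    omega

/-- The function is the position on the path. It serves to exclude that a path uses an edge in both
directions or runs around a whole cycle. -/
theorem exists_increasing {u v : V} (p : G.Walk u v) (hp : p.IsPath) :
    ∃ pos : V → ℕ, ∀ d ∈ p.darts, pos d.fst < pos d.snd := by
  classical
  induction p with
  | nil => exact ⟨fun _ => 0, by simp⟩
  | @cons u w v h p ih =>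
    rw [cons_isPath_iff] at hp
    obtain ⟨pos, hpos⟩ := ih hp.1
    refine ⟨fun x => if x = u then 0 else pos x + 1, fun d hd => ?_⟩
    rw [darts_cons, List.mem_cons] at hd
    rcases hd with rfl | hd
    · simp [h.ne']
    · have h1 : d.fst ≠ u := fun he => hp.2 (he ▸ p.dart_fst_mem_support_of_mem_darts hd)
      have h2 : d.snd ≠ u := fun he => hp.2 (he ▸ p.dart_snd_mem_support_of_mem_darts hd)
      simpa [h1, h2] using hpos d hd

/-- A strictly increasing key cannot return to an earlier vertex. The lower bound on the support
strengthens the induction. -/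
theorem isPath_of_increasing {α : Type*} [LinearOrder α] (key : V → α) {u v : V} (p : G.Walk u v)
    (h : ∀ d ∈ p.darts, key d.fst < key d.snd) :
    p.IsPath ∧ ∀ x ∈ p.support, key u ≤ key x := by
  induction p with
  | nil => simp
  | @cons u w v h' p ih =>
    simp only [darts_cons, List.mem_cons, forall_eq_or_imp] at h
    obtain ⟨h1, h2⟩ := ih h.2
    rw [cons_isPath_iff]
    refine ⟨⟨h1, fun hu => absurd (h2 u hu) (not_le.2 h.1)⟩, fun x hx => ?_⟩
    rw [support_cons, List.mem_cons] at hx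
    rcases hx with rfl | hx
    exacts [le_rfl, h.1.le.trans (h2 x hx)]

end SimpleGraph.Walk

namespace SearchTree

variable {V : Type*} {G : SimpleGraph V} {s t : V} {T : SearchTree G s} {a b c d u v w x : V}

theorem mem_of_mem_support {y : V} (p : G.Walk y v) (hy : y ∈ T.verts) (hx : x ∈ p.support) :
    x ∈ T.verts := by
  induction p with
  | nil => simp_all
  | cons h p ih =>
    rw [SimpleGraph.Walk.support_cons, List.mem_cons] at hx
    rcases hx with rfl | hx
    exacts [hy, ih (T.closed _ hy _ h) hx]

theorem isTreeEdge_or_nonTree (hu : u ∈ T.verts) (h : G.Adj u w) :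
    T.IsTreeEdge u w ∨ T.NonTree u w := by
  by_cases h' : T.IsTreeEdge u w
  exacts [Or.inl h', Or.inr ⟨h, hu, h'⟩]

/-- An edge that enters the subtree of `c` is the tree edge above `c` or an edge outside of the
tree. -/
theorem enter_cases (hu : u ∈ T.verts) (h : G.Adj u w) (h1 : ¬ T.Sub c u) (h2 : T.Sub c w) :
    (u = T.par c ∧ w = c) ∨ T.NonTree w u :=
  (isTreeEdge_or_nonTree hu h).imp (fun h => h.eq_of_cross h1 h2) fun h => h.symm

section path

variable {Q : G.Walk s t}

-- A path uses every edge at most once, and the boundary of the subtree of `c` has at most two edges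
-- by `cover_unique`. Together with `countP_darts_cross`, this count fixes how a path passes through
-- a subtree.
open Classical in
theorem countP_le_two (hG : G.IsCactus) (hQ : Q.IsPath) (hc : c ∈ T.verts) (hs : c ≠ s) :
    (Q.darts.countP fun d => ¬ T.Sub c d.fst ∧ T.Sub c d.snd) +
      (Q.darts.countP fun d => T.Sub c d.fst ∧ ¬ T.Sub c d.snd) ≤ 2 := by
  obtain ⟨e, he⟩ : ∃ e, ∀ u w, T.NonTree u w → T.Sub c u → ¬ T.Sub c w → s(u, w) = e := by
    by_cases h : ∃ u w, T.NonTree u w ∧ T.Sub c u ∧ ¬ T.Sub c w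
    · obtain ⟨u, w, h, hu, hw⟩ := h
      refine ⟨s(u, w), fun u' w' h' hu' hw' => ?_⟩
      obtain ⟨rfl, rfl⟩ := cover_unique hG hc hs h hu hw h' hu' hw'
      rfl
    · exact ⟨s(s, s), fun u w h1 h2 h3 => absurd ⟨u, w, h1, h2, h3⟩ h⟩
  have hsum : (Q.darts.countP fun d => ¬ T.Sub c d.fst ∧ T.Sub c d.snd) +
      (Q.darts.countP fun d => T.Sub c d.fst ∧ ¬ T.Sub c d.snd) =
      (Q.darts.filter fun d => ¬ (T.Sub c d.fst ↔ T.Sub c d.snd)).length := by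
    rw [← List.countP_eq_length_filter]
    induction Q.darts with
    | nil => simp
    | cons d l ih =>
      simp only [List.countP_cons]
      by_cases h1 : T.Sub c d.fst <;> by_cases h2 : T.Sub c d.snd <;> simp_all <;> omega
  rw [hsum, ← List.length_map (f := SimpleGraph.Dart.edge)]
  have hnd : ((Q.darts.filter fun d => ¬ (T.Sub c d.fst ↔ T.Sub c d.snd)).map
      SimpleGraph.Dart.edge).Nodup :=
    hQ.isTrail.edges_nodup.sublist (List.filter_sublist.map _)
  rw [← List.toFinset_card_of_nodup hnd]
  refine (Finset.card_le_card (t := {s(c, T.par c), e}) fun f hf => ?_).trans Finset.card_le_two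
  obtain ⟨d, hd, rfl⟩ := List.mem_map.1 (List.mem_toFinset.1 hf)
  rw [List.mem_filter] at hd
  have hm : d.fst ∈ T.verts :=
    mem_of_mem_support Q T.root_mem (Q.dart_fst_mem_support_of_mem_darts hd.1)
  have hcr := hd.2
  simp only [decide_eq_true_eq] at hcr
  simp only [Finset.mem_insert, Finset.mem_singleton]
  change s(d.fst, d.snd) = _ ∨ s(d.fst, d.snd) = _
  by_cases h1 : T.Sub c d.fst
  · have h2 : ¬ T.Sub c d.snd := by tauto
    rcases enter_cases (T.closed _ hm _ d.adj) d.adj.symm h2 h1 with ⟨h3, h4⟩ | h3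
    · left; rw [h3, h4]
    · right; exact he _ _ h3 h1 h2
  · have h2 : T.Sub c d.snd := by tauto
    rcases enter_cases hm d.adj h1 h2 with ⟨h3, h4⟩ | h3
    · left; rw [h3, h4, Sym2.eq_swap]
    · right; rw [Sym2.eq_swap]; exact he _ _ h3 h2 h1

/-- A path to a vertex of the subtree of `c` does not leave this subtree. -/
theorem not_leave (hG : G.IsCactus) (hQ : Q.IsPath) (hc : c ∈ T.verts) (hs : c ≠ s)
    (ht : T.Sub c t) {d : G.Dart} (hd : d ∈ Q.darts) :
    ¬ (T.Sub c d.fst ∧ ¬ T.Sub c d.snd) := by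
  classical
  intro h
  -- As `s` lies outside and `t` inside, there is one more entry than exits. Their sum is at most
  -- two, hence there is no exit.
  have h1 := countP_le_two hG hQ hc hs
  have h2 := Q.countP_darts_cross (T.Sub c)
  rw [if_neg (fun h => hs h.eq_root), if_pos ht] at h2
  have h3 := List.countP_pos_iff (p := fun d : G.Dart => decide (T.Sub c d.fst ∧ ¬ T.Sub c d.snd)).2
    ⟨d, hd, by simpa using h⟩
  omega

theorem exists_enter (hs : c ≠ s) (ht : T.Sub c t) :
    ∃ d ∈ Q.darts, ¬ T.Sub c d.fst ∧ T.Sub c d.snd := by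
  obtain ⟨d, hd, h1, h2⟩ := Q.exists_boundary_dart {v | ¬ T.Sub c v} (fun h => hs h.eq_root)
    (not_not.2 ht)
  exact ⟨d, hd, h1, not_not.1 h2⟩

/-- A path to a vertex of the subtree of `c` enters this subtree only once. -/
theorem enter_unique (hG : G.IsCactus) (hQ : Q.IsPath) (hc : c ∈ T.verts) (hs : c ≠ s)
    (ht : T.Sub c t) {d d' : G.Dart} (hd : d ∈ Q.darts) (hd' : d' ∈ Q.darts)
    (h : ¬ T.Sub c d.fst ∧ T.Sub c d.snd) (h' : ¬ T.Sub c d'.fst ∧ T.Sub c d'.snd) : d = d' := by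
  classical
  have h1 := countP_le_two hG hQ hc hs
  have h2 := Q.countP_darts_cross (T.Sub c)
  rw [if_neg (fun h => hs h.eq_root), if_pos ht] at h2
  have h3 : (Q.darts.countP fun d => ¬ T.Sub c d.fst ∧ T.Sub c d.snd) = 1 := by omega
  rw [List.countP_eq_length_filter, List.length_eq_one_iff] at h3
  obtain ⟨x, hx⟩ := h3
  have m1 : d ∈ [x] := hx ▸ List.mem_filter.2 ⟨hd, by simpa using h⟩
  have m2 : d' ∈ [x] := hx ▸ List.mem_filter.2 ⟨hd', by simpa using h'⟩
  rw [List.mem_singleton] at m1 m2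
  rw [m1, m2]

/-- Both ends of the path lie outside of the subtree, so entries and exits are equal in number. -/
theorem exists_leave_iff (hs : c ≠ s) (ht : ¬ T.Sub c t) :
    (∃ d ∈ Q.darts, T.Sub c d.fst ∧ ¬ T.Sub c d.snd) ↔
    ∃ d ∈ Q.darts, ¬ T.Sub c d.fst ∧ T.Sub c d.snd := by
  classical
  have h2 := Q.countP_darts_cross (T.Sub c)
  rw [if_neg (fun h => hs h.eq_root), if_neg ht] at h2
  have h3 := List.countP_pos_iff (l := Q.darts)
    (p := fun d : G.Dart => decide (T.Sub c d.fst ∧ ¬ T.Sub c d.snd))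
  have h4 := List.countP_pos_iff (l := Q.darts)
    (p := fun d : G.Dart => decide (¬ T.Sub c d.fst ∧ T.Sub c d.snd))
  simp only [decide_eq_true_eq] at h3 h4
  rw [← h3, ← h4]
  omega

end path

end SearchTree

/-! ### The constraints on paths and the order of traversal. -/

namespace SearchTree

variable {V : Type*} {G : SimpleGraph V} {s t : V} {T : SearchTree G s} {a b c d u v w x : V}

/-- Data for the order in which the paths from `s` to `t` traverse vertices and edges. For a vertex
`v`, `anc v` is the number of its last ancestor on the tree path from `s` to `t`. The predicate
`up` singles out the vertices from which a path has to go up in the tree, and `tail` is the end at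
which a path enters an edge. -/
structure PathKeys (T : SearchTree G s) (t : V) where
  anc : V → ℕ
  up : V → Prop
  tail : Sym2 V → V
  rank : V → ℕ
  anc_of_sub : ∀ v, T.Sub v t → anc v = T.num v
  anc_of_not_sub : ∀ v ∈ T.verts, v ≠ s → ¬ T.Sub v t → anc v = anc (T.par v)
  up_of : ∀ c ∈ T.verts, c ≠ s → ¬ T.Sub c t → ∀ u w, T.NonTree u w → anc w < anc u →
    T.Sub c u → ¬ T.Sub c w → up c
  not_up_of : ∀ c ∈ T.verts, c ≠ s → ¬ T.Sub c t → ∀ u w, T.NonTree u w → anc w < anc u →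
    ¬ T.Sub c u → T.Sub c w → ¬ up c
  tail_of_sub : ∀ c ∈ T.verts, c ≠ s → T.Sub c t → tail s(c, T.par c) = T.par c
  tail_of_up : ∀ c ∈ T.verts, c ≠ s → ¬ T.Sub c t → up c → tail s(c, T.par c) = c
  tail_of_not_up : ∀ c ∈ T.verts, c ≠ s → ¬ T.Sub c t → ¬ up c → tail s(c, T.par c) = T.par c
  tail_nonTree : ∀ u w, T.NonTree u w → anc w < anc u → tail s(u, w) = w
  rank_of_up : ∀ c ∈ T.verts, c ≠ s → ¬ T.Sub c t → up c → rank c < rank (T.par c)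
  rank_of_not_up : ∀ c ∈ T.verts, c ≠ s → ¬ T.Sub c t → ¬ up c → rank (T.par c) < rank c

/-- The constraints on the set of the edges of a path from `s` to `t`. -/
structure IsFlow (T : SearchTree G s) (t : V) (z : Set (Sym2 V)) : Prop where
  xor : ∀ c ∈ T.verts, c ≠ s → T.Sub c t → ∀ u w, T.NonTree u w → T.Sub c u → ¬ T.Sub c w →
    (s(c, T.par c) ∈ z ↔ s(u, w) ∉ z)
  bridge : ∀ c ∈ T.verts, c ≠ s → T.Sub c t → (∀ u w, T.NonTree u w → T.Sub c u → T.Sub c w) →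
    s(c, T.par c) ∈ z
  side : ∀ c ∈ T.verts, c ≠ s → ¬ T.Sub c t → ∀ u w, T.NonTree u w → T.Sub c u → ¬ T.Sub c w →
    s(u, w) ∈ z → s(c, T.par c) ∈ z

theorem exists_dart {y : V} {Q : G.Walk s y} {e : Sym2 V} (h : e ∈ Q.edges) :
    ∃ d ∈ Q.darts, s(d.fst, d.snd) = e := by
  obtain ⟨d, hd, rfl⟩ := List.mem_map.1 h
  exact ⟨d, hd, rfl⟩

theorem mem_edges_of_dart {y : V} {Q : G.Walk s y} {d : G.Dart} (h : d ∈ Q.darts) :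
    s(d.fst, d.snd) ∈ Q.edges := List.mem_map.2 ⟨d, h, rfl⟩

theorem dart_fst_mem {y : V} {Q : G.Walk s y} {d : G.Dart} (h : d ∈ Q.darts) : d.fst ∈ T.verts :=
  mem_of_mem_support Q T.root_mem (Q.dart_fst_mem_support_of_mem_darts h)

theorem dart_snd_mem {y : V} {Q : G.Walk s y} {d : G.Dart} (h : d ∈ Q.darts) : d.snd ∈ T.verts :=
  mem_of_mem_support Q T.root_mem (Q.dart_snd_mem_support_of_mem_darts h)

/-- The edges of a path satisfy the constraints. -/
theorem isFlow_of_isPath (hG : G.IsCactus) {Q : G.Walk s t} (hQ : Q.IsPath) :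
    IsFlow T t {e | e ∈ Q.edges} := by
  -- a dart whose edge crosses the boundary of the subtree of `c` towards `t` enters it
  have enter : ∀ c ∈ T.verts, c ≠ s → T.Sub c t → ∀ u w, T.Sub c u → ¬ T.Sub c w →
      ∀ d ∈ Q.darts, s(d.fst, d.snd) = s(u, w) → ¬ T.Sub c d.fst ∧ T.Sub c d.snd := by
    intro c hc hs ht u w hu hw d hd he
    rcases Sym2.eq_iff.1 he with ⟨h1, h2⟩ | ⟨h1, h2⟩
    · exact absurd ⟨h1 ▸ hu, h2 ▸ hw⟩ (not_leave hG hQ hc hs ht hd)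
    · exact ⟨h1 ▸ hw, h2 ▸ hu⟩
  -- For a subtree that contains `t`, the first three goals say that it is entered exactly once: not
  -- through both boundary edges, through one of them if there are two, and through the tree edge if
  -- it is the only one.
  refine ⟨fun c hc hs ht u w h hu hw => ⟨fun h1 h2 => ?_, fun h1 => ?_⟩, fun c hc hs ht h => ?_,
    fun c hc hs ht u w h hu hw h1 => ?_⟩
  · obtain ⟨d, hd, he⟩ := exists_dart h1
    obtain ⟨d', hd', he'⟩ := exists_dart h2
    have := enter_unique hG hQ hc hs ht hd hd'
      (enter c hc hs ht _ _ (Sub.refl c) (not_sub_par hc hs) d hd he)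
      (enter c hc hs ht _ _ hu hw d' hd' he')
    subst this
    rw [he] at he'
    refine h.2.2 ?_
    rcases Sym2.eq_iff.1 he' with ⟨rfl, rfl⟩ | ⟨rfl, rfl⟩
    exacts [isTreeEdge_par hc hs, (isTreeEdge_par hc hs).symm]
  · obtain ⟨d, hd, hd1, hd2⟩ := exists_enter (Q := Q) hs ht
    have hm := mem_edges_of_dart hd
    rcases enter_cases (dart_fst_mem hd) d.adj hd1 hd2 with ⟨h3, h4⟩ | h3
    · rw [h3, h4, Sym2.eq_swap] at hm
      exact hm
    · obtain ⟨h4, h5⟩ := cover_unique hG hc hs h hu hw h3 hd2 hd1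
      rw [← h4, ← h5, Sym2.eq_swap] at hm
      exact absurd hm h1
  · obtain ⟨d, hd, hd1, hd2⟩ := exists_enter (Q := Q) hs ht
    have hm := mem_edges_of_dart hd
    rcases enter_cases (dart_fst_mem hd) d.adj hd1 hd2 with ⟨h3, h4⟩ | h3
    · rw [h3, h4, Sym2.eq_swap] at hm
      exact hm
    · exact absurd (h _ _ h3 hd2) hd1
  · obtain ⟨d, hd, he⟩ := exists_dart h1
    -- A subtree without `t` that is crossed one way is also crossed the other way. The second
    -- crossing uses the tree edge, since using the same outside edge backwards would contradict the
    -- positions on the path.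
    rcases Sym2.eq_iff.1 he with ⟨h3, h4⟩ | ⟨h3, h4⟩
    · obtain ⟨d', hd', h5, h6⟩ := (exists_leave_iff hs ht).1 ⟨d, hd, h3 ▸ hu, h4 ▸ hw⟩
      have hm := mem_edges_of_dart hd'
      rcases enter_cases (dart_fst_mem hd') d'.adj h5 h6 with ⟨h7, h8⟩ | h7
      · rw [h7, h8, Sym2.eq_swap] at hm
        exact hm
      · obtain ⟨h8, h9⟩ := cover_unique hG hc hs h hu hw h7 h6 h5
        obtain ⟨pos, hpos⟩ := Q.exists_increasing hQ
        have p1 := hpos d hd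
        have p2 := hpos d' hd'
        rw [h3, h4] at p1
        rw [← h8, ← h9] at p2
        omega
    · obtain ⟨d', hd', h5, h6⟩ := (exists_leave_iff hs ht).2 ⟨d, hd, h3 ▸ hw, h4 ▸ hu⟩
      have hm := mem_edges_of_dart hd'
      rcases enter_cases (dart_snd_mem hd') d'.adj.symm h6 h5 with ⟨h7, h8⟩ | h7
      · rw [h7, h8] at hm
        exact hm
      · obtain ⟨h8, h9⟩ := cover_unique hG hc hs h hu hw h7 h5 h6
        obtain ⟨pos, hpos⟩ := Q.exists_increasing hQ
        have p1 := hpos d hd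
        have p2 := hpos d' hd'
        rw [h3, h4] at p1
        rw [← h8, ← h9] at p2
        omega

namespace PathKeys

variable (K : PathKeys T t)

/-- The keys are compared lexicographically. -/
def key (v : V) : ℕ ×ₗ ℕ := toLex (K.anc v, K.rank v)

variable {K}

theorem key_lt_of_anc (h : K.anc u < K.anc v) : K.key u < K.key v :=
  Prod.Lex.toLex_lt_toLex.2 (Or.inl h)

theorem key_lt_of_rank (h : K.anc u = K.anc v) (h' : K.rank u < K.rank v) : K.key u < K.key v :=
  Prod.Lex.toLex_lt_toLex.2 (Or.inr ⟨h, h'⟩)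

/-- The two recursive fields of `PathKeys` determine `anc v` as the number of the lowest common
ancestor of `v` and `t`, the vertex at which the branch of `v` leaves the tree path. -/
theorem anc_spec (ht : t ∈ T.verts) (hv : v ∈ T.verts) : ∃ x, T.Sub x t ∧ T.Sub x v ∧
    K.anc v = T.num x ∧ ∀ y, T.Sub y t → T.Sub y v → T.Sub y x := by
  induction hn : T.num v using Nat.strong_induction_on generalizing v with
  | _ n ih =>
    by_cases h : T.Sub v t
    · exact ⟨v, h, Sub.refl v, K.anc_of_sub v h, fun y _ hy => hy⟩
    · have hs : v ≠ s := by
        rintro rfl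
        exact h (sub_root ht)
      obtain ⟨x, h1, h2, h3, h4⟩ := ih _ (hn ▸ T.num_par v hv hs) (T.par_mem v hv hs) rfl
      refine ⟨x, h1, h2.trans (sub_par hv hs), (K.anc_of_not_sub v hv hs h).trans h3,
        fun y hy hyv => h4 y hy ?_⟩
      rcases (sub_iff hv hs).1 hyv with rfl | h'
      exacts [absurd hy h, h']

theorem num_le_anc (ht : t ∈ T.verts) (hv : v ∈ T.verts) (hx : T.Sub x t) (hxv : T.Sub x v) :
    T.num x ≤ K.anc v := by
  obtain ⟨y, h1, h2, h3, h4⟩ := K.anc_spec ht hv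
  rw [h3]
  exact (h4 x hx hxv).num_le

/-- If `u` branches off the tree path to `t` later than `w`, then so it does at a vertex of this
path above `u` but not above `w`. -/
theorem exists_sub_of_anc_lt (ht : t ∈ T.verts) (hu : u ∈ T.verts) (hw : w ∈ T.verts)
    (h : K.anc w < K.anc u) : ∃ x ∈ T.verts, x ≠ s ∧ T.Sub x t ∧ T.Sub x u ∧ ¬ T.Sub x w := by
  obtain ⟨x, h1, h2, h3, h4⟩ := K.anc_spec ht hu
  have hxw : ¬ T.Sub x w := fun hxw => by
    have := K.num_le_anc ht hw h1 hxw
    omega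
  exact ⟨x, h1.mem ht, fun hx => hxw (hx ▸ sub_root hw), h1, h2, hxw⟩

/-- Equal numbers would mean the same branching vertex, which lies below `c` on account of `u` and
above `w`. -/
theorem anc_ne (ht : t ∈ T.verts) (hu : u ∈ T.verts) (hw : w ∈ T.verts) (hc : T.Sub c t)
    (hcu : T.Sub c u) (hcw : ¬ T.Sub c w) : K.anc u ≠ K.anc w := by
  obtain ⟨x, h1, h2, h3, h4⟩ := K.anc_spec ht hu
  obtain ⟨y, h1', h2', h3', h4'⟩ := K.anc_spec ht hw
  intro he
  have : x = y := T.num_inj (h1.mem ht) (h1'.mem ht) (by rw [← h3, ← h3', he])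
  subst this
  exact hcw ((h4 c hc hcu).trans h2')

/-- A subtree off the tree path hangs on a single vertex of this path, so inside of it only the rank
can distinguish keys. -/
theorem anc_eq_of_sub (hct : ¬ T.Sub c t) (h : T.Sub c v) : K.anc v = K.anc c := by
  induction h with
  | refl => rfl
  | @tail x y hvx hxy ih =>
    obtain ⟨h1, h2, rfl⟩ := hxy
    have hx : ¬ T.Sub x t := fun h => hct ((sub_par h1 h2).trans h)
    rw [ih hx, K.anc_of_not_sub x h1 h2 hx]

/-- A path that uses an edge outside of the tree uses it as a detour of the tree path. -/
theorem anc_ne_of_dart (K : PathKeys T t) (hG : G.IsCactus) (ht : t ∈ T.verts) {Q : G.Walk s t}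
    (hQ : Q.IsPath) {d : G.Dart} (hd : d ∈ Q.darts) (hN : T.NonTree d.fst d.snd) :
    K.anc d.fst ≠ K.anc d.snd := by
  intro he
  -- If both ends had the same branching vertex, the cycle of `d` would contain no edge of the tree
  -- path. Every subtree whose boundary `d` crosses would then be crossed a second time, through its
  -- tree edge and in the opposite sense, so the path would run around the whole cycle.
  obtain ⟨pos, hpos⟩ := Q.exists_increasing hQ
  have hpd := hpos d hd
  have hP : ∀ c, T.Sub c t → (T.Sub c d.fst ↔ T.Sub c d.snd) := fun c hc => by
    by_contra h
    by_cases h1 : T.Sub c d.fst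
    · exact K.anc_ne ht hN.mem_left hN.mem_right hc h1 (by tauto) he
    · exact K.anc_ne ht hN.mem_right hN.mem_left hc (by tauto) h1 he.symm
  -- the tree edges on the side of the second end are traversed upwards
  have hup : ∀ c ∈ T.verts, c ≠ s → ¬ T.Sub c d.fst → T.Sub c d.snd → pos c < pos (T.par c) := by
    intro c hc hs h1 h2
    have hct : ¬ T.Sub c t := fun h => by have := hP c h; tauto
    obtain ⟨d', hd', h5, h6⟩ := (exists_leave_iff hs hct).2 ⟨d, hd, h1, h2⟩
    have := hpos d' hd'
    rcases enter_cases (dart_snd_mem hd') d'.adj.symm h6 h5 with ⟨h7, h8⟩ | h7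
    · rwa [h7, h8] at this
    · obtain ⟨h8, h9⟩ := cover_unique hG hc hs hN.symm h2 h1 h7 h5 h6
      rw [← h8, ← h9] at this
      omega
  have hdown : ∀ c ∈ T.verts, c ≠ s → T.Sub c d.fst → ¬ T.Sub c d.snd → pos (T.par c) < pos c := by
    intro c hc hs h1 h2
    have hct : ¬ T.Sub c t := fun h => by have := hP c h; tauto
    obtain ⟨d', hd', h5, h6⟩ := (exists_leave_iff hs hct).1 ⟨d, hd, h1, h2⟩
    have := hpos d' hd'
    rcases enter_cases (dart_fst_mem hd') d'.adj h5 h6 with ⟨h7, h8⟩ | h7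
    · rwa [h7, h8] at this
    · obtain ⟨h8, h9⟩ := cover_unique hG hc hs hN h1 h2 h7 h6 h5
      rw [← h8, ← h9] at this
      omega
  -- Positions do not decrease from `d.snd` up to the lowest common ancestor `y` and on down to
  -- `d.fst`, whereas `d` itself leads from a smaller to a larger position.
  obtain ⟨y, hy1, hy2, hy3⟩ := exists_lca hN.mem_left hN.mem_right
  have h1 : ∀ x, T.Sub x d.snd → T.Sub y x → pos d.snd ≤ pos x := by
    intro x hx
    induction hx with
    | refl => exact fun _ => le_rfl
    | @tail x x' hvx hxx' ih =>
      obtain ⟨h1, h2, rfl⟩ := hxx'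
      intro hy
      have hf : ¬ T.Sub x d.fst := fun hf => not_sub_par h1 h2 ((hy3 x hf hvx).trans hy)
      exact (ih (hy.trans (sub_par h1 h2))).trans (hup x h1 h2 hf hvx).le
  have h2 : ∀ x, T.Sub x d.fst → T.Sub y x → pos x ≤ pos d.fst := by
    intro x hx
    induction hx with
    | refl => exact fun _ => le_rfl
    | @tail x x' hvx hxx' ih =>
      obtain ⟨h1, h2, rfl⟩ := hxx'
      intro hy
      have hf : ¬ T.Sub x d.snd := fun hf => not_sub_par h1 h2 ((hy3 x hvx hf).trans hy)
      exact (hdown x h1 h2 hvx hf).le.trans (ih (hy.trans (sub_par h1 h2)))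
  have := h1 y hy2 (Sub.refl y)
  have := h2 y hy1 (Sub.refl y)
  omega

/-- Every path from `s` to `t` enters each of its edges at the tail, and the keys increase. -/
theorem dart_of_isPath (K : PathKeys T t) (hG : G.IsCactus) (ht : t ∈ T.verts) {Q : G.Walk s t}
    (hQ : Q.IsPath) {d : G.Dart} (hd : d ∈ Q.darts) :
    K.tail s(d.fst, d.snd) = d.fst ∧ K.key d.fst < K.key d.snd := by
  -- edges outside of the tree
  have hnon : ∀ d ∈ Q.darts, T.NonTree d.fst d.snd → K.anc d.fst < K.anc d.snd := by
    intro d hd hN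
    rcases lt_or_gt_of_ne (K.anc_ne_of_dart hG ht hQ hd hN) with h | h
    · exact h
    -- Using the edge in the direction of decreasing `anc` would leave the subtree of a vertex above
    -- `t`.
    · obtain ⟨x, h1, h2, h3, h4, h5⟩ := K.exists_sub_of_anc_lt ht hN.mem_left hN.mem_right h
      exact absurd ⟨h4, h5⟩ (not_leave hG hQ h1 h2 h3 hd)
  rcases isTreeEdge_or_nonTree (dart_fst_mem hd) d.adj with hT | hN
  · rcases hT with ⟨hc, hs, he⟩ | ⟨hc, hs, he⟩
    · -- from a vertex to its parent
      have hcr : T.Sub d.fst d.fst ∧ ¬ T.Sub d.fst d.snd := ⟨Sub.refl _, he ▸ not_sub_par hc hs⟩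
      have hct : ¬ T.Sub d.fst t := fun h => not_leave hG hQ hc hs h hd hcr
      -- The subtree left through its tree edge was entered through the other boundary edge, and the
      -- direction of that one decides `up`.
      obtain ⟨d', hd', h5, h6⟩ := (exists_leave_iff hs hct).1 ⟨d, hd, hcr⟩
      have hup : K.up d.fst := by
        rcases enter_cases (dart_fst_mem hd') d'.adj h5 h6 with ⟨h7, h8⟩ | h7
        · obtain ⟨pos, hpos⟩ := Q.exists_increasing hQ
          have p1 := hpos d hd
          have p2 := hpos d' hd'
          rw [h7, h8, he] at p2
          omega
        · exact K.up_of _ hc hs hct _ _ h7 (hnon d' hd' h7.symm) h6 h5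
      rw [← he]
      exact ⟨K.tail_of_up _ hc hs hct hup, key_lt_of_rank (K.anc_of_not_sub _ hc hs hct)
        (K.rank_of_up _ hc hs hct hup)⟩
    · -- from a vertex to a child
      have hcr : ¬ T.Sub d.snd d.fst ∧ T.Sub d.snd d.snd := ⟨he ▸ not_sub_par hc hs, Sub.refl _⟩
      rw [Sym2.eq_swap, ← he]
      by_cases hct : T.Sub d.snd t
      · refine ⟨K.tail_of_sub _ hc hs hct, key_lt_of_anc ?_⟩
        rw [K.anc_of_sub _ hct, K.anc_of_sub _ ((sub_par hc hs).trans hct)]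
        exact T.num_par _ hc hs
      · obtain ⟨d', hd', h5, h6⟩ := (exists_leave_iff hs hct).2 ⟨d, hd, hcr⟩
        have hup : ¬ K.up d.snd := by
          rcases enter_cases (dart_snd_mem hd') d'.adj.symm h6 h5 with ⟨h7, h8⟩ | h7
          · obtain ⟨pos, hpos⟩ := Q.exists_increasing hQ
            have p1 := hpos d hd
            have p2 := hpos d' hd'
            rw [h7, h8, he] at p2
            omega
          · exact K.not_up_of _ hc hs hct _ _ h7.symm (hnon d' hd' h7) h6 h5
        exact ⟨K.tail_of_not_up _ hc hs hct hup,
          key_lt_of_rank (K.anc_of_not_sub _ hc hs hct).symm (K.rank_of_not_up _ hc hs hct hup)⟩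
  · have := hnon d hd hN
    rw [Sym2.eq_swap]
    exact ⟨K.tail_nonTree _ _ hN.symm this, key_lt_of_anc this⟩

/-- The condition on a vertex that is reached by a path inside of `z`. -/
def Open (K : PathKeys T t) (z : Set (Sym2 V)) (v : V) : Prop :=
  v ∈ T.verts ∧
  ((T.Sub v t ∧ ∀ c ∈ T.verts, c ≠ s → T.par c = v → T.Sub c t → ∀ u w, T.NonTree u w →
      T.Sub c u → ¬ T.Sub c w → s(u, w) ∈ z → T.Sub v w) ∨
   (¬ T.Sub v t ∧ ∃ u w, T.NonTree u w ∧ s(u, w) ∈ z ∧ K.anc w < K.anc u ∧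
      (T.Sub v w ∧ ¬ T.Sub v u ∨ T.Sub v u ∧ ¬ T.Sub v w)))

/-- The end of a detour. -/
theorem open_of_detour (K : PathKeys T t) (hG : G.IsCactus) (ht : t ∈ T.verts)
    {z : Set (Sym2 V)} (hN : T.NonTree u w) (hlt : K.anc w < K.anc u) (hx : T.Sub x t)
    (hxu : T.Sub x u) (ha : K.anc u = T.num x) : K.Open z x := by
  refine ⟨hx.mem ht, Or.inl ⟨hx, ?_⟩⟩
  rintro c hc hs rfl hct u' w' hN' hcu' hcw' -
  -- Otherwise the next detour would also cover the edge above `T.par c`, as the finished detour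
  -- does, so the two would be the same edge. But then `u` would lie below `c` and branch off later
  -- than `anc u` says.
  by_contra hxw'
  have hxs : T.par c ≠ s := fun h => by
    rw [h] at hxw'
    exact hxw' (sub_root hN'.mem_right)
  have hxw : ¬ T.Sub (T.par c) w := fun h => by
    have := K.num_le_anc ht hN.mem_right hx h
    omega
  obtain ⟨rfl, rfl⟩ := cover_unique hG (hx.mem ht) hxs hN hxu hxw hN'
    ((sub_par hc hs).trans hcu') hxw'
  have := K.num_le_anc ht hN.mem_left hct hcu'
  have := T.num_par c hc hs
  omega

/-- A set of edges that satisfies the constraints leads on. -/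
theorem Open.step {z : Set (Sym2 V)} (hz : IsFlow T t z) (hG : G.IsCactus) (ht : t ∈ T.verts)
    (h : K.Open z v) (hvt : v ≠ t) : ∃ v', G.Adj v v' ∧ s(v, v') ∈ z ∧ K.tail s(v, v') = v ∧
      K.key v < K.key v' ∧ K.Open z v' := by
  -- crossing an edge outside of the tree
  have cross : ∀ u w, T.NonTree u w → s(u, w) ∈ z → K.anc w < K.anc u → w = v →
      ∃ v', G.Adj v v' ∧ s(v, v') ∈ z ∧ K.tail s(v, v') = v ∧ K.key v < K.key v' ∧
        K.Open z v' := by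
    rintro u w hN huw hlt rfl
    refine ⟨u, hN.1.symm, ?_, ?_, key_lt_of_anc hlt, ?_⟩
    · rwa [Sym2.eq_swap]
    · rw [Sym2.eq_swap]
      exact K.tail_nonTree u w hN hlt
    by_cases hut : T.Sub u t
    · exact K.open_of_detour hG ht hN hlt hut (Sub.refl u) (K.anc_of_sub u hut)
    · refine ⟨hN.mem_left, Or.inr ⟨hut, u, w, hN, huw, hlt, Or.inr ⟨Sub.refl u, fun h => ?_⟩⟩⟩
      rw [K.anc_eq_of_sub hut h] at hlt
      exact lt_irrefl _ hlt
  -- going down to a child that is not on the way to `t`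
  have down : ∀ u w, T.NonTree u w → s(u, w) ∈ z → K.anc w < K.anc u → ∀ d ∈ T.verts, d ≠ s →
      T.par d = v → ¬ T.Sub d t → T.Sub d w → ¬ T.Sub d u →
      ∃ v', G.Adj v v' ∧ s(v, v') ∈ z ∧ K.tail s(v, v') = v ∧ K.key v < K.key v' ∧
        K.Open z v' := by
    rintro u w hN huw hlt d hd hds rfl hdt hdw hdu
    have hup := K.not_up_of d hd hds hdt u w hN hlt hdu hdw
    rw [Sym2.eq_swap] at huw
    have hzd := hz.side d hd hds hdt w u hN.symm hdw hdu huw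
    have htl := K.tail_of_not_up d hd hds hdt hup
    rw [Sym2.eq_swap] at hzd htl huw
    refine ⟨d, T.adj d hd hds, hzd, htl, key_lt_of_rank (K.anc_of_not_sub d hd hds hdt).symm
      (K.rank_of_not_up d hd hds hdt hup), hd,
      Or.inr ⟨hdt, u, w, hN, huw, hlt, Or.inl ⟨hdw, hdu⟩⟩⟩
  -- There are three positions. On the tree path, openness says that a chosen detour around the next
  -- tree edge starts in the subtree of `v`, so that it has not been missed. Off the tree path, the
  -- vertex is on a chosen detour, either on the way down to the edge outside of the tree or on the
  -- way up from it.
  obtain ⟨hv, ⟨hP, hopen⟩ | ⟨hP, u, w, hN, huw, hlt, ⟨hw, hu⟩ | ⟨hu, hw⟩⟩⟩ := h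
  · obtain ⟨c, hc, hs, rfl, hct⟩ := hP.exists_child hvt
    by_cases hzc : s(c, T.par c) ∈ z
    · refine ⟨c, T.adj c hc hs, ?_, ?_, key_lt_of_anc ?_, hc, Or.inl ⟨hct, ?_⟩⟩
      · rwa [Sym2.eq_swap]
      · rw [Sym2.eq_swap]
        exact K.tail_of_sub c hc hs hct
      · rw [K.anc_of_sub _ hct, K.anc_of_sub _ hP]
        exact T.num_par c hc hs
      -- A detour in `z` that starts too high would cover the tree edge just used, and `xor` forbids
      -- that both are in `z`.
      · rintro c' hc' hs' rfl hct' u w hN hu hw huw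
        by_contra hcw
        exact (hz.xor _ hc hs hct u w hN ((sub_par hc' hs').trans hu) hcw).1 hzc huw
    · have : ¬ ∀ u w, T.NonTree u w → T.Sub c u → T.Sub c w := fun h =>
        hzc (hz.bridge c hc hs hct h)
      push Not at this
      obtain ⟨u, w, hN, hcu, hcw⟩ := this
      have huw : s(u, w) ∈ z := by
        by_contra h
        exact hzc ((hz.xor c hc hs hct u w hN hcu hcw).2 h)
      have hvw := hopen c hc hs rfl hct u w hN hcu hcw huw
      have hlt : K.anc w < K.anc u := by
        refine lt_of_le_of_ne ?_ (K.anc_ne ht hN.mem_left hN.mem_right hct hcu hcw).symm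
        obtain ⟨x, h1, h2, h3, h4⟩ := K.anc_spec ht hN.mem_right
        obtain ⟨x', h1', h2', h3', h4'⟩ := K.anc_spec ht hN.mem_left
        rw [h3, h3']
        by_contra hlt
        have hcx' := h4' c hct hcu
        have hcx : T.Sub c x := hcx'.trans (h1'.of_num_le h1 ht (by omega))
        exact hcw (hcx.trans h2)
      by_cases hwv : w = T.par c
      · exact cross u w hN huw hlt hwv
      · obtain ⟨d, hd, hds, hdv, hdw⟩ := hvw.exists_child (Ne.symm hwv)
        refine down u w hN huw hlt d hd hds hdv (fun hdt => ?_) hdw fun hdu => ?_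
        · have := hdt.eq_of_par_eq hct ht hds hs hdv
          exact hcw (this ▸ hdw)
        · have := hdu.eq_of_par_eq hcu hN.mem_left hds hs hdv
          exact hcw (this ▸ hdw)
  · by_cases hwv : w = v
    · exact cross u w hN huw hlt hwv
    · obtain ⟨d, hd, hds, rfl, hdw⟩ := hw.exists_child (Ne.symm hwv)
      exact down u w hN huw hlt d hd hds rfl (fun hdt => hP ((sub_par hd hds).trans hdt)) hdw
        fun hdu => hu ((sub_par hd hds).trans hdu)
  · have hs : v ≠ s := by
      rintro rfl
      exact hP (sub_root ht)
    have hup := K.up_of v hv hs hP u w hN hlt hu hw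
    have hanc := K.anc_of_not_sub v hv hs hP
    refine ⟨T.par v, (T.adj v hv hs).symm, hz.side v hv hs hP u w hN hu hw huw,
      K.tail_of_up v hv hs hP hup, key_lt_of_rank hanc (K.rank_of_up v hv hs hP hup), ?_⟩
    have hpu := (sub_par hv hs).trans hu
    by_cases hpt : T.Sub (T.par v) t
    · refine K.open_of_detour hG ht hN hlt hpt hpu ?_
      rw [K.anc_eq_of_sub hP hu, hanc, K.anc_of_sub _ hpt]
    · refine ⟨T.par_mem v hv hs, Or.inr ⟨hpt, u, w, hN, huw, hlt, Or.inr ⟨hpu, fun h => ?_⟩⟩⟩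
      rw [K.anc_eq_of_sub hpt hpu, K.anc_eq_of_sub hpt h] at hlt
      exact lt_irrefl _ hlt

/-- A set of edges that satisfies the constraints contains a path. -/
theorem exists_path [Finite V] (K : PathKeys T t) {z : Set (Sym2 V)} (hz : IsFlow T t z)
    (hG : G.IsCactus) (ht : t ∈ T.verts) : ∃ Q : G.Walk s t, Q.IsPath ∧ ∀ d ∈ Q.darts,
      s(d.fst, d.snd) ∈ z ∧ K.tail s(d.fst, d.snd) = d.fst ∧ K.key d.fst < K.key d.snd := by
  -- Steps increase the key and there are finitely many vertices, so the walk ends, which is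
  -- possible only at `t`.
  have wf : WellFounded fun a b : V => K.key b < K.key a := by
    have : IsTrans V fun a b : V => K.key b < K.key a := ⟨fun _ _ _ h1 h2 => h2.trans h1⟩
    have : Std.Irrefl fun a b : V => K.key b < K.key a := ⟨fun _ => lt_irrefl _⟩
    exact Finite.wellFounded_of_trans_of_irrefl _
  have walk : ∀ v, K.Open z v → ∃ Q : G.Walk v t, ∀ d ∈ Q.darts,
      s(d.fst, d.snd) ∈ z ∧ K.tail s(d.fst, d.snd) = d.fst ∧ K.key d.fst < K.key d.snd := by
    intro v
    induction v using wf.induction with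
    | _ v ih =>
      intro hv
      by_cases hvt : v = t
      · subst hvt
        exact ⟨.nil, by simp⟩
      · obtain ⟨v', h1, h2, h3, h4, h5⟩ := hv.step hz hG ht hvt
        obtain ⟨Q, hQ⟩ := ih v' h4 h5
        refine ⟨.cons h1 Q, fun d hd => ?_⟩
        rw [SimpleGraph.Walk.darts_cons, List.mem_cons] at hd
        rcases hd with rfl | hd
        exacts [⟨h2, h3, h4⟩, hQ d hd]
  -- The root is open, because no detour can start above it.
  obtain ⟨Q, hQ⟩ := walk s ⟨T.root_mem, Or.inl ⟨sub_root ht,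
    fun c _ _ _ _ u w hN _ _ _ => sub_root hN.mem_right⟩⟩
  exact ⟨Q, (Q.isPath_of_increasing K.key fun d hd => (hQ d hd).2.2).1, hQ⟩

end PathKeys

end SearchTree

/-! ### Conforming paths as solutions of the constraints. -/

namespace SelfDeletingGraph

open SearchTree

variable {V : Type*} {S : SelfDeletingGraph V} {s t : V} {T : SearchTree S.graph s}

/-- The search for a conforming path as a constraint satisfaction problem. -/
theorem hasConformingPath_iff [Finite V] (K : PathKeys T t) (hG : S.graph.IsCactus)
    (ht : t ∈ T.verts) : S.HasConformingPath s t ↔ ∃ (z : Set (Sym2 V)) (y : Set V),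
      IsFlow T t z ∧ (∀ e ∈ S.graph.edgeSet, e ∈ z → K.tail e ∈ y) ∧
      ∀ v e, e ∈ S.del v → K.key v ≤ K.key (K.tail e) → e ∈ z → v ∉ y := by
  constructor
  · rintro ⟨Q, hQ, hconf⟩
    have hdart := fun d hd => K.dart_of_isPath hG ht hQ (d := d) hd
    have hstep : ∀ i < Q.length, K.tail s(Q.getVert i, Q.getVert (i + 1)) = Q.getVert i ∧
        K.key (Q.getVert i) < K.key (Q.getVert (i + 1)) := by
      intro i hi
      have := hdart (Q.darts[i]'(by simpa using hi)) (List.getElem_mem _)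
      rwa [SimpleGraph.Walk.darts_getElem_eq_getVert] at this
    have hmono : ∀ i j, i < j → j ≤ Q.length → K.key (Q.getVert i) < K.key (Q.getVert j) := by
      intro i j hij
      induction j, hij using Nat.le_induction with
      | base => exact fun h => (hstep i h).2
      | succ j hj ih => exact fun h => (ih (by omega)).trans (hstep j h).2
    -- Keys increase along `Q`, and an edge of `Q` is entered at its tail. So the comparison of keys
    -- tells whether a vertex of `Q` comes no later than an edge of `Q`.
    refine ⟨{e | e ∈ Q.edges}, {v | v ∈ Q.support}, isFlow_of_isPath hG hQ, ?_, ?_⟩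
    · intro e _ he
      obtain ⟨d, hd, rfl⟩ := exists_dart he
      rw [(hdart d hd).1]
      exact Q.dart_fst_mem_support_of_mem_darts hd
    · intro v e hev hle he hv
      obtain ⟨i, hi, rfl⟩ := List.getElem_of_mem he
      obtain ⟨j, rfl, hj⟩ := SimpleGraph.Walk.mem_support_iff_exists_getVert.1 hv
      have hi' : i < Q.length := by simpa using hi
      refine hconf i hi j ?_ hev
      rw [SimpleGraph.Walk.getElem_edges hi, (hstep i hi').1] at hle
      by_contra hlt
      exact absurd hle (not_le.2 (hmono i j (by omega) hj))
  · rintro ⟨z, y, hz, htail, hdel⟩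
    -- `z` and `y` may contain more than `Q` does. This is harmless: each vertex of `Q` before `t`
    -- is the tail of an edge of `Q`, hence in `y`, and no other members are needed.
    obtain ⟨Q, hQ, hd⟩ := K.exists_path hz hG ht
    have hstep : ∀ i < Q.length, s(Q.getVert i, Q.getVert (i + 1)) ∈ z ∧
        K.tail s(Q.getVert i, Q.getVert (i + 1)) = Q.getVert i ∧
        K.key (Q.getVert i) < K.key (Q.getVert (i + 1)) := by
      intro i hi
      have := hd (Q.darts[i]'(by simpa using hi)) (List.getElem_mem _)
      rwa [SimpleGraph.Walk.darts_getElem_eq_getVert] at this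
    have hmono : ∀ i j, i ≤ j → j ≤ Q.length → K.key (Q.getVert i) ≤ K.key (Q.getVert j) := by
      intro i j hij
      induction j, hij using Nat.le_induction with
      | base => exact fun _ => le_rfl
      | succ j hj ih => exact fun h => (ih (by omega)).trans (hstep j h).2.2.le
    refine ⟨Q, hQ, fun i hi j hj hmem => ?_⟩
    have hi' : i < Q.length := by simpa using hi
    rw [SimpleGraph.Walk.getElem_edges hi] at hmem
    obtain ⟨h1, h2, -⟩ := hstep i hi'
    obtain ⟨h3, h4, -⟩ := hstep j (by omega)
    refine hdel _ _ hmem ?_ h1 ?_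
    · rw [h2]
      exact hmono j i hj hi'.le
    · have := htail _ (Q.adj_getVert_succ (by omega : j < Q.length)) h3
      rwa [h4] at this

end SelfDeletingGraph

/-! ### The search tree of the input graph -/

namespace SelfDeletingGraph.Presentation

open Ram Ram.Expr Ram.Prog

variable {V : Type*} {S : SelfDeletingGraph V} (I : S.Presentation) (s t : V)

/-- The number of a vertex. -/
def vx (v : V) : ℕ := I.vertex v

variable {I} in
theorem vx_lt (v : V) : I.vx v < I.n := (I.vertex v).2

variable {I} in
theorem vx_inj {u v : V} : I.vx u = I.vx v ↔ u = v := by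
  rw [vx, vx, Fin.val_inj, I.vertex.apply_eq_iff_eq]

variable {I} in
theorem exists_vx {a : ℕ} (h : a < I.n) : ∃ v, I.vx v = a :=
  ⟨I.vertex.symm ⟨a, h⟩, by simp [vx]⟩

variable {I} in
theorem edge_adj (i : Fin I.m) : S.graph.Adj (I.fst i) (I.snd i) := by
  have := (I.edge i).2
  rwa [I.edge_eq i, SimpleGraph.mem_edgeSet] at this

variable {I} in
theorem exists_edge {u w : V} (h : S.graph.Adj u w) : ∃ i, (I.edge i : Sym2 V) = s(u, w) :=
  ⟨I.edge.symm ⟨s(u, w), h⟩, by simp⟩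

variable {I} in
theorem edge_inj {i j : Fin I.m} (h : (I.edge i : Sym2 V) = I.edge j) : i = j :=
  I.edge.injective (Subtype.ext h)

/-- The input data are in their place; the register `5` holds the number of variables. -/
structure Input (σ : State) : Prop where
  r0 : σ.reg 0 = I.n
  r1 : σ.reg 1 = I.m
  r2 : σ.reg 2 = I.k
  r3 : σ.reg 3 = I.vx s
  r4 : σ.reg 4 = I.vx t
  r5 : σ.reg 5 = I.m + I.n
  a0 : ∀ i : Fin I.m, σ.arr 0 i = I.vx (I.fst i)
  a1 : ∀ i : Fin I.m, σ.arr 1 i = I.vx (I.snd i)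
  a2 : ∀ i : Fin I.k, σ.arr 2 i = I.vx (I.delVertex i)
  a3 : ∀ i : Fin I.k, σ.arr 3 i = I.delEdge i

variable {I s t}

theorem Input.congr {σ σ' : State} (h : I.Input s t σ) (hr : ∀ x < 6, σ'.reg x = σ.reg x)
    (ha : ∀ a < 4, σ'.arr a = σ.arr a) : I.Input s t σ' := by
  refine ⟨?_, ?_, ?_, ?_, ?_, ?_, ?_, ?_, ?_, ?_⟩
  · rw [hr 0 (by omega), h.r0]
  · rw [hr 1 (by omega), h.r1]
  · rw [hr 2 (by omega), h.r2]
  · rw [hr 3 (by omega), h.r3]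
  · rw [hr 4 (by omega), h.r4]
  · rw [hr 5 (by omega), h.r5]
  · rw [ha 0 (by omega)]; exact h.a0
  · rw [ha 1 (by omega)]; exact h.a1
  · rw [ha 2 (by omega)]; exact h.a2
  · rw [ha 3 (by omega)]; exact h.a3

/-- Append both orientations of the edge `reg 6` to the adjacency lists in the arrays `6, …, 9`; the
array `15` holds the edges of the arcs. -/
def buildStep : Prog :=
  (put 15 (reg 17) (reg 6) ⨟ set 7 (get 0 (reg 6)) ⨟ set 8 (get 1 (reg 6))) ⨟ addArc 6 17 7 8 ⨟
  put 15 (reg 17) (reg 6) ⨟ addArc 6 17 8 7 ⨟ set 6 (bin .add (reg 6) (const 1))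

/-- Build the adjacency lists of the input graph. -/
def build : Prog := loop (bin .lt (reg 6) (reg 1)) buildStep

/-- The arcs of the first `j` edges. -/
structure ArcRep (I : S.Presentation) (j : ℕ) (σ : State) : Prop where
  rep : GraphRep 6 (2 * j) I.n σ
  src_even : ∀ i : Fin I.m, i < j → σ.arr 8 (2 * i) = I.vx (I.fst i)
  dst_even : ∀ i : Fin I.m, i < j → σ.arr 9 (2 * i) = I.vx (I.snd i)
  src_odd : ∀ i : Fin I.m, i < j → σ.arr 8 (2 * i + 1) = I.vx (I.snd i)
  dst_odd : ∀ i : Fin I.m, i < j → σ.arr 9 (2 * i + 1) = I.vx (I.fst i)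
  edge_even : ∀ i : Fin I.m, i < j → σ.arr 15 (2 * i) = i
  edge_odd : ∀ i : Fin I.m, i < j → σ.arr 15 (2 * i + 1) = i

theorem addArc_frame {g c x y : ℕ} {σ σ' : State} (h : Frame (addArc g c x y) σ σ') :
    (∀ z, z ≠ c → σ'.reg z = σ.reg z) ∧ ∀ b, b < g ∨ g + 3 < b → σ'.arr b = σ.arr b := by
  refine ⟨fun x hx => h.reg x ?_, fun b hb => h.arr b ?_⟩
  · simpa [addArc, wregs] using hx
  · simp [addArc, warrs]; omega

theorem buildStep_run {B j : ℕ} {σ : State} (hB : 2 * I.m + 2 < B) (hσ : σ.Bdd B)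
    (hI : I.Input s t σ) (hj : j < I.m) (h6 : σ.reg 6 = j) (h17 : σ.reg 17 = 2 * j)
    (h : ArcRep I j σ) :
    Run B buildStep σ fun k σ' => k ≤ 110 ∧ ArcRep I (j + 1) σ' ∧ σ'.reg 6 = j + 1 ∧
      σ'.reg 17 = 2 * (j + 1) := by
  have hB1 : 1 < B := by omega
  have ha0 : σ.arr 0 j = I.vx (I.fst ⟨j, hj⟩) := hI.a0 ⟨j, hj⟩
  have ha1 : σ.arr 1 j = I.vx (I.snd ⟨j, hj⟩) := hI.a1 ⟨j, hj⟩
  refine Run.seq (Run.mono_frame hσ (Run.of_ok (Q := fun k σ' => k ≤ 20 ∧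
    σ'.reg 7 = I.vx (I.fst ⟨j, hj⟩) ∧ σ'.reg 8 = I.vx (I.snd ⟨j, hj⟩) ∧
    σ'.arr 15 = Function.update (σ.arr 15) (2 * j) j) hB1 hσ ?_ fun k hk => ⟨hk.trans ?_, ?_⟩) ?_)
  · simp [Prog.Ok, Expr.Ok]
  · simp [Prog.time, Expr.cost]
  · simp [Prog.eval, Expr.val, h6, h17, ha0, ha1]
  rintro k₁ σ₁ ⟨hk₁, e7, e8, e15⟩ hb₁ hf₁
  have fr₁ : ∀ x, x ≠ 7 → x ≠ 8 → σ₁.reg x = σ.reg x := fun x h1 h2 =>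
    hf₁.reg x (by simp [wregs]; omega)
  have fa₁ : ∀ a, a ≠ 15 → σ₁.arr a = σ.arr a := fun a ha => hf₁.arr a (by simp [warrs]; omega)
  refine Run.seq ((addArc_run (M := 2 * j) (N := I.n) hB1 hb₁ ?_ (by omega)
    (h.rep.congr fun i hi => fa₁ _ (by omega)) (by rw [e8]; exact vx_lt _)).mono_frame hb₁ ?_)
  · rw [fr₁ _ (by omega) (by omega), h17]
  rintro k₂ σ₂ ⟨hk₂, hg₂, c₂, s₂, d₂⟩ hb₂ hf₂
  obtain ⟨fr₂, fa₂⟩ := addArc_frame hf₂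
  refine Run.seq (Run.mono_frame hb₂ (Run.of_ok (Q := fun k σ' => k ≤ 20 ∧
    σ'.arr 15 = Function.update (σ₂.arr 15) (2 * j + 1) j) hB1 hb₂ ?_
    fun k hk => ⟨hk.trans ?_, ?_⟩) ?_)
  · simp [Prog.Ok, Expr.Ok]
  · simp [Prog.time, Expr.cost]
  · simp [Prog.eval, Expr.val, c₂, fr₂ 6 (by omega), fr₁ 6 (by omega) (by omega), h6]
  rintro k₃ σ₃ ⟨hk₃, f15⟩ hb₃ hf₃
  have fr₃ : ∀ x, σ₃.reg x = σ₂.reg x := fun x => hf₃.reg x (by simp [wregs])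
  have fa₃ : ∀ a, a ≠ 15 → σ₃.arr a = σ₂.arr a := fun a ha => hf₃.arr a (by simp [warrs]; omega)
  refine Run.seq ((addArc_run (M := 2 * j + 1) (N := I.n) hB1 hb₃ ?_ (by omega)
    (hg₂.congr fun i hi => fa₃ _ (by omega)) ?_).mono_frame hb₃ ?_)
  · rw [fr₃, c₂]
  · rw [fr₃, fr₂ _ (by omega), e7]; exact vx_lt _
  rintro k₄ σ₄ ⟨hk₄, hg₄, c₄, s₄, d₄⟩ hb₄ hf₄
  obtain ⟨fr₄, fa₄⟩ := addArc_frame hf₄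
  have r6 : σ₄.reg 6 = j := by
    rw [fr₄ _ (by omega), fr₃, fr₂ _ (by omega), fr₁ _ (by omega) (by omega), h6]
  have s8 : σ₄.arr 8 = Function.update (Function.update (σ.arr 8) (2 * j) (I.vx (I.fst ⟨j, hj⟩)))
      (2 * j + 1) (I.vx (I.snd ⟨j, hj⟩)) := by
    rw [s₄, fa₃ _ (by omega), s₂, fa₁ _ (by omega), e7, fr₃, fr₂ _ (by omega), e8]
  have s9 : σ₄.arr 9 = Function.update (Function.update (σ.arr 9) (2 * j) (I.vx (I.snd ⟨j, hj⟩)))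
      (2 * j + 1) (I.vx (I.fst ⟨j, hj⟩)) := by
    rw [d₄, fa₃ _ (by omega), d₂, fa₁ _ (by omega), e8, fr₃, fr₂ _ (by omega), e7]
  have s15 : σ₄.arr 15 = Function.update (Function.update (σ.arr 15) (2 * j) j) (2 * j + 1) j := by
    rw [fa₄ _ (by omega), f15, fa₂ _ (by omega), e15]
  refine Run.of_ok hB1 hb₄ (by simp [Prog.Ok, Expr.Ok, Expr.val, r6]; omega)
    fun k₅ hk₅ => ⟨?_, ?_, ?_, ?_⟩
  · simp only [Prog.time, Expr.cost] at hk₅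
    omega
  · simp only [Prog.eval]
    have hcase : ∀ i : Fin I.m, i < j + 1 → i = ⟨j, hj⟩ ∨ (i : ℕ) < j := fun i hi =>
      (Nat.lt_succ_iff_lt_or_eq.1 hi).symm.imp (fun h => Fin.ext h) id
    refine ⟨⟨hg₄.adj, hg₄.dst_lt⟩, ?_, ?_, ?_, ?_, ?_, ?_⟩ <;>
    · intro i hi
      simp only [State.setReg_arr, s8, s9, s15]
      rcases hcase i hi with rfl | h'
      · simp
      · have n1 : 2 * (i : ℕ) ≠ 2 * j := by omega
        have n2 : 2 * (i : ℕ) ≠ 2 * j + 1 := by omega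
        have n3 : 2 * (i : ℕ) + 1 ≠ 2 * j := by omega
        have n4 : 2 * (i : ℕ) + 1 ≠ 2 * j + 1 := by omega
        first
        | rw [Function.update_of_ne n2, Function.update_of_ne n1]
        | rw [Function.update_of_ne n4, Function.update_of_ne n3]
        first
        | exact h.src_even i h'
        | exact h.dst_even i h'
        | exact h.src_odd i h'
        | exact h.dst_odd i h'
        | exact h.edge_even i h'
        | exact h.edge_odd i h'
  · simp [Prog.eval, Expr.val, Op.eval, r6]
  · simp only [Prog.eval, State.setReg_reg, show (17 : ℕ) ≠ 6 by omega, if_false, c₄]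
    omega

theorem build_run {B : ℕ} {σ : State} (hB : 2 * I.m + 2 < B) (hσ : σ.Bdd B)
    (hI : I.Input s t σ) (h6 : σ.reg 6 = 0) (h17 : σ.reg 17 = 0)
    (h : ArcRep I 0 σ) :
    Run B build σ fun k σ' => k ≤ 120 * I.m + 10 ∧ ArcRep I I.m σ' := by
  refine (Run.for (by omega) hσ (fun j k σ' => σ'.reg 6 = j ∧ σ'.reg 17 = 2 * j ∧ ArcRep I j σ' ∧
    k ≤ 120 * j) 0 I.m (fun i k σ' h => h.1) hI.r1 (by decide) (Nat.zero_le _)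
    ⟨h6, h17, h, le_rfl⟩ ?_).mono ?_
  · rintro j k σ' hb hf ⟨e6, e17, ha, hk⟩ - hj
    refine (buildStep_run hB hb (hI.congr (fun x hx => hf.reg x ?_) fun a ha => hf.arr a ?_) hj e6
      e17 ha).mono ?_
    · revert x; decide
    · revert a; decide
    · rintro l σ'' ⟨h1, h2, h3, h4⟩
      exact ⟨h3, h4, h2, by omega⟩
  · rintro k σ' ⟨l, rfl, -, -, ha, hl⟩
    exact ⟨by omega, ha⟩

/-- The result of the search, as a tree. -/
structure TreeRep (I : S.Presentation) (T : SearchTree S.graph s) (σ : State) : Prop where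
  mark : ∀ v, σ.arr 10 (I.vx v) = 1 ↔ v ∈ T.verts
  par : ∀ v ∈ T.verts, v ≠ s → σ.arr 13 (I.vx v) = I.vx (T.par v)
  num : ∀ v, σ.arr 12 (I.vx v) = T.num v
  queue : ∀ i < σ.reg 22, ∃ v ∈ T.verts, σ.arr 11 i = I.vx v ∧ T.num v = i
  num_lt : ∀ v ∈ T.verts, T.num v < σ.reg 22
  qt_pos : 0 < σ.reg 22
  qt_le : σ.reg 22 ≤ I.n
  edge : ∀ v ∈ T.verts, v ≠ s → ∃ i : Fin I.m, σ.arr 15 (σ.arr 14 (I.vx v)) = i ∧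
    (I.edge i : Sym2 V) = s(v, T.par v)
  num_root : T.num s = 0

theorem TreeRep.congr {T : SearchTree S.graph s} {σ σ' : State} (h : TreeRep I T σ)
    (hr : σ'.reg 22 = σ.reg 22) (ha : ∀ a, 10 ≤ a → a < 16 → σ'.arr a = σ.arr a) :
    TreeRep I T σ' := by
  obtain ⟨h1, h2, h3, h4, h5, h6, h7, h8, h9⟩ := h
  constructor
  all_goals first
    | rw [ha 10 (by omega) (by omega)]; exact h1
    | rw [ha 13 (by omega) (by omega)]; exact h2
    | rw [ha 12 (by omega) (by omega)]; exact h3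
    | rw [ha 11 (by omega) (by omega), hr]; exact h4
    | rw [hr]; exact h5
    | rw [hr]; exact h6
    | rw [hr]; exact h7
    | rw [ha 15 (by omega) (by omega), ha 14 (by omega) (by omega)]; exact h8
    | exact h9

/-- The search from `s` in the input graph. -/
def explore : Prog := searchInit 20 10 12 3 ⨟ searchLoop 20 10 6 60 12

/-- An arc comes from an edge. -/
theorem ArcRep.exists_edge {σ : State} (h : ArcRep I I.m σ) {j : ℕ} (hj : j < 2 * I.m) {u w : V}
    (hu : σ.arr 8 j = I.vx u) (hw : σ.arr 9 j = I.vx w) :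
    ∃ i : Fin I.m, σ.arr 15 j = i ∧ (I.edge i : Sym2 V) = s(u, w) := by
  rcases Nat.even_or_odd' j with ⟨i, rfl | rfl⟩
  · refine ⟨⟨i, by omega⟩, h.edge_even ⟨i, by omega⟩ (by simp; omega), ?_⟩
    have h1 := h.src_even ⟨i, by omega⟩ (by simp; omega)
    have h2 := h.dst_even ⟨i, by omega⟩ (by simp; omega)
    simp only at h1 h2
    rw [h1, vx_inj] at hu
    rw [h2, vx_inj] at hw
    rw [I.edge_eq, hu, hw]
  · refine ⟨⟨i, by omega⟩, h.edge_odd ⟨i, by omega⟩ (by simp; omega), ?_⟩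
    have h1 := h.src_odd ⟨i, by omega⟩ (by simp; omega)
    have h2 := h.dst_odd ⟨i, by omega⟩ (by simp; omega)
    simp only at h1 h2
    rw [h1, vx_inj] at hu
    rw [h2, vx_inj] at hw
    rw [I.edge_eq, hu, hw, Sym2.eq_swap]

theorem ArcRep.exists_arc {σ : State} (h : ArcRep I I.m σ) {u w : V} (hadj : S.graph.Adj u w) :
    ∃ j < 2 * I.m, σ.arr 8 j = I.vx u ∧ σ.arr 9 j = I.vx w := by
  obtain ⟨i, hi⟩ := Presentation.exists_edge (I := I) hadj
  rw [I.edge_eq] at hi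
  have hlt := i.2
  rcases Sym2.eq_iff.1 hi with ⟨rfl, rfl⟩ | ⟨rfl, rfl⟩
  · exact ⟨2 * i, by omega, h.src_even i hlt, h.dst_even i hlt⟩
  · exact ⟨2 * i + 1, by omega, h.src_odd i hlt, h.dst_odd i hlt⟩

/-- The parent pointers of a completed search form the tree, and queue positions serve as its
numbering. The array `60` is zero throughout, so no vertex is barred and the marked set is closed
under adjacency. -/
theorem ArcRep.exists_tree {σ : State} (h : ArcRep I I.m σ) {w : ℕ}
    (hS : SearchAt 20 10 6 60 12 (2 * I.m) I.n (I.vx s) w σ) (hd : σ.reg 24 ≠ 0)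
    (h12 : σ.reg 12 = 1) (h60 : ∀ i, σ.arr 60 i = 0) :
    ∃ T : SearchTree S.graph s, TreeRep I T σ := by
  obtain ⟨hi, hdone⟩ := hS
  rw [(hdone hd).1, (hdone hd).2, h12] at hi
  have hr : ∀ v, σ.arr 10 (I.vx v) = 1 → v ≠ s → ∃ u, σ.arr 13 (I.vx v) = I.vx u ∧
      σ.arr 10 (I.vx u) = 1 ∧ σ.arr 12 (I.vx u) < σ.arr 12 (I.vx v) ∧
      ∃ i : Fin I.m, σ.arr 15 (σ.arr 14 (I.vx v)) = i ∧ (I.edge i : Sym2 V) = s(v, u) := by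
    intro v hv hvs
    obtain ⟨h1, h2, h3, h4, h5⟩ := hi.tree _ hv fun h => hvs (vx_inj.1 h)
    have hlt : σ.arr 13 (I.vx v) < I.n := by
      rw [← hi.q_num _ h4]
      exact hi.q_lt _ (hi.num_lt _ h4)
    obtain ⟨u, hu⟩ := exists_vx hlt
    simp only [Nat.reduceAdd] at h1 h2 h3 h4 h5
    rw [← hu] at h2 h4 h5
    obtain ⟨i, hi1, hi2⟩ := h.exists_edge h1 h2 h3
    exact ⟨u, hu.symm, h4, h5, i, hi1, hi2.trans Sym2.eq_swap⟩
  choose! par hp1 hp2 hp3 hp4 using hr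
  have hadj : ∀ v, σ.arr 10 (I.vx v) = 1 → v ≠ s → S.graph.Adj (par v) v := by
    intro v hv hvs
    obtain ⟨i, -, hi2⟩ := hp4 v hv hvs
    have := (I.edge i).2
    rw [hi2] at this
    exact SimpleGraph.Adj.symm this
  refine ⟨⟨{v | σ.arr 10 (I.vx v) = 1}, par, fun v => σ.arr 12 (I.vx v), hi.mark_root,
    hp2, hadj, hp3, ?_, ?_⟩, fun v => Iff.rfl, hp1, fun v => rfl, ?_, fun v hv => hi.num_lt _ hv,
    hi.qt_pos, hi.qt_le, hp4, ?_⟩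
  · intro u hu w huw
    obtain ⟨j, hj, h1, h2⟩ := h.exists_arc huw
    have h3 := hi.closed_of_done hj (by simp only [Nat.reduceAdd]; rw [h1]; exact hu)
    simp only [Nat.reduceAdd, h2, h60] at h3
    exact h3.resolve_right (by simp)
  · intro u hu v hv huv
    have h1 := hi.q_num _ hu
    have h2 := hi.q_num _ hv
    simp only [Nat.reduceAdd] at h1 h2
    rw [← vx_inj (I := I), ← h1, ← h2]
    exact congrArg _ huv
  · intro i hiq
    obtain ⟨v, hv⟩ := exists_vx (hi.q_lt i hiq)
    refine ⟨v, ?_, hv.symm, ?_⟩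
    · change σ.arr 10 (I.vx v) = 1
      rw [hv]
      exact hi.mark_q i hiq
    · change σ.arr 12 (I.vx v) = i
      rw [hv]
      exact hi.num_q i hiq
  · change σ.arr 12 (I.vx s) = 0
    rw [← hi.q_zero]
    exact hi.num_q 0 hi.qt_pos

theorem explore_run {B : ℕ} {σ : State} (hB : 2 * I.m + 2 < B) (hnB : I.n + 1 < B) (hσ : σ.Bdd B)
    (hI : I.Input s t σ) (h : ArcRep I I.m σ) (h12 : σ.reg 12 = 1) (h60 : ∀ i, σ.arr 60 i = 0)
    (h10 : ∀ i, σ.arr 10 i = 0) :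
    Run B explore σ fun k σ' => k ≤ 100 * (I.n + 2 * I.m) + 200 ∧
      ∃ T : SearchTree S.graph s, TreeRep I T σ' := by
  have hB1 : 1 < B := by omega
  refine Run.seq ((searchInit_run (g := 6) (v := 60) (M := 2 * I.m) (N := I.n) hB1 hσ
    ⟨by omega, by omega, by omega⟩ (by simp [h10, h12]) (by rw [hI.r3]; exact vx_lt s)
    (h60 _)).mono_frame hσ ?_)
  rintro k₁ σ₁ ⟨hk₁, hS₁, -⟩ hb₁ hf₁
  obtain ⟨fr₁, fa₁⟩ := searchInit_frame hf₁
  rw [hI.r3] at hS₁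
  refine (searchLoop_run hB1 hb₁ hnB ⟨by omega, by omega, by omega⟩
    (h.rep.congr fun i hi => fa₁ _ (by omega)) hS₁).mono_frame hb₁ ?_
  rintro k₂ σ₂ ⟨w, -, hk₂, hS₂, hd₂⟩ hb₂ hf₂
  obtain ⟨fr₂, fa₂⟩ := searchStep_frame (⟨hf₂.reg, hf₂.arr⟩ :
      Frame (searchStep 20 10 6 60 12) σ₁ σ₂)
  have hw := hS₂.inv.work_le_size
  refine ⟨by omega, ArcRep.exists_tree ?_ hS₂ hd₂ ?_ ?_⟩
  · have e : ∀ a, a < 10 ∨ 14 < a → σ₂.arr a = σ.arr a := fun a ha => by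
      rw [fa₂ _ (by omega), fa₁ _ (by omega)]
    obtain ⟨h1, h2, h3, h4, h5, h6, h7⟩ := h
    exact ⟨h1.congr fun i hi => e _ (by omega), by rwa [e 8 (by omega)], by rwa [e 9 (by omega)],
      by rwa [e 8 (by omega)], by rwa [e 9 (by omega)], by rwa [e 15 (by omega)],
      by rwa [e 15 (by omega)]⟩
  · rw [fr₂ _ (by omega), fr₁ _ (by omega), h12]
  · rw [fa₂ _ (by omega), fa₁ _ (by omega)]
    exact h60

end SelfDeletingGraph.Presentation

/-! ### Positions with respect to the tree path -/

theorem SearchTree.edge_inj {V : Type*} {G : SimpleGraph V} {s : V} {T : SearchTree G s} {u v : V}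
    (hu : u ∈ T.verts) (hus : u ≠ s) (hv : v ∈ T.verts) (hvs : v ≠ s)
    (h : s(u, T.par u) = s(v, T.par v)) : u = v := by
  rcases Sym2.eq_iff.1 h with ⟨h, -⟩ | ⟨h1, h2⟩
  · exact h
  · have h3 := T.num_par u hu hus
    have h4 := T.num_par v hv hvs
    rw [h2] at h3
    rw [← h1] at h4
    omega

namespace SelfDeletingGraph.Presentation

open Ram Ram.Expr Ram.Prog SearchTree

variable {V : Type*} {S : SelfDeletingGraph V} {I : S.Presentation} {s t : V}
  {T : SearchTree S.graph s} {B : ℕ}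

/-- The input data and the search tree. -/
structure Base (I : S.Presentation) (T : SearchTree S.graph s) (t : V) (σ : State) : Prop where
  input : I.Input s t σ
  tree : TreeRep I T σ

theorem Base.congr {σ σ' : State} (h : Base I T t σ) (hr : ∀ x < 6, σ'.reg x = σ.reg x)
    (hr' : σ'.reg 22 = σ.reg 22) (ha : ∀ a < 16, σ'.arr a = σ.arr a) : Base I T t σ' :=
  ⟨h.input.congr hr fun a h => ha a (by omega), h.tree.congr hr' fun a _ h => ha a h⟩

theorem Base.setReg {σ : State} (h : Base I T t σ) {x w : ℕ} (hx : 6 ≤ x) (hx' : x ≠ 22) :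
    Base I T t (σ.setReg x w) :=
  h.congr (fun y hy => by rw [State.setReg_reg, if_neg (by omega)])
    (by rw [State.setReg_reg, if_neg (by omega)]) fun _ _ => rfl

theorem Base.frame {P : Prog} {σ σ' : State} (h : Base I T t σ) (hf : Frame P σ σ')
    (hr : ∀ x ∈ P.wregs, 6 ≤ x ∧ x ≠ 22) (ha : ∀ a ∈ P.warrs, 16 ≤ a) : Base I T t σ' :=
  h.congr (fun x hx => hf.reg x fun h => by have := hr x h; omega)
    (hf.reg 22 fun h => (hr 22 h).2 rfl) fun a h' => hf.arr a fun h => by have := ha a h; omega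

/-- Mark the vertices of the tree path from `s` to `t` in the array `16`. -/
def markPath : Prog :=
  set 7 (reg 4) ⨟
  loop (bin .sub (const 1) (bin .eq (reg 7) (reg 3)))
    (put 16 (reg 7) (const 1) ⨟ set 7 (get 13 (reg 7))) ⨟
  put 16 (reg 3) (const 1)

/-- The array `16` marks the vertices of the tree path from `s` to `t`. -/
structure PathRep (I : S.Presentation) (T : SearchTree S.graph s) (t : V) (σ : State) : Prop where
  pos : ∀ v, T.Sub v t → σ.arr 16 (I.vx v) = 1
  neg : ∀ v, ¬ T.Sub v t → σ.arr 16 (I.vx v) = 0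

theorem PathRep.congr {σ σ' : State} (h : PathRep I T t σ) (ha : σ'.arr 16 = σ.arr 16) :
    PathRep I T t σ' := ⟨by rw [ha]; exact h.pos, by rw [ha]; exact h.neg⟩

theorem PathRep.ne_zero {σ : State} (h : PathRep I T t σ) (v : V) :
    σ.arr 16 (I.vx v) ≠ 0 ↔ T.Sub v t := by
  by_cases hv : T.Sub v t
  · simp [h.pos v hv, hv]
  · simp [h.neg v hv, hv]

theorem markPath_run {σ : State} (hB : 1 < B) (hσ : σ.Bdd B) (h : Base I T t σ)
    (ht : t ∈ T.verts) (h16 : ∀ i, σ.arr 16 i = 0) :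
    Run B markPath σ fun k σ' => k ≤ 20 * I.n + 20 ∧ PathRep I T t σ' := by
  refine Run.seq (Run.of_ok hB hσ (by simp [Prog.Ok, Expr.Ok]) fun k₁ hk₁ => ?_)
  simp only [Prog.time, Expr.cost] at hk₁
  simp only [Prog.eval, Expr.val]
  have hb₁ : (σ.setReg 7 (σ.reg 4)).Bdd B := hσ.setReg _ (hσ.reg 4)
  have hn : T.num t ≤ I.n := (h.tree.num_lt t ht).le.trans h.tree.qt_le
  -- The vertex `v` climbs from `t`, and the marked vertices are the ancestors of `t` it has passed.
  -- The loop stops before marking `s`, which is done afterwards. Each round is charged to the drop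
  -- of `T.num v`.
  refine Run.seq ((Run.loop (Q := fun k σ' => k ≤ 20 * I.n + 6 ∧
      ∀ u, (T.Sub u t ∧ u ≠ s → σ'.arr 16 (I.vx u) = 1) ∧
        (¬ (T.Sub u t ∧ u ≠ s) → σ'.arr 16 (I.vx u) = 0)) hB hb₁
    (fun n k σ' => ∃ v, T.Sub v t ∧ σ'.reg 7 = I.vx v ∧ n = T.num v ∧
      k + 20 * T.num v ≤ 20 * T.num t ∧
      ∀ u, (T.Sub u t ∧ ¬ T.Sub u v → σ'.arr 16 (I.vx u) = 1) ∧
        (¬ (T.Sub u t ∧ ¬ T.Sub u v) → σ'.arr 16 (I.vx u) = 0)) (T.num t)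
    ⟨t, Sub.refl t, by simp [h.input.r4], rfl, by omega, fun u => by simp [h16]⟩ ?_).mono_frame hb₁ ?_)
  · rintro n k σ' hb hf ⟨v, hvt, h7, rfl, hk, harr⟩
    have hbase : Base I T t σ' := (h.setReg (by omega) (by omega)).frame hf (by decide)
      (by decide)
    have hv := hvt.mem ht
    refine ⟨by simp [Expr.Ok, hB], fun h0 => ?_, fun h0 => ?_⟩
    · have hvs : v = s := by
        by_contra hne
        have : I.vx v ≠ I.vx s := fun h => hne (vx_inj.1 h)
        simp [Expr.val, Op.eval, h7, hbase.input.r3, this] at h0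
      subst hvs
      refine ⟨by simp only [Expr.cost]; omega, fun u => ?_⟩
      have : T.Sub u v ↔ u = v := ⟨Sub.eq_root, fun h => by rw [h]; exact Sub.refl _⟩
      have h' := harr u
      rwa [this] at h'
    · have hvs : v ≠ s := by
        rintro rfl
        simp [Expr.val, Op.eval, h7, hbase.input.r3] at h0
      have hpar := hbase.tree.par v hv hvs
      have hlt := T.num_par v hv hvs
      refine Run.of_ok hB hb (by simp [Prog.Ok, Expr.Ok, hB]) fun l hl => ?_
      simp only [Prog.time, Expr.cost] at hl ⊢
      refine ⟨T.num (T.par v), hlt, T.par v, (sub_par hv hvs).trans hvt, ?_, rfl, by omega, ?_⟩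
      · simp [Prog.eval, Expr.val, h7, hpar]
      · intro u
        simp only [Prog.eval, Expr.val, h7, State.setReg_arr, State.setArr_arr, if_true]
        by_cases huv : u = v
        · subst huv
          simp [hvt, not_sub_par hv hvs]
        · rw [Function.update_of_ne (fun h => huv (vx_inj.1 h))]
          have h' := harr u
          rw [sub_iff hv hvs] at h'
          simpa [huv] using h'
  · rintro k₂ σ₂ ⟨hk₂, harr⟩ hb₂ hf₂
    have h3 : σ₂.reg 3 = I.vx s := by
      rw [hf₂.reg 3 (by decide)]
      simpa using h.input.r3
    refine Run.of_ok hB hb₂ (by simp [Prog.Ok, Expr.Ok, hB]) fun l hl => ⟨?_, ?_, ?_⟩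
    · simp only [Prog.time, Expr.cost] at hl
      omega
    · intro v hv
      simp only [Prog.eval, Expr.val, h3, State.setArr_arr, if_true]
      by_cases hvs : v = s
      · simp [hvs]
      · rw [Function.update_of_ne (fun h => hvs (vx_inj.1 h))]
        exact (harr v).1 ⟨hv, hvs⟩
    · intro v hv
      have hvs : v ≠ s := by
        rintro rfl
        exact hv (sub_root ht)
      simp only [Prog.eval, Expr.val, h3, State.setArr_arr, if_true]
      rw [Function.update_of_ne (fun h => hvs (vx_inj.1 h))]
      exact (harr v).2 fun h => hv h.1

/-- One vertex of `setKeys`. -/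
def setKeysStep : Prog :=
  set 7 (get 11 (reg 6)) ⨟ put 18 (reg 7) (bin .add (reg 0) (reg 6)) ⨟
  cond (get 16 (reg 7)) (put 17 (reg 7) (reg 6)) (put 17 (reg 7) (get 17 (get 13 (reg 7)))) ⨟
  set 6 (bin .add (reg 6) (const 1))

/-- Compute in the array `17` the numbers of the last ancestors on the tree path, and initialize the
array `18` with the ranks for the traversal away from `s`. -/
def setKeys : Prog := set 6 (const 0) ⨟ loop (bin .lt (reg 6) (reg 22)) setKeysStep

/-- The array `17` holds the numbers of the last ancestors on the tree path. -/
structure AncRep (I : S.Presentation) (T : SearchTree S.graph s) (t : V) (i : ℕ) (σ : State) :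
    Prop where
  pos : ∀ v ∈ T.verts, T.num v < i → T.Sub v t → σ.arr 17 (I.vx v) = T.num v
  neg : ∀ v ∈ T.verts, T.num v < i → v ≠ s → ¬ T.Sub v t →
    σ.arr 17 (I.vx v) = σ.arr 17 (I.vx (T.par v))

/-- Vertices are treated in the order of the queue, so the value of the parent is final when a child
copies it. The offset `n` in the ranks leaves room for the values `n - num` of vertices that are
turned later. -/
theorem setKeys_run {σ : State} (hB : 2 * I.n + 1 < B) (hσ : σ.Bdd B) (h : Base I T t σ)
    (ht : t ∈ T.verts) (hP : PathRep I T t σ) :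
    Run B setKeys σ fun k σ' => k ≤ 40 * I.n + 20 ∧ AncRep I T t I.n σ' ∧
      ∀ v ∈ T.verts, σ'.arr 18 (I.vx v) = I.n + T.num v := by
  have hB1 : 1 < B := by omega
  refine Run.seq (Run.of_ok hB1 hσ (by simp [Prog.Ok, Expr.Ok]; omega) fun k₁ hk₁ => ?_)
  simp only [Prog.time, Expr.cost] at hk₁
  simp only [Prog.eval, Expr.val]
  have hqt := h.tree.qt_le
  refine (Run.for hB1 (hσ.setReg 6 (by omega)) (fun i k σ' => σ'.reg 6 = i ∧ k ≤ 40 * i ∧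
    AncRep I T t i σ' ∧ ∀ v ∈ T.verts, T.num v < i → σ'.arr 18 (I.vx v) = I.n + T.num v)
    0 (σ.reg 22) (fun i k σ' h => h.1) (by simp) (by decide) (Nat.zero_le _)
    ⟨by simp, by omega, ⟨by simp, by simp⟩, by simp⟩ ?_).mono ?_
  · rintro i k σ' hb hf ⟨h6, hk, ⟨ha1, ha2⟩, hr⟩ - hi
    have hbase : Base I T t σ' := (h.setReg (by omega) (by omega)).frame hf (by decide)
      (by decide)
    have hP' : PathRep I T t σ' := hP.congr (hf.arr 16 (by decide))
    have h22 : σ'.reg 22 = σ.reg 22 := hf.reg 22 (by decide)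
    obtain ⟨v, hv, hq, hnum⟩ := hbase.tree.queue i (by omega)
    have hne : ∀ u, T.num u ≠ i → I.vx u ≠ I.vx v := fun u hu he => by
      rw [vx_inj.1 he] at hu
      exact hu hnum
    have e6 : (setKeysStep.eval σ').reg 6 = i + 1 := by
      by_cases hvt : T.Sub v t
      · simp [setKeysStep, Prog.eval, Expr.val, Op.eval, h6, hq, hP'.pos v hvt]
      · simp [setKeysStep, Prog.eval, Expr.val, Op.eval, h6, hq, hP'.neg v hvt]
    have e18 : (setKeysStep.eval σ').arr 18 =
        Function.update (σ'.arr 18) (I.vx v) (I.n + i) := by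
      by_cases hvt : T.Sub v t
      · simp [setKeysStep, Prog.eval, Expr.val, Op.eval, h6, hq, hP'.pos v hvt, hbase.input.r0]
      · simp [setKeysStep, Prog.eval, Expr.val, Op.eval, h6, hq, hP'.neg v hvt, hbase.input.r0]
    refine Run.of_ok hB1 hb ?_ fun l hl => ⟨e6, ?_, ?_, ?_⟩
    · by_cases hvt : T.Sub v t
      · simp [setKeysStep, Prog.eval, Prog.Ok, Expr.Ok, Expr.val, Op.eval, h6, hq, hP'.pos v hvt,
          hbase.input.r0]
        omega
      · simp [setKeysStep, Prog.eval, Prog.Ok, Expr.Ok, Expr.val, Op.eval, h6, hq, hP'.neg v hvt,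
          hbase.input.r0]
        omega
    · simp only [setKeysStep, Prog.time, Expr.cost] at hl
      omega
    · by_cases hvt : T.Sub v t
      · have e17 : (setKeysStep.eval σ').arr 17 = Function.update (σ'.arr 17) (I.vx v) i := by
          simp [setKeysStep, Prog.eval, Expr.val, Op.eval, h6, hq, hP'.pos v hvt]
        refine ⟨fun u hu hui hut => ?_, fun u hu hui hus hut => ?_⟩
        · rw [e17]
          by_cases huv : u = v
          · rw [huv, Function.update_self, hnum]
          · have : T.num u ≠ i := fun h => huv (T.num_inj hu hv (h.trans hnum.symm))
            rw [Function.update_of_ne (hne u this)]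
            exact ha1 u hu (by omega) hut
        · rw [e17]
          have huv : u ≠ v := fun h => hut (h ▸ hvt)
          have : T.num u ≠ i := fun h => huv (T.num_inj hu hv (h.trans hnum.symm))
          have h2 := T.num_par u hu hus
          rw [Function.update_of_ne (hne u this), Function.update_of_ne (hne _ (by omega))]
          exact ha2 u hu (by omega) hus hut
      · have hvs : v ≠ s := by
          rintro rfl
          exact hvt (sub_root ht)
        have e17 : (setKeysStep.eval σ').arr 17 =
            Function.update (σ'.arr 17) (I.vx v) (σ'.arr 17 (I.vx (T.par v))) := by
          simp [setKeysStep, Prog.eval, Expr.val, Op.eval, h6, hq, hP'.neg v hvt,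
            hbase.tree.par v hv hvs]
        refine ⟨fun u hu hui hut => ?_, fun u hu hui hus hut => ?_⟩
        · rw [e17]
          have huv : u ≠ v := fun h => hvt (h ▸ hut)
          have : T.num u ≠ i := fun h => huv (T.num_inj hu hv (h.trans hnum.symm))
          rw [Function.update_of_ne (hne u this)]
          exact ha1 u hu (by omega) hut
        · rw [e17]
          have h2 := T.num_par u hu hus
          rw [Function.update_of_ne (hne (T.par u) (by omega))]
          by_cases huv : u = v
          · rw [huv, Function.update_self]
          · have : T.num u ≠ i := fun h => huv (T.num_inj hu hv (h.trans hnum.symm))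
            rw [Function.update_of_ne (hne u this)]
            exact ha2 u hu (by omega) hus hut
    · intro u hu hui
      rw [e18]
      by_cases huv : u = v
      · rw [huv, Function.update_self, hnum]
      · have : T.num u ≠ i := fun h => huv (T.num_inj hu hv (h.trans hnum.symm))
        rw [Function.update_of_ne (hne u this)]
        exact hr u hu (by omega)
  · rintro k σ' ⟨l, rfl, -, hl, ⟨h1, h2⟩, h3⟩
    have hlt := h.tree.num_lt
    exact ⟨by omega, ⟨fun v hv _ => h1 v hv (hlt v hv), fun v hv _ => h2 v hv (hlt v hv)⟩,
      fun v hv => h3 v hv (hlt v hv)⟩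

/-- Mark the edges of the tree in the array `19`, and initialize the array `20` with their upper
ends. -/
def setTree : Prog :=
  set 6 (const 1) ⨟
  loop (bin .lt (reg 6) (reg 22))
    (set 7 (get 11 (reg 6)) ⨟ set 8 (get 15 (get 14 (reg 7))) ⨟ put 19 (reg 8) (const 1) ⨟
     put 20 (reg 8) (get 13 (reg 7)) ⨟ set 6 (bin .add (reg 6) (const 1)))

theorem setTree_run {σ : State} (hB : 2 * I.n + 1 < B) (hσ : σ.Bdd B) (h : Base I T t σ)
    (h19 : ∀ i, σ.arr 19 i = 0) (h20 : ∀ i, σ.arr 20 i = 0) :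
    Run B setTree σ fun k σ' => k ≤ 40 * I.n + 20 ∧
      (∀ i : Fin I.m, σ'.arr 19 i ≠ 0 ↔ T.IsTreeEdge (I.fst i) (I.snd i)) ∧
      (∀ v ∈ T.verts, v ≠ s → ∀ i : Fin I.m, (I.edge i : Sym2 V) = s(v, T.par v) →
        σ'.arr 20 i = I.vx (T.par v)) ∧ ∀ i, σ'.arr 20 i < I.n := by
  have hB1 : 1 < B := by omega
  refine Run.seq (Run.of_ok hB1 hσ (by simp [Prog.Ok, Expr.Ok]; omega) fun k₁ hk₁ => ?_)
  simp only [Prog.time, Expr.cost] at hk₁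
  simp only [Prog.eval, Expr.val]
  have hqt := h.tree.qt_le
  have hpos := h.tree.qt_pos
  -- The count starts at `1`, since position `0` of the queue is the root, which has no edge above
  -- it. The bound on all cells of array `20` ensures that every cell, also one not written here,
  -- names a vertex.
  refine (Run.for hB1 (hσ.setReg 6 (by omega)) (fun i k σ' => σ'.reg 6 = i ∧ k ≤ 40 * i ∧
      (∀ j : Fin I.m, σ'.arr 19 j ≠ 0 → T.IsTreeEdge (I.fst j) (I.snd j)) ∧
      (∀ v ∈ T.verts, v ≠ s → T.num v < i → ∀ j : Fin I.m, (I.edge j : Sym2 V) = s(v, T.par v) →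
        σ'.arr 19 j ≠ 0 ∧ σ'.arr 20 j = I.vx (T.par v)) ∧ ∀ j, σ'.arr 20 j < I.n)
    1 (σ.reg 22) (fun i k σ' h => h.1) (by simp) (by decide) (by omega)
    ⟨by simp, by omega, by simp [h19], ?_, ?_⟩ ?_).mono ?_
  · intro v hv hvs hn
    refine absurd (T.num_inj hv T.root_mem ?_) hvs
    rw [h.tree.num_root]
    omega
  · simp only [State.setReg_arr, h20]
    intro _
    omega
  · rintro i k σ' hb hf ⟨h6, hk, h1, h2, h3⟩ hi1 hi
    have hbase : Base I T t σ' := (h.setReg (by omega) (by omega)).frame hf (by decide)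
      (by decide)
    have h22 : σ'.reg 22 = σ.reg 22 := hf.reg 22 (by decide)
    obtain ⟨v, hv, hq, hnum⟩ := hbase.tree.queue i (by omega)
    have hvs : v ≠ s := by
      rintro rfl
      have := hbase.tree.num_root
      omega
    obtain ⟨e, he1, he2⟩ := hbase.tree.edge v hv hvs
    have hpar := hbase.tree.par v hv hvs
    refine Run.of_ok hB1 hb ?_ fun l hl => ⟨?_, ?_, ?_, ?_, ?_⟩
    · simp [Prog.eval, Prog.Ok, Expr.Ok, Expr.val, h6]
      omega
    · simp [Prog.eval, Expr.val, Op.eval, h6]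
    · simp only [Prog.time, Expr.cost] at hl
      omega
    · intro j hj
      by_cases hje : j = e
      · have hee := I.edge_eq e
        rw [he2] at hee
        rw [hje]
        rcases Sym2.eq_iff.1 hee with ⟨h4, h5⟩ | ⟨h4, h5⟩
        · rw [← h4, ← h5]; exact isTreeEdge_par hv hvs
        · rw [← h4, ← h5]; exact (isTreeEdge_par hv hvs).symm
      · have : (j : ℕ) ≠ e := fun h => hje (Fin.ext h)
        refine h1 j ?_
        simpa [Prog.eval, Expr.val, Op.eval, h6, hq, he1, this] using hj
    · intro u hu hus hun j hj
      by_cases huv : u = v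
      · subst huv
        have : j = e := I.edge_inj (hj.trans he2.symm)
        subst this
        simp [Prog.eval, Expr.val, Op.eval, h6, hq, he1, hpar]
      · have hje : (j : ℕ) ≠ e := fun h => by
          have : j = e := Fin.ext h
          subst this
          exact huv (SearchTree.edge_inj hu hus hv hvs (hj.symm.trans he2))
        have : T.num u ≠ i := fun h => huv (T.num_inj hu hv (h.trans hnum.symm))
        simpa [Prog.eval, Expr.val, Op.eval, h6, hq, he1, hje] using h2 u hu hus (by omega) j hj
    · intro j
      by_cases hje : j = e
      · simpa [Prog.eval, Expr.val, Op.eval, h6, hq, he1, hje, hpar] using vx_lt _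
      · simpa [Prog.eval, Expr.val, Op.eval, h6, hq, he1, hje] using h3 j
  · rintro k σ' ⟨l, rfl, -, hl, h1, h2, h3⟩
    have hlt := h.tree.num_lt
    refine ⟨by omega, fun i => ⟨h1 i, ?_⟩, fun v hv hvs i hi => (h2 v hv hvs (hlt v hv) i hi).2, h3⟩
    rintro (⟨h4, h5, h6⟩ | ⟨h4, h5, h6⟩)
    · exact (h2 _ h4 h5 (hlt _ h4) i (by rw [I.edge_eq, h6])).1
    · exact (h2 _ h4 h5 (hlt _ h4) i (by rw [I.edge_eq, h6, Sym2.eq_swap])).1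

end SelfDeletingGraph.Presentation

/-! ### The clauses for the cycles -/

namespace Ram

open Ram.Expr Ram.Prog

/-- The arrays `24, …, 27` hold `M` implications that are equivalent to the condition `Φ`. -/
structure Clauses (N M : ℕ) (Φ : (ℕ → Prop) → Prop) (σ : State) : Prop where
  count : σ.reg 11 = M
  rep : GraphRep 24 M (2 * N) σ
  skew : Skew N (σ.arr 26) (σ.arr 27) M
  sat : ∀ τ, Sat N (σ.arr 26) (σ.arr 27) M τ ↔ Φ τ

theorem Clauses.congr {N M : ℕ} {Φ Φ' : (ℕ → Prop) → Prop} {σ σ' : State}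
    (h : Clauses N M Φ σ) (hr : σ'.reg 11 = σ.reg 11)
    (ha : ∀ a, 24 ≤ a → a < 28 → σ'.arr a = σ.arr a) (hΦ : ∀ τ, Φ τ ↔ Φ' τ) :
    Clauses N M Φ' σ' := by
  refine ⟨hr.trans h.count, h.rep.congr fun i hi => ha _ (by omega) (by omega), ?_, fun τ => ?_⟩
  · rw [ha 26 (by omega) (by omega), ha 27 (by omega) (by omega)]
    exact h.skew
  · rw [ha 26 (by omega) (by omega), ha 27 (by omega) (by omega), h.sat, hΦ]

/-- Add the implication from the literal `x` to the literal `y` and its contrapositive; `x'` and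
`y'` are the negations. -/
def imp (x y x' y' : Expr) : Prog :=
  (set 7 x ⨟ set 8 y ⨟ set 9 x' ⨟ set 10 y') ⨟ addArc 24 11 7 8 ⨟ addArc 24 11 10 9

theorem imp_frame {x y x' y' : Expr} {σ σ' : State} (h : Frame (imp x y x' y') σ σ') :
    (∀ z, z < 7 ∨ 11 < z → σ'.reg z = σ.reg z) ∧ ∀ a, a < 24 ∨ 27 < a → σ'.arr a = σ.arr a := by
  refine ⟨fun z hz => h.reg z ?_, fun a ha => h.arr a ?_⟩
  · simp [imp, addArc, wregs]; omega
  · simp [imp, addArc, warrs]; omega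

/-- The contrapositive does not change the meaning, but keeps the set of implications closed under
contraposition, as `solve` requires. The caller supplies the negations, as it knows which literals
are negative. -/
theorem imp_run {B N M a b : ℕ} {Φ : (ℕ → Prop) → Prop} {σ : State} {x y x' y' : Expr}
    (hB : 1 < B) (hσ : σ.Bdd B) (h : Clauses N M Φ σ) (hM : M + 2 < B)
    (hok : (set 7 x ⨟ set 8 y ⨟ set 9 x' ⨟ set 10 y').Ok B σ)
    (h7 : ((set 7 x ⨟ set 8 y ⨟ set 9 x' ⨟ set 10 y').eval σ).reg 7 = a)
    (h8 : ((set 7 x ⨟ set 8 y ⨟ set 9 x' ⨟ set 10 y').eval σ).reg 8 = b)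
    (h9 : ((set 7 x ⨟ set 8 y ⨟ set 9 x' ⨟ set 10 y').eval σ).reg 9 = neg N a)
    (h10 : ((set 7 x ⨟ set 8 y ⨟ set 9 x' ⨟ set 10 y').eval σ).reg 10 = neg N b)
    (ha : a < 2 * N) (hb : b < 2 * N) :
    Run B (imp x y x' y') σ fun k σ' => k ≤ x.cost + y.cost + x'.cost + y'.cost + 64 ∧
      Clauses N (M + 2) (fun τ => Φ τ ∧ (lit N τ a → lit N τ b)) σ' := by
  refine Run.seq (Run.mono_frame (Q := fun k σ' => k ≤ x.cost + y.cost + x'.cost + y'.cost + 4 ∧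
    σ'.reg 7 = a ∧ σ'.reg 8 = b ∧ σ'.reg 9 = neg N a ∧ σ'.reg 10 = neg N b) hσ
    (Run.of_ok hB hσ hok fun k hk => ⟨?_, h7, h8, h9, h10⟩) ?_)
  · simp only [Prog.time] at hk; omega
  rintro k₁ σ₁ ⟨hk₁, e7, e8, e9, e10⟩ hb₁ hf₁
  have hc₁ : Clauses N M Φ σ₁ := h.congr (hf₁.reg 11 (by simp [wregs]))
    (fun a _ _ => hf₁.arr a (by simp [warrs])) fun _ => Iff.rfl
  refine Run.seq ((addArc_run hB hb₁ hc₁.count (by omega) hc₁.rep (by rwa [e8])).mono_frame hb₁ ?_)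
  rintro k₂ σ₂ ⟨hk₂, hg₂, c₂, s₂, d₂⟩ hb₂ hf₂
  have fr₂ : ∀ z, z ≠ 11 → σ₂.reg z = σ₁.reg z := fun z hz => hf₂.reg z (by simp [addArc, wregs, hz])
  refine (addArc_run hB hb₂ c₂ (by omega) hg₂
    (by rw [fr₂ _ (by omega), e9]; exact neg_lt ha)).mono ?_
  rintro k₃ σ₃ ⟨hk₃, hg₃, c₃, s₃, d₃⟩
  simp only [Nat.reduceAdd] at s₂ d₂ s₃ d₃
  rw [s₂, fr₂ _ (by omega), e7, e10] at s₃
  rw [d₂, fr₂ _ (by omega), e8, e9] at d₃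
  -- Each position holds an old implication, the new one, or its contrapositive; all remaining goals
  -- are settled by these cases.
  have key : ∀ j, (j < M ∧ σ₃.arr 26 j = σ₁.arr 26 j ∧ σ₃.arr 27 j = σ₁.arr 27 j) ∨
      (j = M ∧ σ₃.arr 26 j = a ∧ σ₃.arr 27 j = b) ∨
      (j = M + 1 ∧ σ₃.arr 26 j = neg N b ∧ σ₃.arr 27 j = neg N a) ∨ M + 2 ≤ j := by
    intro j
    rcases lt_trichotomy j M with hj | rfl | hj
    · left
      rw [s₃, d₃]
      simp [hj, hj.ne, (show j ≠ M + 1 by omega)]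
    · right; left
      rw [s₃, d₃]
      simp
    · by_cases hj' : j = M + 1
      · right; right; left
        subst hj'
        rw [s₃, d₃]
        simp
      · omega
  have sk := hc₁.skew
  refine ⟨by omega, c₃, hg₃, ⟨?_, ?_, ?_⟩, fun τ => ?_⟩
  · intro j hj
    rcases key j with ⟨h0, h1, h2⟩ | ⟨h0, h1, h2⟩ | ⟨h0, h1, h2⟩ | h0
    · rw [h1]; exact sk.src_lt j h0
    · rwa [h1]
    · rw [h1]; exact neg_lt hb
    · omega
  · intro j hj
    rcases key j with ⟨h0, h1, h2⟩ | ⟨h0, h1, h2⟩ | ⟨h0, h1, h2⟩ | h0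
    · rw [h2]; exact sk.dst_lt j h0
    · rwa [h2]
    · rw [h2]; exact neg_lt ha
    · omega
  · have kM : σ₃.arr 26 M = a ∧ σ₃.arr 27 M = b := by
      rcases key M with h0 | h0 | h0 | h0
      · omega
      · exact h0.2
      · omega
      · omega
    have kM' : σ₃.arr 26 (M + 1) = neg N b ∧ σ₃.arr 27 (M + 1) = neg N a := by
      rcases key (M + 1) with h0 | h0 | h0 | h0
      · omega
      · omega
      · exact h0.2
      · omega
    intro j hj
    rcases key j with ⟨h0, h1, h2⟩ | ⟨h0, h1, h2⟩ | ⟨h0, h1, h2⟩ | h0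
    · obtain ⟨i, hi, h3, h4⟩ := sk.contra j h0
      refine ⟨i, by omega, ?_⟩
      rcases key i with ⟨-, h5, h6⟩ | h5 | h5 | h5
      · rw [h5, h6, h1, h2]; exact ⟨h3, h4⟩
      all_goals omega
    · exact ⟨M + 1, by omega, by rw [h2]; exact kM'.1, by rw [h1]; exact kM'.2⟩
    · exact ⟨M, by omega, by rw [h2, neg_neg ha]; exact kM.1, by rw [h1, neg_neg hb]; exact kM.2⟩
    · omega
  · rw [← hc₁.sat]
    constructor
    · intro hs
      refine ⟨fun j hj => ?_, ?_⟩
      · have := hs j (by omega)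
        rcases key j with ⟨-, h1, h2⟩ | h1 | h1 | h1
        · rwa [h1, h2] at this
        all_goals omega
      · have := hs M (by omega)
        rcases key M with h0 | ⟨-, h1, h2⟩ | h0 | h0
        · omega
        · rwa [h1, h2] at this
        · omega
        · omega
    · rintro ⟨h1, h2⟩ j hj
      rcases key j with ⟨h0, h3, h4⟩ | ⟨-, h3, h4⟩ | ⟨-, h3, h4⟩ | h3
      · rw [h3, h4]; exact h1 j h0
      · rwa [h3, h4]
      · rw [h3, h4, lit_neg ha, lit_neg hb]
        exact fun h h' => h (h2 h')
      · omega

end Ram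

namespace SelfDeletingGraph.Presentation

open Ram Ram.Expr Ram.Prog SearchTree

variable {V : Type*} {S : SelfDeletingGraph V} {I : S.Presentation} {s t : V}
  {T : SearchTree S.graph s} {B : ℕ}

/-- The set of edges given by an assignment. -/
def edgesOf (I : S.Presentation) (τ : ℕ → Prop) : Set (Sym2 V) :=
  {e | ∃ i : Fin I.m, (I.edge i : Sym2 V) = e ∧ τ i}

/-- The set of vertices given by an assignment. -/
def vertsOf (I : S.Presentation) (τ : ℕ → Prop) : Set V := {v | τ (I.m + I.vx v)}

theorem edge_mem_edgesOf {τ : ℕ → Prop} {i : Fin I.m} : (I.edge i : Sym2 V) ∈ I.edgesOf τ ↔ τ i :=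
  ⟨fun ⟨_, h, h'⟩ => edge_inj h ▸ h', fun h => ⟨i, rfl, h⟩⟩

/-- There are `m + n` variables: the edges come first and the vertices follow from `m` on. -/
theorem lit_edge {τ : ℕ → Prop} {i : Fin I.m} :
    lit (I.m + I.n) τ i ↔ (I.edge i : Sym2 V) ∈ I.edgesOf τ := by
  rw [edge_mem_edgesOf, lit, if_pos (by omega)]

theorem lit_not_edge {τ : ℕ → Prop} {i : Fin I.m} :
    lit (I.m + I.n) τ (i + (I.m + I.n)) ↔ (I.edge i : Sym2 V) ∉ I.edgesOf τ := by
  rw [edge_mem_edgesOf, lit, if_neg (by omega), Nat.add_sub_cancel]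

/-- The data for the clauses. -/
structure Setup (I : S.Presentation) (T : SearchTree S.graph s) (t : V) (anc : V → ℕ)
    (σ : State) : Prop where
  base : Base I T t σ
  path : PathRep I T t σ
  anc_eq : ∀ v, σ.arr 17 (I.vx v) = anc v
  tree_edge : ∀ i : Fin I.m, σ.arr 19 i ≠ 0 ↔ T.IsTreeEdge (I.fst i) (I.snd i)

theorem Setup.congr {anc : V → ℕ} {σ σ' : State} (h : Setup I T t anc σ)
    (hr : ∀ x < 6, σ'.reg x = σ.reg x) (hr' : σ'.reg 22 = σ.reg 22)
    (ha : ∀ a < 20, a ≠ 18 → σ'.arr a = σ.arr a) : Setup I T t anc σ' :=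
  ⟨h.base.congr hr hr' fun a h => ha a (by omega) (by omega),
    h.path.congr (ha 16 (by omega) (by omega)),
    by rw [ha 17 (by omega) (by omega)]; exact h.anc_eq,
    by rw [ha 19 (by omega) (by omega)]; exact h.tree_edge⟩

theorem Setup.frame {anc : V → ℕ} {P : Prog} {σ σ' : State} (h : Setup I T t anc σ)
    (hf : Frame P σ σ') (hr : ∀ x ∈ P.wregs, 6 ≤ x ∧ x ≠ 22)
    (ha : ∀ a ∈ P.warrs, a = 18 ∨ 20 ≤ a) : Setup I T t anc σ' :=
  h.congr (fun x hx => hf.reg x fun h => by have := hr x h; omega)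
    (hf.reg 22 fun h => (hr 22 h).2 rfl)
    fun a h' h'' => hf.arr a fun h => by have := ha a h; omega

/-- The clause for a tree edge and an edge outside of the tree that covers it. -/
def CoverClause (I : S.Presentation) (T : SearchTree S.graph s) (t : V) (i : Fin I.m) (c : V)
    (τ : ℕ → Prop) : Prop :=
  (T.Sub c t → (s(c, T.par c) ∈ I.edgesOf τ ↔ (I.edge i : Sym2 V) ∉ I.edgesOf τ)) ∧
  (¬ T.Sub c t → (I.edge i : Sym2 V) ∈ I.edgesOf τ → s(c, T.par c) ∈ I.edgesOf τ)

/-- The edge from the vertex `reg 27` to its parent. -/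
def treeEdge : Expr := get 15 (get 14 (reg 27))

/-- Add the clause for the edge above the vertex `reg 27` and the edge `reg 6`. -/
def visit : Prog :=
  put 21 (reg 27) (const 1) ⨟
  cond (get 16 (reg 27))
    (imp treeEdge (bin .add (reg 6) (reg 5)) (bin .add treeEdge (reg 5)) (reg 6) ⨟
     imp (bin .add treeEdge (reg 5)) (reg 6) treeEdge (bin .add (reg 6) (reg 5)))
    (imp (reg 6) treeEdge (bin .add (reg 6) (reg 5)) (bin .add treeEdge (reg 5)))

/-- On the tree path the exclusive choice takes two implications, elsewhere one is enough. With
contrapositives, a vertex costs at most four arcs. -/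
theorem visit_run {anc : V → ℕ} {σ : State} {M : ℕ} {Φ : (ℕ → Prop) → Prop} {c : V} {i : Fin I.m}
    (hB : 4 * I.m + 2 * I.n + 2 < B) (hMB : M + 4 < B) (hσ : σ.Bdd B) (hS : Setup I T t anc σ)
    (hc : c ∈ T.verts) (hs : c ≠ s) (h27 : σ.reg 27 = I.vx c) (h6 : σ.reg 6 = i)
    (h : Clauses (I.m + I.n) M Φ σ) :
    Run B visit σ fun k σ' => k ≤ 300 ∧ σ'.arr 21 = Function.update (σ.arr 21) (I.vx c) 1 ∧
      ∃ M' ≤ M + 4, Clauses (I.m + I.n) M' (fun τ => Φ τ ∧ CoverClause I T t i c τ) σ' := by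
  have hB1 : 1 < B := by omega
  have hi := i.2
  obtain ⟨e, he1, he2⟩ := hS.base.tree.edge c hc hs
  have hee := e.2
  have ne : ∀ j : Fin I.m, neg (I.m + I.n) j = j + (I.m + I.n) := fun j => by
    rw [neg, if_pos (by omega)]
  have ne' : ∀ j : Fin I.m, neg (I.m + I.n) (j + (I.m + I.n)) = j := fun j => by
    rw [neg, if_neg (by omega), Nat.add_sub_cancel]
  refine Run.seq (Run.of_ok hB1 hσ (by simp [Prog.Ok, Expr.Ok, hB1]) fun k₁ hk₁ => ?_)
  simp only [Prog.eval, Expr.val, h27]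
  have hb₁ : (σ.setArr 21 (I.vx c) 1).Bdd B := hσ.setArr _ _ hB1
  have hS₁ : Setup I T t anc (σ.setArr 21 (I.vx c) 1) := hS.congr (fun _ _ => rfl) rfl
    fun a ha _ => by rw [State.setArr_arr, if_neg (by omega)]
  have hC₁ : Clauses (I.m + I.n) M Φ (σ.setArr 21 (I.vx c) 1) := h.congr rfl
    (fun a ha _ => by rw [State.setArr_arr, if_neg (by omega)]) fun _ => Iff.rfl
  have h21 : (σ.setArr 21 (I.vx c) 1).arr 21 = Function.update (σ.arr 21) (I.vx c) 1 := by simp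
  have h27' : (σ.setArr 21 (I.vx c) 1).reg 27 = I.vx c := h27
  have h6' : (σ.setArr 21 (I.vx c) 1).reg 6 = i := h6
  have he1' : (σ.setArr 21 (I.vx c) 1).arr 15 ((σ.setArr 21 (I.vx c) 1).arr 14 (I.vx c)) = e := by
    simpa using he1
  simp only [Prog.time, Expr.cost] at hk₁
  generalize σ.setArr 21 (I.vx c) 1 = σ₁ at *
  have h5 := hS₁.base.input.r5
  refine Run.cond hB1 hb₁ (by simp [Expr.Ok]) (fun hp => ?_) fun hp => ?_
  · simp only [Expr.val, h27'] at hp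
    have hct := (hS₁.path.ne_zero c).1 hp
    refine Run.seq ((imp_run (a := e) (b := i + (I.m + I.n)) hB1 hb₁ hC₁ (by omega) ?_ ?_ ?_ ?_ ?_
      (by omega) (by omega)).mono_frame hb₁ ?_)
    · simp [Prog.Ok, Expr.Ok, treeEdge, Prog.eval, Expr.val, Op.eval, h27', h5, h6', he1']
      omega
    · simp [treeEdge, Prog.eval, Expr.val, Op.eval, h27', he1']
    · simp [Prog.eval, Expr.val, Op.eval, h5, h6']
    · simp [treeEdge, Prog.eval, Expr.val, Op.eval, h27', he1', h5, ne]
    · simp [Prog.eval, Expr.val, h6', ne']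
    rintro k₂ σ₂ ⟨hk₂, hC₂⟩ hb₂ hf₂
    obtain ⟨fr₂, fa₂⟩ := imp_frame hf₂
    have g27 : σ₂.reg 27 = I.vx c := by rw [fr₂ _ (by omega), h27']
    have g6 : σ₂.reg 6 = i := by rw [fr₂ _ (by omega), h6']
    have g5 : σ₂.reg 5 = I.m + I.n := by rw [fr₂ _ (by omega), h5]
    have ge : σ₂.arr 15 (σ₂.arr 14 (I.vx c)) = e := by
      rw [fa₂ _ (by omega), fa₂ _ (by omega), he1']
    refine (imp_run (a := e + (I.m + I.n)) (b := i) hB1 hb₂ hC₂ (by omega) ?_ ?_ ?_ ?_ ?_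
      (by omega) (by omega)).mono_frame hb₂ ?_
    · simp [Prog.Ok, Expr.Ok, treeEdge, Prog.eval, Expr.val, Op.eval, g27, g5, g6, ge]
      omega
    · simp [treeEdge, Prog.eval, Expr.val, Op.eval, g27, ge, g5]
    · simp [Prog.eval, Expr.val, g6]
    · simp [treeEdge, Prog.eval, Expr.val, g27, ge, ne']
    · simp [Prog.eval, Expr.val, Op.eval, g6, g5, ne]
    rintro k₃ σ₃ ⟨hk₃, hC₃⟩ hb₃ hf₃
    obtain ⟨fr₃, fa₃⟩ := imp_frame hf₃
    simp only [Expr.cost, treeEdge] at hk₂ hk₃ ⊢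
    refine ⟨by omega, by rw [fa₃ _ (by omega), fa₂ _ (by omega), h21], M + 2 + 2, by omega,
      hC₃.congr rfl (fun _ _ _ => rfl) fun τ => ?_⟩
    rw [lit_edge, lit_edge, lit_not_edge, lit_not_edge, CoverClause, he2]
    tauto
  · simp only [Expr.val, h27'] at hp
    have hct : ¬ T.Sub c t := fun h => (hS₁.path.ne_zero c).2 h hp
    refine (imp_run (a := i) (b := e) hB1 hb₁ hC₁ (by omega) ?_ ?_ ?_ ?_ ?_
      (by omega) (by omega)).mono_frame hb₁ ?_
    · simp [Prog.Ok, Expr.Ok, treeEdge, Prog.eval, Expr.val, Op.eval, h27', h5, h6', he1']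
      omega
    · simp [Prog.eval, Expr.val, h6']
    · simp [treeEdge, Prog.eval, Expr.val, h27', he1']
    · simp [Prog.eval, Expr.val, Op.eval, h5, h6', ne]
    · simp [treeEdge, Prog.eval, Expr.val, Op.eval, h27', he1', h5, ne]
    rintro k₂ σ₂ ⟨hk₂, hC₂⟩ hb₂ hf₂
    obtain ⟨fr₂, fa₂⟩ := imp_frame hf₂
    simp only [Expr.cost, treeEdge] at hk₂ ⊢
    refine ⟨by omega, by rw [fa₂ _ (by omega), h21], M + 2, by omega,
      hC₂.congr rfl (fun _ _ _ => rfl) fun τ => ?_⟩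
    rw [lit_edge, lit_edge, CoverClause, he2]
    tauto

end SelfDeletingGraph.Presentation

/-! ### Walking around the cycles -/

namespace SearchTree

variable {V : Type*} {G : SimpleGraph V} {s : V} {T : SearchTree G s} {a b c u w : V}

/-- A walker that started at `u` and moves from `a` to its parent passes just one more vertex,
namely `a`. -/
theorem chain_par (ha : a ∈ T.verts) (hs : a ≠ s) (h : T.Sub a u) :
    (T.Sub c u ∧ ¬ T.Sub c (T.par a)) ↔ c = a ∨ (T.Sub c u ∧ ¬ T.Sub c a) := by
  rw [sub_iff ha hs]
  constructor
  · rintro ⟨h1, h2⟩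
    by_cases hca : c = a
    · exact Or.inl hca
    · exact Or.inr ⟨h1, by tauto⟩
  · rintro (rfl | ⟨h1, h2⟩)
    · exact ⟨h, not_sub_par ha hs⟩
    · exact ⟨h1, by tauto⟩

/-- When two walkers go up from `u` and `w`, such that always the one with the larger number
moves, they do not pass a common ancestor. -/
theorem not_sub_of_num_lt (ha : T.Sub a u)
    (h : ∀ c, T.Sub c w → ¬ T.Sub c b → ¬ T.Sub c u) (hn : T.num b < T.num a) : ¬ T.Sub a w := by
  intro haw
  have hab : ¬ T.Sub a b := fun h' => by
    have := h'.num_le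
    omega
  exact h a haw hab ha

end SearchTree

namespace SelfDeletingGraph.Presentation

open Ram Ram.Expr Ram.Prog SearchTree

variable {V : Type*} {S : SelfDeletingGraph V} {I : S.Presentation} {s t : V}
  {T : SearchTree S.graph s} {B : ℕ}

/-- The state of the data for the cycles: `P` is the set of the pairs of an edge outside of the tree
and a tree edge covered by it that have been dealt with, `U` is the set of the vertices from which
the paths go up, and `R` is the set of the edges outside of the tree whose tail has been set. -/
structure CoverRep (I : S.Presentation) (T : SearchTree S.graph s) (t : V) (tl : Fin I.m → V)
    (P : Set (Fin I.m × V)) (U : Set V) (R : Set (Fin I.m)) (σ : State) : Prop where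
  cov_pos : ∀ c, (∃ i, (i, c) ∈ P) → σ.arr 21 (I.vx c) = 1
  cov_neg : ∀ c, (¬ ∃ i, (i, c) ∈ P) → σ.arr 21 (I.vx c) = 0
  rank_up : ∀ c ∈ T.verts, c ∈ U → σ.arr 18 (I.vx c) = I.n - T.num c
  rank_not_up : ∀ c ∈ T.verts, c ∉ U → σ.arr 18 (I.vx c) = I.n + T.num c
  tail_up : ∀ c ∈ T.verts, c ≠ s → c ∈ U → ∀ j : Fin I.m, (I.edge j : Sym2 V) = s(c, T.par c) →
    σ.arr 20 j = I.vx c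
  tail_not_up : ∀ c ∈ T.verts, c ≠ s → c ∉ U → ∀ j : Fin I.m,
    (I.edge j : Sym2 V) = s(c, T.par c) → σ.arr 20 j = I.vx (T.par c)
  tail_lt : ∀ j, σ.arr 20 j < I.n
  tail_lo : ∀ i ∈ R, ¬ T.IsTreeEdge (I.fst i) (I.snd i) ∧ σ.arr 20 i = I.vx (tl i)
  clauses : ∃ M ≤ 4 * (Prod.snd '' P).ncard,
    Clauses (I.m + I.n) M (fun τ => ∀ p ∈ P, CoverClause I T t p.1 p.2 τ) σ

variable {anc : V → ℕ} {tl : Fin I.m → V} {P : Set (Fin I.m × V)} {U : Set V} {R : Set (Fin I.m)}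

theorem CoverRep.congr {σ σ' : State} (h : CoverRep I T t tl P U R σ)
    (hr : σ'.reg 11 = σ.reg 11) (ha : ∀ a, 18 ≤ a → a < 28 → σ'.arr a = σ.arr a) :
    CoverRep I T t tl P U R σ' := by
  obtain ⟨h0, h1, h2, h3, h4, h5, h6, h7, M, hM, hC⟩ := h
  refine ⟨?_, ?_, ?_, ?_, ?_, ?_, ?_, ?_, M, hM,
    hC.congr hr (fun a h h' => ha a (by omega) h') fun _ => Iff.rfl⟩
  · rwa [ha 21 (by omega) (by omega)]
  · rwa [ha 21 (by omega) (by omega)]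
  · rwa [ha 18 (by omega) (by omega)]
  · rwa [ha 18 (by omega) (by omega)]
  · rwa [ha 20 (by omega) (by omega)]
  · rwa [ha 20 (by omega) (by omega)]
  · rwa [ha 20 (by omega) (by omega)]
  · rwa [ha 20 (by omega) (by omega)]

theorem finite_vertex (I : S.Presentation) : Finite V := .of_equiv _ I.vertex.symm

theorem card_vertex (I : S.Presentation) : Nat.card V = I.n := by
  rw [Nat.card_congr I.vertex, Nat.card_eq_fintype_card, Fintype.card_fin]

theorem ncard_le (I : S.Presentation) (A : Set V) : A.ncard ≤ I.n := by
  have := I.finite_vertex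
  rw [← I.card_vertex]
  exact Set.ncard_le_card A

theorem isTreeEdge_of_edge_eq {c : V} (hc : c ∈ T.verts) (hs : c ≠ s) {e : Fin I.m}
    (he : (I.edge e : Sym2 V) = s(c, T.par c)) : T.IsTreeEdge (I.fst e) (I.snd e) := by
  rw [I.edge_eq] at he
  rcases Sym2.eq_iff.1 he with ⟨h1, h2⟩ | ⟨h1, h2⟩
  · rw [h1, h2]; exact isTreeEdge_par hc hs
  · rw [h1, h2]; exact (isTreeEdge_par hc hs).symm

/-- Since `c` has not been covered before, the number of covered vertices grows by one, and this
pays for the four arcs in the bound on `M`. -/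
theorem CoverRep.visit_run {σ : State} {c : V} {i : Fin I.m}
    (hB : 4 * I.m + 4 * I.n + 4 < B) (hσ : σ.Bdd B) (hS : Setup I T t anc σ)
    (h : CoverRep I T t tl P U R σ) (hc : c ∈ T.verts) (hs : c ≠ s) (h27 : σ.reg 27 = I.vx c)
    (h6 : σ.reg 6 = i) (hP : ∀ j, (j, c) ∉ P) :
    Run B visit σ fun k σ' => k ≤ 300 ∧ CoverRep I T t tl (insert (i, c) P) U R σ' ∧
      (Prod.snd '' insert (i, c) P).ncard = (Prod.snd '' P).ncard + 1 := by
  have := I.finite_vertex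
  obtain ⟨M, hM, hC⟩ := h.clauses
  have hle := I.ncard_le (Prod.snd '' P)
  have hcard : (Prod.snd '' insert (i, c) P).ncard = (Prod.snd '' P).ncard + 1 := by
    rw [Set.image_insert_eq, Set.ncard_insert_of_notMem]
    rintro ⟨⟨j, d⟩, hj, rfl⟩
    exact hP j hj
  refine (Presentation.visit_run (by omega) (by omega) hσ hS hc hs h27 h6 hC).mono_frame hσ ?_
  rintro k σ' ⟨hk, h21, M', hM', hC'⟩ hb hf
  obtain ⟨h0, h1, h2, h3, h4, h5, h6', h7, -⟩ := h
  have e18 : σ'.arr 18 = σ.arr 18 := hf.arr 18 (by decide)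
  have e20 : σ'.arr 20 = σ.arr 20 := hf.arr 20 (by decide)
  refine ⟨hk, ⟨?_, ?_, by rwa [e18], by rwa [e18], by rwa [e20], by rwa [e20], by rwa [e20],
    by rwa [e20], M', by omega, hC'.congr rfl (fun _ _ _ => rfl) fun τ => ?_⟩, hcard⟩
  · rintro d ⟨j, hj⟩
    rw [h21]
    by_cases hd : d = c
    · rw [hd, Function.update_self]
    · rw [Function.update_of_ne (fun h => hd (vx_inj.1 h))]
      exact h0 d ⟨j, hj.resolve_left fun h => hd (congrArg Prod.snd h)⟩
  · intro d hd
    have hdc : d ≠ c := by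
      rintro rfl
      exact hd ⟨i, Set.mem_insert _ _⟩
    rw [h21, Function.update_of_ne (fun h => hdc (vx_inj.1 h))]
    exact h1 d fun ⟨j, hj⟩ => hd ⟨j, Set.mem_insert_of_mem _ hj⟩
  · simp only [Set.mem_insert_iff, forall_eq_or_imp]
    tauto

/-- Reverse the direction of the edge above the vertex `reg 27`, unless it is on the tree path. -/
def turn : Prog :=
  cond (get 16 (reg 27)) skip
    (put 18 (reg 27) (bin .sub (reg 0) (get 12 (reg 27))) ⨟ put 20 treeEdge (reg 27))

/-- On the tree path nothing is turned, as every path goes down there. Elsewhere the rank is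
reflected at `n`, which puts the vertex before its parent. -/
theorem CoverRep.turn_run {σ : State} {c : V} (hB : 1 < B) (hσ : σ.Bdd B) (hS : Setup I T t anc σ)
    (h : CoverRep I T t tl P U R σ) (hc : c ∈ T.verts) (hs : c ≠ s) (h27 : σ.reg 27 = I.vx c) :
    Run B turn σ fun k σ' => k ≤ 20 ∧
      CoverRep I T t tl P {d | d ∈ U ∨ d = c ∧ ¬ T.Sub c t} R σ' := by
  refine Run.cond hB hσ (by simp [Expr.Ok]) (fun hp => ?_) fun hp => ?_
  · simp only [Expr.val, h27] at hp
    have hct := (hS.path.ne_zero c).1 hp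
    refine Run.of_ok hB hσ trivial fun k hk => ?_
    simp only [Prog.time, Expr.cost] at hk ⊢
    refine ⟨by omega, ?_⟩
    simpa [hct, Prog.eval] using h
  · simp only [Expr.val, h27] at hp
    have hct : ¬ T.Sub c t := fun h => (hS.path.ne_zero c).2 h hp
    obtain ⟨e, he1, he2⟩ := hS.base.tree.edge c hc hs
    obtain ⟨h0, h1, h2, h3, h4, h5, h6, h7, M, hM, hC⟩ := h
    refine Run.of_ok hB hσ (by simp [Prog.Ok, Expr.Ok, treeEdge]) fun k hk => ?_
    simp only [Prog.time, Expr.cost, treeEdge] at hk ⊢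
    refine ⟨by omega, ?_⟩
    simp only [Prog.eval, Expr.val, Op.eval, h27, State.setArr_reg, State.setArr_arr, he1,
      hS.base.tree.num, hS.base.input.r0, Nat.reduceEqDiff, if_false]
    have ne : ∀ j : Fin I.m, j ≠ e → (j : ℕ) ≠ e := fun j hj hje => hj (Fin.ext hje)
    have ne' : ∀ d, d ≠ c → I.vx d ≠ I.vx c := fun d hd h => hd (vx_inj.1 h)
    simp only [hct, not_false_eq_true, and_true]
    refine ⟨?_, ?_, ?_, ?_, ?_, ?_, ?_, ?_, M, hM, hC.congr rfl (fun a h h' => ?_) fun _ => Iff.rfl⟩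
    · simpa using h0
    · simpa using h1
    · intro d hd hdU
      by_cases hdc : d = c
      · simp [hdc]
      · simpa [ne' d hdc] using h2 d hd (hdU.resolve_right hdc)
    · intro d hd hdU
      rw [Set.mem_ofPred_eq, not_or] at hdU
      simpa [ne' d hdU.2] using h3 d hd hdU.1
    · intro d hd hds hdU j hj
      by_cases hdc : d = c
      · subst hdc
        rw [I.edge_inj (hj.trans he2.symm)]
        simp
      · have : j ≠ e := fun h => hdc (SearchTree.edge_inj hd hds hc hs (hj.symm.trans (h ▸ he2)))
        simpa [ne j this] using h4 d hd hds (hdU.resolve_right hdc) j hj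
    · intro d hd hds hdU j hj
      rw [Set.mem_ofPred_eq, not_or] at hdU
      have : j ≠ e := fun h => hdU.2 (SearchTree.edge_inj hd hds hc hs (hj.symm.trans (h ▸ he2)))
      simpa [ne j this] using h5 d hd hds hdU.1 j hj
    · intro j
      by_cases hj : j = e
      · simpa [hj] using vx_lt c
      · simpa [hj] using h6 j
    · intro j hj
      have : j ≠ e := fun h => (h7 j hj).1 (h ▸ isTreeEdge_of_edge_eq hc hs he2)
      simpa [ne j this] using h7 j hj
    · simp only [State.setArr_arr]
      rw [if_neg (by omega), if_neg (by omega)]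

/-- Let the walker with the larger number go up. -/
def coverStep : Prog :=
  cond (bin .lt (get 12 (reg 26)) (get 12 (reg 25)))
    (set 27 (reg 25) ⨟ visit ⨟ turn ⨟ set 25 (get 13 (reg 27)))
    (set 27 (reg 26) ⨟ visit ⨟ set 26 (get 13 (reg 27)))

/-- Go around the cycle of the edge `reg 6`. -/
def coverEdge : Prog :=
  (set 25 (get 0 (reg 6)) ⨟ set 26 (get 1 (reg 6)) ⨟
    cond (bin .lt (get 17 (reg 25)) (get 17 (reg 26)))
      (set 25 (get 1 (reg 6)) ⨟ set 26 (get 0 (reg 6))) skip ⨟ put 20 (reg 6) (reg 26)) ⨟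
  loop (bin .sub (const 1) (bin .eq (reg 25) (reg 26))) coverStep

/-- By `not_sub_of_num_lt`, the walker with the larger number is not at a common ancestor, so the
edge above it lies on the cycle. Each round adds exactly one vertex to those covered and is charged
to it. Only the walker from `u` turns edges: paths cross from `w` to `u` and go up on the side of
`u`. -/
theorem coverStep_run {σ : State} {a b u w : V} {i : Fin I.m}
    (hB : 4 * I.m + 4 * I.n + 4 < B) (hσ : σ.Bdd B) (hS : Setup I T t anc σ)
    (hu : u ∈ T.verts) (hw : w ∈ T.verts) (h6 : σ.reg 6 = i)
    (hP : ∀ c, T.Sub c u ∧ ¬ T.Sub c w ∨ T.Sub c w ∧ ¬ T.Sub c u → ∀ j, (j, c) ∉ P)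
    (h25 : σ.reg 25 = I.vx a) (h26 : σ.reg 26 = I.vx b) (hab : a ≠ b)
    (ha : T.Sub a u) (hb : T.Sub b w)
    (ha' : ∀ c, T.Sub c u → ¬ T.Sub c a → ¬ T.Sub c w)
    (hb' : ∀ c, T.Sub c w → ¬ T.Sub c b → ¬ T.Sub c u)
    (h : CoverRep I T t tl (P ∪ {p | p.1 = i ∧ (T.Sub p.2 u ∧ ¬ T.Sub p.2 a ∨
      T.Sub p.2 w ∧ ¬ T.Sub p.2 b)}) (U ∪ {c | ¬ T.Sub c t ∧ T.Sub c u ∧ ¬ T.Sub c a}) R σ) :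
    Run B coverStep σ fun k σ' => k ≤ 400 ∧ ∃ a₁ b₁, σ'.reg 25 = I.vx a₁ ∧ σ'.reg 26 = I.vx b₁ ∧
      T.Sub a₁ u ∧ T.Sub b₁ w ∧ T.num a₁ + T.num b₁ < T.num a + T.num b ∧
      (∀ c, T.Sub c u → ¬ T.Sub c a₁ → ¬ T.Sub c w) ∧
      (∀ c, T.Sub c w → ¬ T.Sub c b₁ → ¬ T.Sub c u) ∧
      CoverRep I T t tl (P ∪ {p | p.1 = i ∧ (T.Sub p.2 u ∧ ¬ T.Sub p.2 a₁ ∨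
        T.Sub p.2 w ∧ ¬ T.Sub p.2 b₁)}) (U ∪ {c | ¬ T.Sub c t ∧ T.Sub c u ∧ ¬ T.Sub c a₁}) R σ' ∧
      (Prod.snd '' (P ∪ {p | p.1 = i ∧ (T.Sub p.2 u ∧ ¬ T.Sub p.2 a₁ ∨
        T.Sub p.2 w ∧ ¬ T.Sub p.2 b₁)})).ncard = (Prod.snd '' (P ∪ {p | p.1 = i ∧
          (T.Sub p.2 u ∧ ¬ T.Sub p.2 a ∨ T.Sub p.2 w ∧ ¬ T.Sub p.2 b)})).ncard + 1 := by
  have hB1 : 1 < B := by omega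
  have hav := ha.mem hu
  have hbv := hb.mem hw
  refine Run.cond hB1 hσ (by simp [Expr.Ok]) (fun hp => ?_) fun hp => ?_
  · have hn : T.num b < T.num a := by
      by_contra hn
      simp [Expr.val, Op.eval, h25, h26, hS.base.tree.num, hn] at hp
    have haw := not_sub_of_num_lt ha hb' hn
    have has : a ≠ s := by
      rintro rfl
      exact haw (sub_root hw)
    have hset : insert (i, a) (P ∪ {p | p.1 = i ∧ (T.Sub p.2 u ∧ ¬ T.Sub p.2 a ∨
        T.Sub p.2 w ∧ ¬ T.Sub p.2 b)}) = P ∪ {p | p.1 = i ∧ (T.Sub p.2 u ∧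
        ¬ T.Sub p.2 (T.par a) ∨ T.Sub p.2 w ∧ ¬ T.Sub p.2 b)} := by
      ext ⟨j, c⟩
      simp only [Set.mem_insert_iff, Set.mem_union, Set.mem_ofPred_eq, chain_par hav has ha,
        Prod.mk.injEq]
      tauto
    have hsetU : {d | d ∈ U ∪ {c | ¬ T.Sub c t ∧ T.Sub c u ∧ ¬ T.Sub c a} ∨
        d = a ∧ ¬ T.Sub a t} = U ∪ {c | ¬ T.Sub c t ∧ T.Sub c u ∧ ¬ T.Sub c (T.par a)} := by
      ext c
      simp only [Set.mem_union, Set.mem_ofPred_eq, chain_par hav has ha]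
      by_cases hca : c = a
      · subst hca; tauto
      · tauto
    refine Run.seq (Run.of_ok hB1 hσ (by simp [Prog.Ok, Expr.Ok]) fun k₁ hk₁ => ?_)
    simp only [Prog.eval, Expr.val, h25]
    simp only [Prog.time, Expr.cost] at hk₁
    have hb₁ : (σ.setReg 27 (I.vx a)).Bdd B := hσ.setReg _ (by have := vx_lt (I := I) a; omega)
    have hS₁ : Setup I T t anc (σ.setReg 27 (I.vx a)) := hS.congr
      (fun x hx => by rw [State.setReg_reg, if_neg (by omega)]) (by simp) fun _ _ _ => rfl
    refine Run.seq ((CoverRep.visit_run hB hb₁ hS₁ (h.congr (by simp) fun _ _ _ => rfl) hav has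
      (by simp) (by simpa using h6) ?_).mono_frame hb₁ ?_)
    · rintro j (hj | ⟨-, hj | hj⟩)
      · exact hP a (Or.inl ⟨ha, haw⟩) j hj
      · exact hj.2 (Sub.refl a)
      · exact haw hj.1
    rintro k₂ σ₂ ⟨hk₂, hC₂, hcard⟩ hb₂ hf₂
    have hS₂ := hS₁.frame hf₂ (by decide) (by decide)
    have r27 : σ₂.reg 27 = I.vx a := by rw [hf₂.reg 27 (by decide)]; simp
    refine Run.seq ((hC₂.turn_run hB1 hb₂ hS₂ hav has r27).mono_frame hb₂ ?_)
    rintro k₃ σ₃ ⟨hk₃, hC₃⟩ hb₃ hf₃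
    have hS₃ := hS₂.frame hf₃ (by decide) (by decide)
    rw [hset, hsetU] at hC₃
    rw [hset] at hcard
    refine Run.of_ok hB1 hb₃ (by simp [Prog.Ok, Expr.Ok]) fun k₄ hk₄ => ?_
    simp only [Prog.eval, Expr.val]
    simp only [Prog.time, Expr.cost] at hk₄ ⊢
    have hpar := T.num_par a hav has
    refine ⟨by omega, T.par a, b, ?_, ?_, (sub_par hav has).trans ha, hb, by omega, ?_, hb',
      hC₃.congr (by simp) fun _ _ _ => rfl, hcard⟩
    · rw [State.setReg_reg, if_pos rfl, hf₃.reg 27 (by decide), r27, hS₃.base.tree.par a hav has]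
    · rw [State.setReg_reg, if_neg (by omega), hf₃.reg 26 (by decide), hf₂.reg 26 (by decide)]
      simpa using h26
    · intro c h1 h2
      rcases (chain_par hav has ha).1 ⟨h1, h2⟩ with rfl | h3
      exacts [haw, ha' c h3.1 h3.2]
  · have hn : T.num a < T.num b := by
      by_contra hn
      have : T.num a ≠ T.num b := fun h => hab (T.num_inj hav hbv h)
      simp [Expr.val, Op.eval, h25, h26, hS.base.tree.num] at hp
      omega
    have hbu := not_sub_of_num_lt hb ha' hn
    have hbs : b ≠ s := by
      rintro rfl
      exact hbu (sub_root hu)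
    have hset : insert (i, b) (P ∪ {p | p.1 = i ∧ (T.Sub p.2 u ∧ ¬ T.Sub p.2 a ∨
        T.Sub p.2 w ∧ ¬ T.Sub p.2 b)}) = P ∪ {p | p.1 = i ∧ (T.Sub p.2 u ∧
        ¬ T.Sub p.2 a ∨ T.Sub p.2 w ∧ ¬ T.Sub p.2 (T.par b))} := by
      ext ⟨j, c⟩
      simp only [Set.mem_insert_iff, Set.mem_union, Set.mem_ofPred_eq, chain_par hbv hbs hb,
        Prod.mk.injEq]
      tauto
    refine Run.seq (Run.of_ok hB1 hσ (by simp [Prog.Ok, Expr.Ok]) fun k₁ hk₁ => ?_)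
    simp only [Prog.eval, Expr.val, h26]
    simp only [Prog.time, Expr.cost] at hk₁
    have hb₁ : (σ.setReg 27 (I.vx b)).Bdd B := hσ.setReg _ (by have := vx_lt (I := I) b; omega)
    have hS₁ : Setup I T t anc (σ.setReg 27 (I.vx b)) := hS.congr
      (fun x hx => by rw [State.setReg_reg, if_neg (by omega)]) (by simp) fun _ _ _ => rfl
    refine Run.seq ((CoverRep.visit_run hB hb₁ hS₁ (h.congr (by simp) fun _ _ _ => rfl) hbv hbs
      (by simp) (by simpa using h6) ?_).mono_frame hb₁ ?_)
    · rintro j (hj | ⟨-, hj | hj⟩)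
      · exact hP b (Or.inr ⟨hb, hbu⟩) j hj
      · exact hbu hj.1
      · exact hj.2 (Sub.refl b)
    rintro k₂ σ₂ ⟨hk₂, hC₂, hcard⟩ hb₂ hf₂
    have hS₂ := hS₁.frame hf₂ (by decide) (by decide)
    have r27 : σ₂.reg 27 = I.vx b := by rw [hf₂.reg 27 (by decide)]; simp
    rw [hset] at hC₂ hcard
    refine Run.of_ok hB1 hb₂ (by simp [Prog.Ok, Expr.Ok]) fun k₄ hk₄ => ?_
    simp only [Prog.eval, Expr.val]
    simp only [Prog.time, Expr.cost] at hk₄ ⊢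
    have hpar := T.num_par b hbv hbs
    refine ⟨by omega, a, T.par b, ?_, ?_, ha, (sub_par hbv hbs).trans hb, by omega, ha', ?_,
      hC₂.congr (by simp) fun _ _ _ => rfl, hcard⟩
    · rw [State.setReg_reg, if_neg (by omega), hf₂.reg 25 (by decide)]
      simpa using h25
    · rw [State.setReg_reg, if_pos rfl, r27, hS₂.base.tree.par b hbv hbs]
    · intro c h1 h2
      rcases (chain_par hbv hbs hb).1 ⟨h1, h2⟩ with rfl | h3
      exacts [hbu, hb' c h3.1 h3.2]

/-- The end of an edge that a path traverses last. -/
noncomputable def hi (I : S.Presentation) (anc : V → ℕ) (i : Fin I.m) : V :=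
  if anc (I.fst i) < anc (I.snd i) then I.snd i else I.fst i

/-- The end of an edge that a path traverses first. -/
noncomputable def lo (I : S.Presentation) (anc : V → ℕ) (i : Fin I.m) : V :=
  if anc (I.fst i) < anc (I.snd i) then I.fst i else I.snd i

theorem edge_hi_lo (anc : V → ℕ) (i : Fin I.m) :
    (I.edge i : Sym2 V) = s(I.hi anc i, I.lo anc i) := by
  rw [I.edge_eq, hi, lo]
  split_ifs
  · exact Sym2.eq_swap
  · rfl

theorem nonTree_hi_lo (anc : V → ℕ) (i : Fin I.m) :
    T.NonTree (I.hi anc i) (I.lo anc i) ↔ T.NonTree (I.fst i) (I.snd i) := by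
  rw [hi, lo]
  split_ifs
  · exact ⟨NonTree.symm, NonTree.symm⟩
  · rfl

/-- The pairs of one of the first `j` edges that is not in the tree, and a vertex such that the edge
above the vertex is on the cycle of the former edge. -/
def coverPairs (I : S.Presentation) (T : SearchTree S.graph s) (anc : V → ℕ) (j : ℕ) :
    Set (Fin I.m × V) :=
  {p | p.1 < j ∧ T.NonTree (I.hi anc p.1) (I.lo anc p.1) ∧
    (T.Sub p.2 (I.hi anc p.1) ∧ ¬ T.Sub p.2 (I.lo anc p.1) ∨
      T.Sub p.2 (I.lo anc p.1) ∧ ¬ T.Sub p.2 (I.hi anc p.1))}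

/-- The vertices from which a path goes up along the cycle of one of the first `j` edges. -/
def upVerts (I : S.Presentation) (T : SearchTree S.graph s) (t : V) (anc : V → ℕ) (j : ℕ) : Set V :=
  {c | ¬ T.Sub c t ∧ ∃ i : Fin I.m, i < j ∧ T.NonTree (I.hi anc i) (I.lo anc i) ∧
    T.Sub c (I.hi anc i) ∧ ¬ T.Sub c (I.lo anc i)}

/-- Those of the first `j` edges that are not in the tree. -/
def nonTreeEdges (I : S.Presentation) (T : SearchTree S.graph s) (anc : V → ℕ) (j : ℕ) :
    Set (Fin I.m) :=
  {i | i < j ∧ T.NonTree (I.hi anc i) (I.lo anc i)}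

theorem lt_succ_iff_fin (i : Fin I.m) (j : Fin I.m) : (j : ℕ) < i + 1 ↔ j = i ∨ (j : ℕ) < i := by
  rw [Nat.lt_succ_iff_lt_or_eq, Fin.val_inj, or_comm]

theorem coverPairs_succ {i : Fin I.m} (h : T.NonTree (I.hi anc i) (I.lo anc i)) :
    I.coverPairs T anc (i + 1) = I.coverPairs T anc i ∪ {p | p.1 = i ∧
      (T.Sub p.2 (I.hi anc i) ∧ ¬ T.Sub p.2 (I.lo anc i) ∨
        T.Sub p.2 (I.lo anc i) ∧ ¬ T.Sub p.2 (I.hi anc i))} := by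
  ext ⟨j, c⟩
  simp only [coverPairs, Set.mem_union, Set.mem_ofPred_eq, lt_succ_iff_fin]
  by_cases hj : j = i
  · subst hj
    simp [h]
  · simp [hj]

theorem coverPairs_succ_of_not {i : Fin I.m} (h : ¬ T.NonTree (I.hi anc i) (I.lo anc i)) :
    I.coverPairs T anc (i + 1) = I.coverPairs T anc i := by
  ext ⟨j, c⟩
  simp only [coverPairs, Set.mem_ofPred_eq, lt_succ_iff_fin]
  by_cases hj : j = i
  · subst hj
    simp [h]
  · simp [hj]

theorem upVerts_succ {i : Fin I.m} (h : T.NonTree (I.hi anc i) (I.lo anc i)) :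
    I.upVerts T t anc (i + 1) = I.upVerts T t anc i ∪
      {c | ¬ T.Sub c t ∧ T.Sub c (I.hi anc i) ∧ ¬ T.Sub c (I.lo anc i)} := by
  ext c
  simp only [upVerts, Set.mem_union, Set.mem_ofPred_eq, lt_succ_iff_fin]
  constructor
  · rintro ⟨h1, j, rfl | h2, h3⟩
    · exact Or.inr ⟨h1, h3.2⟩
    · exact Or.inl ⟨h1, j, h2, h3⟩
  · rintro (⟨h1, j, h2, h3⟩ | ⟨h1, h2⟩)
    · exact ⟨h1, j, Or.inr h2, h3⟩
    · exact ⟨h1, i, Or.inl rfl, h, h2⟩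

theorem upVerts_succ_of_not {i : Fin I.m} (h : ¬ T.NonTree (I.hi anc i) (I.lo anc i)) :
    I.upVerts T t anc (i + 1) = I.upVerts T t anc i := by
  ext c
  simp only [upVerts, Set.mem_ofPred_eq, lt_succ_iff_fin]
  constructor
  · rintro ⟨h1, j, rfl | h2, h3⟩
    · exact absurd h3.1 h
    · exact ⟨h1, j, h2, h3⟩
  · rintro ⟨h1, j, h2, h3⟩
    exact ⟨h1, j, Or.inr h2, h3⟩

theorem nonTreeEdges_succ {i : Fin I.m} (h : T.NonTree (I.hi anc i) (I.lo anc i)) :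
    I.nonTreeEdges T anc (i + 1) = insert i (I.nonTreeEdges T anc i) := by
  ext j
  simp only [nonTreeEdges, Set.mem_insert_iff, Set.mem_ofPred_eq, lt_succ_iff_fin]
  constructor
  · rintro ⟨h1, h2⟩
    tauto
  · rintro (rfl | h1)
    · exact ⟨Or.inl rfl, h⟩
    · tauto

theorem nonTreeEdges_succ_of_not {i : Fin I.m} (h : ¬ T.NonTree (I.hi anc i) (I.lo anc i)) :
    I.nonTreeEdges T anc (i + 1) = I.nonTreeEdges T anc i := by
  ext j
  simp only [nonTreeEdges, Set.mem_ofPred_eq, lt_succ_iff_fin]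
  constructor
  · rintro ⟨rfl | h1, h2⟩
    · exact absurd h2 h
    · exact ⟨h1, h2⟩
  · tauto

/-- The cell written belongs to an edge outside of the tree, so the tails of the tree edges stay. -/
theorem CoverRep.setTail {σ : State} {i : Fin I.m} (h : CoverRep I T t tl P U R σ)
    (hi : ¬ T.IsTreeEdge (I.fst i) (I.snd i)) :
    CoverRep I T t tl P U (insert i R) (σ.setArr 20 i (I.vx (tl i))) := by
  obtain ⟨h0, h1, h2, h3, h4, h5, h6, h7, M, hM, hC⟩ := h
  have ne : ∀ c ∈ T.verts, c ≠ s → ∀ j : Fin I.m, (I.edge j : Sym2 V) = s(c, T.par c) →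
      (j : ℕ) ≠ i := fun c hc hs j hj hji => hi (Fin.ext hji ▸ isTreeEdge_of_edge_eq hc hs hj)
  refine ⟨by simpa using h0, by simpa using h1, by simpa using h2, by simpa using h3, ?_, ?_, ?_,
    ?_, M, hM, hC.congr rfl (fun a h h' => ?_) fun _ => Iff.rfl⟩
  · intro c hc hs hcU j hj
    simpa [ne c hc hs j hj] using h4 c hc hs hcU j hj
  · intro c hc hs hcU j hj
    simpa [ne c hc hs j hj] using h5 c hc hs hcU j hj
  · intro j
    by_cases hj : j = i
    · simpa [hj] using vx_lt _
    · simpa [hj] using h6 j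
  · intro j hj
    by_cases hji : j = i
    · subst hji
      exact ⟨hi, by simp⟩
    · have : (j : ℕ) ≠ i := fun h => hji (Fin.ext h)
      simpa [this] using h7 j (hj.resolve_left hji)
  · rw [State.setArr_arr, if_neg (by omega)]

/-- In a cactus, the cycle of an edge does not meet the cycles dealt with before. -/
theorem notMem_coverPairs (hG : S.graph.IsCactus) {i : Fin I.m}
    (hi : T.NonTree (I.hi anc i) (I.lo anc i)) {c : V}
    (hc : T.Sub c (I.hi anc i) ∧ ¬ T.Sub c (I.lo anc i) ∨
      T.Sub c (I.lo anc i) ∧ ¬ T.Sub c (I.hi anc i)) (j : Fin I.m) :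
    (j, c) ∉ I.coverPairs T anc i := by
  rintro ⟨hj, hj', hcj⟩
  simp only at hj hj' hcj
  have hcv : c ∈ T.verts ∧ c ≠ s := by
    rcases hc with ⟨h1, h2⟩ | ⟨h1, h2⟩
    · exact ⟨h1.mem hi.mem_left, fun h => h2 (h ▸ sub_root hi.mem_right)⟩
    · exact ⟨h1.mem hi.mem_right, fun h => h2 (h ▸ sub_root hi.mem_left)⟩
  have he : (I.edge i : Sym2 V) = I.edge j := by
    rw [edge_hi_lo anc, edge_hi_lo anc]
    rcases hc with ⟨h1, h2⟩ | ⟨h1, h2⟩ <;> rcases hcj with ⟨h3, h4⟩ | ⟨h3, h4⟩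
    · obtain ⟨e1, e2⟩ := cover_unique hG hcv.1 hcv.2 hi h1 h2 hj' h3 h4
      rw [e1, e2]
    · obtain ⟨e1, e2⟩ := cover_unique hG hcv.1 hcv.2 hi h1 h2 hj'.symm h3 h4
      rw [e1, e2, Sym2.eq_swap]
    · obtain ⟨e1, e2⟩ := cover_unique hG hcv.1 hcv.2 hi.symm h1 h2 hj' h3 h4
      rw [e1, e2, Sym2.eq_swap]
    · obtain ⟨e1, e2⟩ := cover_unique hG hcv.1 hcv.2 hi.symm h1 h2 hj'.symm h3 h4
      rw [e1, e2]
  have := I.edge_inj he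
  subst this
  omega

/-- The time is bounded by the growth of the set of covered vertices. The cactus property enters
through `notMem_coverPairs`, by which all vertices met on this cycle are new. -/
theorem coverEdge_run {σ : State} {i : Fin I.m} (hG : S.graph.IsCactus)
    (hB : 4 * I.m + 4 * I.n + 4 < B) (hσ : σ.Bdd B) (hS : Setup I T t anc σ)
    (h6 : σ.reg 6 = i) (hi : T.NonTree (I.hi anc i) (I.lo anc i))
    (h : CoverRep I T t (I.lo anc) (I.coverPairs T anc i) (I.upVerts T t anc i)
      (I.nonTreeEdges T anc i) σ) :
    Run B coverEdge σ fun k σ' =>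
      k + 500 * (Prod.snd '' I.coverPairs T anc i).ncard ≤
        500 * (Prod.snd '' I.coverPairs T anc (i + 1)).ncard + 60 ∧
      CoverRep I T t (I.lo anc) (I.coverPairs T anc (i + 1)) (I.upVerts T t anc (i + 1))
        (I.nonTreeEdges T anc (i + 1)) σ' := by
  have hB1 : 1 < B := by omega
  have hu := hi.mem_left
  have hw := hi.mem_right
  have hP := fun c hc j => notMem_coverPairs hG hi (c := c) hc j
  refine Run.seq (Run.mono_frame (Q := fun k σ' => k ≤ 40 ∧ σ'.reg 25 = I.vx (I.hi anc i) ∧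
    σ'.reg 26 = I.vx (I.lo anc i) ∧ CoverRep I T t (I.lo anc) (I.coverPairs T anc i)
      (I.upVerts T t anc i) (insert i (I.nonTreeEdges T anc i)) σ') hσ
    (Run.of_ok hB1 hσ (by simp [Prog.Ok, Expr.Ok]) fun k hk => ⟨?_, ?_, ?_, ?_⟩) ?_)
  · simp only [Prog.time, Expr.cost] at hk; omega
  · by_cases hlt : anc (I.fst i) < anc (I.snd i) <;>
    simp [Prog.eval, Expr.val, Op.eval, h6, hS.base.input.a0, hS.base.input.a1, hS.anc_eq,
      Presentation.hi, hlt]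
  · by_cases hlt : anc (I.fst i) < anc (I.snd i) <;>
    simp [Prog.eval, Expr.val, Op.eval, h6, hS.base.input.a0, hS.base.input.a1, hS.anc_eq,
      Presentation.lo, hlt]
  · refine (h.setTail (i := i) ((nonTree_hi_lo anc i).1 hi).2.2).congr ?_ ?_ <;>
    by_cases hlt : anc (I.fst i) < anc (I.snd i) <;>
    simp [Prog.eval, Expr.val, Op.eval, h6, hS.base.input.a0, hS.base.input.a1, hS.anc_eq,
      Presentation.lo, hlt]
  rintro k₁ σ₁ ⟨hk₁, h25, h26, hC₁⟩ hb₁ hf₁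
  have hS₁ := hS.frame hf₁ (by decide) (by decide)
  have h6₁ : σ₁.reg 6 = i := by rw [hf₁.reg 6 (by decide), h6]
  rw [coverPairs_succ hi, upVerts_succ hi, nonTreeEdges_succ hi]
  generalize I.hi anc i = u at *
  generalize hw' : I.lo anc i = w at *
  generalize I.coverPairs T anc i = P at *
  generalize I.upVerts T t anc i = U at *
  generalize insert i (I.nonTreeEdges T anc i) = R at *
  refine Run.loop hB1 hb₁ (fun n k σ' => ∃ a b, n = T.num a + T.num b ∧ σ'.reg 25 = I.vx a ∧
      σ'.reg 26 = I.vx b ∧ T.Sub a u ∧ T.Sub b w ∧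
      (∀ c, T.Sub c u → ¬ T.Sub c a → ¬ T.Sub c w) ∧
      (∀ c, T.Sub c w → ¬ T.Sub c b → ¬ T.Sub c u) ∧
      CoverRep I T t (I.lo anc) (P ∪ {p | p.1 = i ∧ (T.Sub p.2 u ∧ ¬ T.Sub p.2 a ∨
        T.Sub p.2 w ∧ ¬ T.Sub p.2 b)}) (U ∪ {c | ¬ T.Sub c t ∧ T.Sub c u ∧ ¬ T.Sub c a}) R σ' ∧
      k + 500 * (Prod.snd '' P).ncard ≤ 500 * (Prod.snd '' (P ∪ {p | p.1 = i ∧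
        (T.Sub p.2 u ∧ ¬ T.Sub p.2 a ∨ T.Sub p.2 w ∧ ¬ T.Sub p.2 b)})).ncard)
    (T.num u + T.num w) ?_ ?_
  · refine ⟨u, w, rfl, h25, h26, Sub.refl u, Sub.refl w, fun c h h' => absurd h h',
      fun c h h' => absurd h h', ?_, ?_⟩
    · convert hC₁ using 1 <;> simp
    · simp
  · rintro n k σ' hb hf ⟨a, b, rfl, e25, e26, ha, hb1, ha', hb', hC, hk⟩
    have hS' := hS₁.frame hf (by decide) (by decide)
    have e6 : σ'.reg 6 = i := by rw [hf.reg 6 (by decide), h6₁]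
    refine ⟨by simp [Expr.Ok, hB1], fun h0 => ?_, fun h0 => ?_⟩
    · have hab : a = b := by
        by_contra hne
        have : I.vx a ≠ I.vx b := fun h => hne (vx_inj.1 h)
        simp [Expr.val, Op.eval, e25, e26, this] at h0
      subst hab
      -- The walkers have met at a common ancestor without passing one, so the vertices passed are
      -- exactly those above one end and not above the other.
      have e1 : ∀ c, (T.Sub c u ∧ ¬ T.Sub c a) ↔ T.Sub c u ∧ ¬ T.Sub c w := fun c =>
        ⟨fun h => ⟨h.1, ha' c h.1 h.2⟩, fun h => ⟨h.1, fun h' => h.2 (h'.trans hb1)⟩⟩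
      have e2 : ∀ c, (T.Sub c w ∧ ¬ T.Sub c a) ↔ T.Sub c w ∧ ¬ T.Sub c u := fun c =>
        ⟨fun h => ⟨h.1, hb' c h.1 h.2⟩, fun h => ⟨h.1, fun h' => h.2 (h'.trans ha)⟩⟩
      simp only [e1, e2] at hC hk
      exact ⟨by simp only [Expr.cost]; omega, hC⟩
    · have hab : a ≠ b := by
        rintro rfl
        simp [Expr.val, Op.eval, e25, e26] at h0
      refine (coverStep_run hB hb hS' hu hw e6 hP e25 e26 hab ha hb1 ha' hb' hC).mono ?_
      rintro l σ'' ⟨hl, a₁, b₁, f25, f26, ha₁, hb₁, hlt, ha₁', hb₁', hC', hcard⟩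
      refine ⟨_, hlt, a₁, b₁, rfl, f25, f26, ha₁, hb₁, ha₁', hb₁', hC', ?_⟩
      rw [hcard]
      simp only [Expr.cost]
      omega

/-- Go around all cycles. -/
def cover : Prog :=
  set 6 (const 0) ⨟
  loop (bin .lt (reg 6) (reg 1))
    (cond (get 19 (reg 6)) skip
      (cond (bin .eq (get 10 (get 0 (reg 6))) (const 1)) coverEdge skip) ⨟
     set 6 (bin .add (reg 6) (const 1)))

/-- The bounds for the cycles telescope to 500 steps per covered vertex, of which there are at most
`n`; every edge costs a constant more. -/
theorem cover_run {σ : State} (hG : S.graph.IsCactus)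
    (hB : 4 * I.m + 4 * I.n + 4 < B) (hσ : σ.Bdd B) (hS : Setup I T t anc σ)
    (h18 : ∀ v ∈ T.verts, σ.arr 18 (I.vx v) = I.n + T.num v)
    (h20 : ∀ v ∈ T.verts, v ≠ s → ∀ i : Fin I.m, (I.edge i : Sym2 V) = s(v, T.par v) →
      σ.arr 20 i = I.vx (T.par v)) (h20' : ∀ i, σ.arr 20 i < I.n) (h21 : ∀ i, σ.arr 21 i = 0)
    (hC : Clauses (I.m + I.n) 0 (fun _ => True) σ) :
    Run B cover σ fun k σ' => k ≤ 500 * I.n + 100 * I.m + 10 ∧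
      CoverRep I T t (I.lo anc) (I.coverPairs T anc I.m) (I.upVerts T t anc I.m)
        (I.nonTreeEdges T anc I.m) σ' := by
  have hB1 : 1 < B := by omega
  refine Run.seq (Run.of_ok hB1 hσ (by simp [Prog.Ok, Expr.Ok]; omega) fun k₁ hk₁ => ?_)
  simp only [Prog.time, Expr.cost] at hk₁
  simp only [Prog.eval, Expr.val]
  have hb₁ : (σ.setReg 6 0).Bdd B := hσ.setReg _ (by omega)
  have hS₁ : Setup I T t anc (σ.setReg 6 0) := hS.congr
    (fun x hx => by rw [State.setReg_reg, if_neg (by omega)]) (by simp) fun _ _ _ => rfl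
  refine (Run.for hB1 hb₁ (fun j k σ' => σ'.reg 6 = j ∧
    k ≤ 500 * (Prod.snd '' I.coverPairs T anc j).ncard + 100 * j ∧
    CoverRep I T t (I.lo anc) (I.coverPairs T anc j) (I.upVerts T t anc j)
      (I.nonTreeEdges T anc j) σ') 0 I.m (fun i k σ' h => h.1) hS₁.base.input.r1 (by decide)
    (Nat.zero_le _) ⟨by simp, by omega, ?_⟩ ?_).mono ?_
  · have e1 : I.coverPairs T anc 0 = ∅ := by ext p; simp [coverPairs]
    have e2 : I.upVerts T t anc 0 = ∅ := by ext p; simp [upVerts]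
    have e3 : I.nonTreeEdges T anc 0 = ∅ := by ext p; simp [nonTreeEdges]
    rw [e1, e2, e3]
    refine ⟨by simp, by simp [h21], by simp, by simpa using h18, by simp, by simpa using h20,
      by simpa using h20', by simp, 0, by omega,
      hC.congr (by simp) (fun _ _ _ => rfl) (by simp)⟩
  · rintro j k σ' hb hf ⟨e6, hk, hC'⟩ - hj
    have hS' := hS₁.frame hf (by decide) (by decide)
    let i : Fin I.m := ⟨j, hj⟩
    have e6' : σ'.reg 6 = i := e6
    have fin : ∀ l σ'', σ''.Bdd B → σ''.reg 6 = j →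
        l + 500 * (Prod.snd '' I.coverPairs T anc j).ncard ≤
          500 * (Prod.snd '' I.coverPairs T anc (j + 1)).ncard + 80 →
        CoverRep I T t (I.lo anc) (I.coverPairs T anc (j + 1)) (I.upVerts T t anc (j + 1))
          (I.nonTreeEdges T anc (j + 1)) σ'' →
        Run B (set 6 (bin .add (reg 6) (const 1))) σ'' fun l' σ₃ => σ₃.reg 6 = j + 1 ∧
          k + (l + l' + 4) ≤ 500 * (Prod.snd '' I.coverPairs T anc (j + 1)).ncard +
            100 * (j + 1) ∧
          CoverRep I T t (I.lo anc) (I.coverPairs T anc (j + 1)) (I.upVerts T t anc (j + 1))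
            (I.nonTreeEdges T anc (j + 1)) σ₃ := by
      intro l σ'' hb'' h6'' hl hC''
      refine Run.of_ok hB1 hb'' (by simp [Prog.Ok, Expr.Ok, Expr.val, h6'']; omega)
        fun l' hl' => ⟨?_, ?_, hC''.congr (by simp [Prog.eval]) fun _ _ _ => rfl⟩
      · simp [Prog.eval, Expr.val, Op.eval, h6'']
      · simp only [Prog.time, Expr.cost] at hl'
        omega
    have skip_case : ¬ T.NonTree (I.hi anc i) (I.lo anc i) →
        I.coverPairs T anc (j + 1) = I.coverPairs T anc j ∧
        I.upVerts T t anc (j + 1) = I.upVerts T t anc j ∧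
        I.nonTreeEdges T anc (j + 1) = I.nonTreeEdges T anc j := fun h =>
      ⟨coverPairs_succ_of_not (i := i) h, upVerts_succ_of_not (i := i) h,
        nonTreeEdges_succ_of_not (i := i) h⟩
    refine Run.seq (Run.cond hB1 hb (by simp [Expr.Ok]) (fun hp => ?_) fun hp => ?_)
    · simp only [Expr.val, e6'] at hp
      obtain ⟨s1, s2, s3⟩ := skip_case fun h =>
        ((nonTree_hi_lo anc i).1 h).2.2 ((hS'.tree_edge i).1 hp)
      refine Run.of_ok hB1 hb trivial fun l hl => fin _ _ hb e6 ?_ ?_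
      · simp only [Prog.time, Expr.cost, s1] at hl ⊢
        omega
      · rw [s1, s2, s3]
        exact hC'
    · simp only [Expr.val, e6'] at hp
      have hnt : ¬ T.IsTreeEdge (I.fst i) (I.snd i) := fun h => (hS'.tree_edge i).2 h hp
      refine Run.cond hB1 hb (by simp [Expr.Ok, hB1]) (fun hm => ?_) fun hm => ?_
      · have hi : T.NonTree (I.hi anc i) (I.lo anc i) := by
          refine (nonTree_hi_lo anc i).2 ⟨edge_adj i, ?_, hnt⟩
          rw [← hS'.base.tree.mark]
          by_contra hne
          simp [Expr.val, Op.eval, e6', hS'.base.input.a0, hne] at hm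
        refine (coverEdge_run hG hB hb hS' e6' hi hC').mono_frame hb ?_
        rintro l σ'' ⟨hl, hC''⟩ hb'' hf''
        refine fin _ _ hb'' ?_ ?_ hC''
        · rw [hf''.reg 6 (by decide), e6]
        · simp only [Expr.cost]
          change l + 500 * (Prod.snd '' I.coverPairs T anc j).ncard ≤
            500 * (Prod.snd '' I.coverPairs T anc (j + 1)).ncard + 60 at hl
          omega
      · obtain ⟨s1, s2, s3⟩ := skip_case fun h => by
          have := ((nonTree_hi_lo anc i).1 h).mem_left
          rw [← hS'.base.tree.mark] at this
          simp [Expr.val, Op.eval, e6', hS'.base.input.a0, this] at hm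
        refine Run.of_ok hB1 hb trivial fun l hl => fin _ _ hb e6 ?_ ?_
        · simp only [Prog.time, Expr.cost, s1] at hl ⊢
          omega
        · rw [s1, s2, s3]
          exact hC'
  · rintro k σ' ⟨l, rfl, -, hl, hC'⟩
    have := I.ncard_le (Prod.snd '' I.coverPairs T anc I.m)
    exact ⟨by omega, hC'⟩

end SelfDeletingGraph.Presentation

/-! ### The remaining clauses -/

namespace SelfDeletingGraph.Presentation

open Ram Ram.Expr Ram.Prog SearchTree

variable {V : Type*} {S : SelfDeletingGraph V} {I : S.Presentation} {s t : V}
  {T : SearchTree S.graph s} {B : ℕ} {anc : V → ℕ} {M : ℕ} {Φ : (ℕ → Prop) → Prop}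

theorem lit_vert {τ : ℕ → Prop} {v : V} :
    lit (I.m + I.n) τ (I.m + I.vx v) ↔ v ∈ I.vertsOf τ := by
  have := vx_lt (I := I) v
  rw [lit, if_pos (by omega)]
  rfl

theorem lit_not_vert {τ : ℕ → Prop} {v : V} :
    lit (I.m + I.n) τ (I.m + I.vx v + (I.m + I.n)) ↔ v ∉ I.vertsOf τ := by
  rw [lit, if_neg (by omega), Nat.add_sub_cancel]
  rfl

theorem neg_of_lt {N a : ℕ} (h : a < N) : neg N a = a + N := by rw [neg, if_pos h]

theorem neg_add_self {N a : ℕ} : neg N (a + N) = a := by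
  rw [neg, if_neg (by omega), Nat.add_sub_cancel]

/-- Add the clauses that the bridges on the tree path belong to the path. -/
def bridges : Prog :=
  set 6 (const 1) ⨟
  loop (bin .lt (reg 6) (reg 22))
    (set 27 (get 11 (reg 6)) ⨟
     cond (bin .lt (get 21 (reg 27)) (get 16 (reg 27)))
       (imp (bin .add treeEdge (reg 5)) treeEdge treeEdge (bin .add treeEdge (reg 5))) skip ⨟
     set 6 (bin .add (reg 6) (const 1)))

/-- The implication from the negation of a literal to the literal itself forces it to be true. With
values `0` and `1`, the program's test `lt` of array `21` against array `16` singles out uncovered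
vertices on the tree path. -/
theorem bridges_run {σ : State} {A : Set V} (hB : 2 * I.m + 2 * I.n + 2 < B)
    (hMB : M + 2 * I.n + 2 < B) (hσ : σ.Bdd B) (hS : Setup I T t anc σ)
    (hA : ∀ c ∈ A, σ.arr 21 (I.vx c) = 1) (hA' : ∀ c, c ∉ A → σ.arr 21 (I.vx c) = 0)
    (h : Clauses (I.m + I.n) M Φ σ) :
    Run B bridges σ fun k σ' => k ≤ 200 * I.n + 20 ∧ ∃ M' ≤ M + 2 * I.n,
      Clauses (I.m + I.n) M' (fun τ => Φ τ ∧ ∀ c ∈ T.verts, c ≠ s → T.Sub c t → c ∉ A →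
        s(c, T.par c) ∈ I.edgesOf τ) σ' := by
  have hB1 : 1 < B := by omega
  refine Run.seq (Run.of_ok hB1 hσ (by simp [Prog.Ok, Expr.Ok]; omega) fun k₁ hk₁ => ?_)
  simp only [Prog.time, Expr.cost] at hk₁
  simp only [Prog.eval, Expr.val]
  have hb₁ : (σ.setReg 6 1).Bdd B := hσ.setReg _ (by omega)
  have hS₁ : Setup I T t anc (σ.setReg 6 1) := hS.congr
    (fun x hx => by rw [State.setReg_reg, if_neg (by omega)]) (by simp) fun _ _ _ => rfl
  have hpos := hS.base.tree.qt_pos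
  have hqt := hS.base.tree.qt_le
  have hlt := hS.base.tree.num_lt
  refine (Run.for hB1 hb₁ (fun j k σ' => σ'.reg 6 = j ∧ k ≤ 200 * j ∧ ∃ M' ≤ M + 2 * j,
    Clauses (I.m + I.n) M' (fun τ => Φ τ ∧ ∀ c ∈ T.verts, T.num c < j → c ≠ s → T.Sub c t →
      c ∉ A → s(c, T.par c) ∈ I.edgesOf τ) σ') 1 (σ.reg 22) (fun i k σ' h => h.1)
    (by simp) (by decide) (by omega) ⟨by simp, by omega, M, by omega, ?_⟩ ?_).mono ?_
  · refine h.congr (by simp) (fun _ _ _ => rfl) fun τ => ⟨fun h => ⟨h, fun c hc hn hcs => ?_⟩, And.left⟩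
    refine absurd (T.num_inj hc T.root_mem ?_) hcs
    rw [hS.base.tree.num_root]
    omega
  · rintro j k σ' hb hf ⟨e6, hk, M', hM', hC⟩ hj1 hj
    have hS' := hS₁.frame hf (by decide) (by decide)
    have h22 : σ'.reg 22 = σ.reg 22 := hf.reg 22 (by decide)
    have h21 : σ'.arr 21 = σ.arr 21 := hf.arr 21 (by decide)
    obtain ⟨c, hc, hq, hnum⟩ := hS'.base.tree.queue j (by omega)
    have hcs : c ≠ s := by
      rintro rfl
      have := hS'.base.tree.num_root
      omega
    obtain ⟨e, he1, he2⟩ := hS'.base.tree.edge c hc hcs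
    have hee := e.2
    refine Run.seq (Run.of_ok hB1 hb (by simp [Prog.Ok, Expr.Ok]) fun l₁ hl₁ => ?_)
    simp only [Prog.time, Expr.cost] at hl₁
    simp only [Prog.eval, Expr.val, e6, hq]
    have hcB : I.vx c < B := by have := vx_lt (I := I) c; omega
    have hb₂ : (σ'.setReg 27 (I.vx c)).Bdd B := hb.setReg _ hcB
    have hC₂ : Clauses (I.m + I.n) M' (fun τ => Φ τ ∧ ∀ c ∈ T.verts, T.num c < j → c ≠ s →
      T.Sub c t → c ∉ A → s(c, T.par c) ∈ I.edgesOf τ) (σ'.setReg 27 (I.vx c)) :=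
      hC.congr (by simp) (fun _ _ _ => rfl) fun _ => Iff.rfl
    have hsucc : ∀ (Ψ : V → Prop), (∀ d ∈ T.verts, T.num d < j + 1 → Ψ d) ↔
        (∀ d ∈ T.verts, T.num d < j → Ψ d) ∧ Ψ c := by
      intro Ψ
      constructor
      · exact fun h => ⟨fun d hd hn => h d hd (by omega), h c hc (by omega)⟩
      · rintro ⟨h1, h2⟩ d hd hn
        by_cases hdc : d = c
        · rw [hdc]; exact h2
        · have : T.num d ≠ j := fun h => hdc (T.num_inj hd hc (h.trans hnum.symm))
          exact h1 d hd (by omega)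
    have fin : ∀ l σ'', σ''.Bdd B → σ''.reg 6 = j → l ≤ 150 → (∃ M' ≤ M + 2 * (j + 1),
        Clauses (I.m + I.n) M' (fun τ => Φ τ ∧ ∀ c ∈ T.verts, T.num c < j + 1 → c ≠ s →
          T.Sub c t → c ∉ A → s(c, T.par c) ∈ I.edgesOf τ) σ'') →
        Run B (set 6 (bin .add (reg 6) (const 1))) σ'' fun l' σ₃ => σ₃.reg 6 = j + 1 ∧
          k + (l₁ + (l + l') + 4) ≤ 200 * (j + 1) ∧ ∃ M' ≤ M + 2 * (j + 1),
        Clauses (I.m + I.n) M' (fun τ => Φ τ ∧ ∀ c ∈ T.verts, T.num c < j + 1 → c ≠ s →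
          T.Sub c t → c ∉ A → s(c, T.par c) ∈ I.edgesOf τ) σ₃ := by
      rintro l σ'' hb'' h6'' hl ⟨M₃, hM₃, hC₃⟩
      refine Run.of_ok hB1 hb'' (by simp [Prog.Ok, Expr.Ok, Expr.val, h6'']; omega)
        fun l' hl' => ⟨?_, ?_, M₃, hM₃, hC₃.congr (by simp [Prog.eval]) (fun _ _ _ => rfl)
          fun _ => Iff.rfl⟩
      · simp [Prog.eval, Expr.val, Op.eval, h6'']
      · simp only [Prog.time, Expr.cost] at hl'
        omega
    refine Run.seq (Run.cond hB1 hb₂ (by simp [Expr.Ok]) (fun hp => ?_) fun hp => ?_)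
    · simp only [Expr.val, Op.eval, State.setReg_reg, State.setReg_arr, if_true, h21] at hp
      have h16 : T.Sub c t := by
        rw [← hS'.path.ne_zero]
        intro h0
        simp [h0] at hp
      have hcA : c ∉ A := by
        intro hcA
        simp [hA c hcA, hS'.path.pos c h16] at hp
      have h5 := hS'.base.input.r5
      refine (imp_run (a := e + (I.m + I.n)) (b := e) hB1 hb₂ hC₂ (by omega) ?_ ?_ ?_ ?_ ?_
        (by omega) (by omega)).mono_frame hb₂ ?_
      · simp [Prog.Ok, Expr.Ok, treeEdge, Prog.eval, Expr.val, Op.eval, h5, he1]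
        omega
      · simp [treeEdge, Prog.eval, Expr.val, Op.eval, he1, h5]
      · simp [treeEdge, Prog.eval, Expr.val, he1]
      · simp [treeEdge, Prog.eval, Expr.val, he1, neg_add_self]
      · rw [neg_of_lt (by omega)]
        simp [treeEdge, Prog.eval, Expr.val, Op.eval, he1, h5]
      rintro l σ'' ⟨hl, hC''⟩ hb'' hf''
      obtain ⟨fr, fa⟩ := imp_frame hf''
      refine fin _ _ hb'' ?_ ?_ ⟨M' + 2, by omega, hC''.congr rfl (fun _ _ _ => rfl) fun τ => ?_⟩
      · rw [fr _ (by omega)]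
        simpa using e6
      · simp only [Expr.cost, treeEdge] at hl ⊢
        omega
      · rw [hsucc, lit_edge, lit_not_edge, he2, and_assoc]
        tauto
    · refine Run.of_ok hB1 hb₂ trivial fun l hl => fin _ _ hb₂ (by simpa [Prog.eval] using e6) ?_
        ⟨M', by omega, hC₂.congr rfl (fun _ _ _ => rfl) fun τ => ?_⟩
      · simp only [Prog.time, Expr.cost] at hl ⊢
        omega
      · rw [hsucc]
        have : T.Sub c t → c ∈ A := by
          intro hct
          by_contra hcA
          simp [Expr.val, Op.eval, h21, hA' c hcA, hS'.path.pos c hct] at hp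
        tauto
  · rintro k σ' ⟨l, rfl, -, hl, M', hM', hC⟩
    refine ⟨by omega, M', by omega, hC.congr rfl (fun _ _ _ => rfl) fun τ => ?_⟩
    exact ⟨fun h => ⟨h.1, fun c hc => h.2 c hc (hlt c hc)⟩, fun h => ⟨h.1, fun c hc _ => h.2 c hc⟩⟩

/-- Add the clauses that the tail of an edge of the path is on the path. -/
def tails : Prog :=
  set 6 (const 0) ⨟
  loop (bin .lt (reg 6) (reg 1))
    (imp (reg 6) (bin .add (reg 1) (get 20 (reg 6))) (bin .add (reg 6) (reg 5))
       (bin .add (bin .add (reg 1) (get 20 (reg 6))) (reg 5)) ⨟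
     set 6 (bin .add (reg 6) (const 1)))

theorem tails_run {σ : State} {tl : Fin I.m → V} (hB : 2 * I.m + 2 * I.n + 2 < B)
    (hMB : M + 2 * I.m + 2 < B) (hσ : σ.Bdd B) (hS : Setup I T t anc σ)
    (htl : ∀ i : Fin I.m, σ.arr 20 i = I.vx (tl i)) (h : Clauses (I.m + I.n) M Φ σ) :
    Run B tails σ fun k σ' => k ≤ 200 * I.m + 20 ∧
      Clauses (I.m + I.n) (M + 2 * I.m) (fun τ => Φ τ ∧ ∀ i : Fin I.m,
        (I.edge i : Sym2 V) ∈ I.edgesOf τ → tl i ∈ I.vertsOf τ) σ' := by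
  have hB1 : 1 < B := by omega
  refine Run.seq (Run.of_ok hB1 hσ (by simp [Prog.Ok, Expr.Ok]; omega) fun k₁ hk₁ => ?_)
  simp only [Prog.time, Expr.cost] at hk₁
  simp only [Prog.eval, Expr.val]
  have hb₁ : (σ.setReg 6 0).Bdd B := hσ.setReg _ (by omega)
  have hS₁ : Setup I T t anc (σ.setReg 6 0) := hS.congr
    (fun x hx => by rw [State.setReg_reg, if_neg (by omega)]) (by simp) fun _ _ _ => rfl
  refine (Run.for hB1 hb₁ (fun j k σ' => σ'.reg 6 = j ∧ k ≤ 200 * j ∧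
    Clauses (I.m + I.n) (M + 2 * j) (fun τ => Φ τ ∧ ∀ i : Fin I.m, i < j →
      (I.edge i : Sym2 V) ∈ I.edgesOf τ → tl i ∈ I.vertsOf τ) σ') 0 I.m (fun i k σ' h => h.1)
    hS₁.base.input.r1 (by decide) (by omega) ⟨by simp, by omega, ?_⟩ ?_).mono ?_
  · exact h.congr (by simp) (fun _ _ _ => rfl) (by simp)
  · rintro j k σ' hb hf ⟨e6, hk, hC⟩ - hj
    have hS' := hS₁.frame hf (by decide) (by decide)
    have h20 : σ'.arr 20 = σ.arr 20 := hf.arr 20 (by decide)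
    have htj : σ'.arr 20 j = I.vx (tl ⟨j, hj⟩) := by rw [h20]; exact htl ⟨j, hj⟩
    have hv := vx_lt (I := I) (tl ⟨j, hj⟩)
    have h5 := hS'.base.input.r5
    have h1 := hS'.base.input.r1
    refine Run.seq ((imp_run (a := j) (b := I.m + I.vx (tl ⟨j, hj⟩)) hB1 hb hC (by omega) ?_ ?_ ?_
      ?_ ?_ (by omega) (by omega)).mono_frame hb ?_)
    · simp [Prog.Ok, Expr.Ok, Prog.eval, Expr.val, Op.eval, h5, h1, e6, htj]
      omega
    · simp [Prog.eval, Expr.val, e6]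
    · simp [Prog.eval, Expr.val, Op.eval, e6, h1, htj]
    · rw [neg_of_lt (by omega)]
      simp [Prog.eval, Expr.val, Op.eval, e6, h5]
    · rw [neg_of_lt (by omega)]
      simp [Prog.eval, Expr.val, Op.eval, e6, h1, h5, htj]
    rintro l σ'' ⟨hl, hC''⟩ hb'' hf''
    obtain ⟨fr, fa⟩ := imp_frame hf''
    have h6'' : σ''.reg 6 = j := by rw [fr _ (by omega), e6]
    refine Run.of_ok hB1 hb'' (by simp [Prog.Ok, Expr.Ok, Expr.val, h6'']; omega)
      fun l' hl' => ⟨?_, ?_, hC''.congr (by simp [Prog.eval]) (fun _ _ _ => rfl) fun τ => ?_⟩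
    · simp [Prog.eval, Expr.val, Op.eval, h6'']
    · simp only [Prog.time, Expr.cost] at hl hl'
      omega
    · have hle : lit (I.m + I.n) τ j ↔ (I.edge ⟨j, hj⟩ : Sym2 V) ∈ I.edgesOf τ :=
        lit_edge (i := ⟨j, hj⟩)
      rw [hle, lit_vert, and_assoc]
      refine and_congr_right fun _ => ?_
      have := lt_succ_iff_fin (I := I) ⟨j, hj⟩
      simp only at this
      simp only [this, or_imp, forall_and, forall_eq]
      tauto
  · rintro k σ' ⟨l, rfl, -, hl, hC⟩
    exact ⟨by omega, hC.congr rfl (fun _ _ _ => rfl) (by simp)⟩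

/-- Add the clauses for the deletions. -/
def deletions : Prog :=
  set 6 (const 0) ⨟
  loop (bin .lt (reg 6) (reg 2))
    ((set 27 (get 2 (reg 6)) ⨟ set 28 (get 3 (reg 6)) ⨟ set 29 (get 20 (reg 28))) ⨟
     cond (bin .add (bin .lt (get 17 (reg 27)) (get 17 (reg 29)))
         (bin .sub (bin .eq (get 17 (reg 27)) (get 17 (reg 29)))
           (bin .lt (get 18 (reg 29)) (get 18 (reg 27)))))
       (imp (reg 28) (bin .add (bin .add (reg 1) (reg 27)) (reg 5)) (bin .add (reg 28) (reg 5))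
         (bin .add (reg 1) (reg 27))) skip ⨟
     set 6 (bin .add (reg 6) (const 1)))

/-- The test in the program is the lexicographic comparison of keys: the sum is nonzero if the first
components are in strict order, or if they are equal and the truncated difference is not cancelled
by a strict reversal of the ranks. -/
theorem deletions_run {σ : State} {tl : Fin I.m → V} {rank : V → ℕ}
    (hB : 2 * I.m + 2 * I.n + I.k + 2 < B)
    (hMB : M + 2 * I.k + 2 < B) (hσ : σ.Bdd B) (hS : Setup I T t anc σ)
    (htl : ∀ i : Fin I.m, σ.arr 20 i = I.vx (tl i)) (hr : ∀ v, σ.arr 18 (I.vx v) = rank v)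
    (h : Clauses (I.m + I.n) M Φ σ) :
    Run B deletions σ fun k σ' => k ≤ 200 * I.k + 20 ∧ ∃ M' ≤ M + 2 * I.k,
      Clauses (I.m + I.n) M' (fun τ => Φ τ ∧ ∀ j : Fin I.k,
        toLex (anc (I.delVertex j), rank (I.delVertex j)) ≤
          toLex (anc (tl (I.delEdge j)), rank (tl (I.delEdge j))) →
        (I.edge (I.delEdge j) : Sym2 V) ∈ I.edgesOf τ → I.delVertex j ∉ I.vertsOf τ) σ' := by
  have hB1 : 1 < B := by omega
  refine Run.seq (Run.of_ok hB1 hσ (by simp [Prog.Ok, Expr.Ok]; omega) fun k₁ hk₁ => ?_)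
  simp only [Prog.time, Expr.cost] at hk₁
  simp only [Prog.eval, Expr.val]
  have hb₁ : (σ.setReg 6 0).Bdd B := hσ.setReg _ (by omega)
  have hS₁ : Setup I T t anc (σ.setReg 6 0) := hS.congr
    (fun x hx => by rw [State.setReg_reg, if_neg (by omega)]) (by simp) fun _ _ _ => rfl
  let Ψ (τ : ℕ → Prop) (j : Fin I.k) : Prop :=
    toLex (anc (I.delVertex j), rank (I.delVertex j)) ≤
      toLex (anc (tl (I.delEdge j)), rank (tl (I.delEdge j))) →
    (I.edge (I.delEdge j) : Sym2 V) ∈ I.edgesOf τ → I.delVertex j ∉ I.vertsOf τ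
  refine (Run.for hB1 hb₁ (fun j k σ' => σ'.reg 6 = j ∧ k ≤ 200 * j ∧ ∃ M' ≤ M + 2 * j,
    Clauses (I.m + I.n) M' (fun τ => Φ τ ∧ ∀ i : Fin I.k, i < j → Ψ τ i) σ') 0 I.k
    (fun i k σ' h => h.1)
    hS₁.base.input.r2 (by decide) (by omega) ⟨by simp, by omega, M, by omega, ?_⟩ ?_).mono ?_
  · exact h.congr (by simp) (fun _ _ _ => rfl) (by simp)
  · rintro j k σ' hb hf ⟨e6, hk, M', hM', hC⟩ - hj
    have hS' := hS₁.frame hf (by decide) (by decide)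
    have h20 : σ'.arr 20 = σ.arr 20 := hf.arr 20 (by decide)
    have h18 : σ'.arr 18 = σ.arr 18 := hf.arr 18 (by decide)
    have hsucc : ∀ τ, (∀ i : Fin I.k, i < j + 1 → Ψ τ i) ↔
        (∀ i : Fin I.k, i < j → Ψ τ i) ∧ Ψ τ ⟨j, hj⟩ := by
      intro τ
      constructor
      · exact fun h => ⟨fun d hn => h d (by omega), h ⟨j, hj⟩ (by simp)⟩
      · rintro ⟨h1, h2⟩ d hn
        by_cases hdc : d = ⟨j, hj⟩
        · rw [hdc]; exact h2
        · have : (d : ℕ) ≠ j := fun h => hdc (Fin.ext h)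
          exact h1 d (by omega)
    have h2 : σ'.arr 2 j = I.vx (I.delVertex ⟨j, hj⟩) := hS'.base.input.a2 ⟨j, hj⟩
    have h3 : σ'.arr 3 j = I.delEdge ⟨j, hj⟩ := hS'.base.input.a3 ⟨j, hj⟩
    have h20' : σ'.arr 20 (I.delEdge ⟨j, hj⟩) = I.vx (tl (I.delEdge ⟨j, hj⟩)) := by rw [h20, htl]
    have hΨ : ∀ τ, Ψ τ ⟨j, hj⟩ ↔
      (toLex (anc (I.delVertex ⟨j, hj⟩), rank (I.delVertex ⟨j, hj⟩)) ≤
        toLex (anc (tl (I.delEdge ⟨j, hj⟩)), rank (tl (I.delEdge ⟨j, hj⟩))) →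
      (I.edge (I.delEdge ⟨j, hj⟩) : Sym2 V) ∈ I.edgesOf τ →
        I.delVertex ⟨j, hj⟩ ∉ I.vertsOf τ) := fun τ => Iff.rfl
    generalize I.delVertex ⟨j, hj⟩ = v at *
    generalize I.delEdge ⟨j, hj⟩ = e at *
    have hv := vx_lt (I := I) v
    have hee := e.2
    have h5 := hS'.base.input.r5
    have h1 := hS'.base.input.r1
    have fin : ∀ l₁ l σ'', l₁ ≤ 20 → σ''.Bdd B → σ''.reg 6 = j → l ≤ 120 →
        (∃ M' ≤ M + 2 * (j + 1), Clauses (I.m + I.n) M'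
          (fun τ => Φ τ ∧ ∀ i : Fin I.k, i < j + 1 → Ψ τ i) σ'') →
        Run B (set 6 (bin .add (reg 6) (const 1))) σ'' fun l' σ₃ => σ₃.reg 6 = j + 1 ∧
          k + (l₁ + (l + l') + 4) ≤ 200 * (j + 1) ∧ ∃ M' ≤ M + 2 * (j + 1),
        Clauses (I.m + I.n) M' (fun τ => Φ τ ∧ ∀ i : Fin I.k, i < j + 1 → Ψ τ i) σ₃ := by
      rintro l₁ l σ'' hl₁ hb'' h6'' hl ⟨M₃, hM₃, hC₃⟩
      refine Run.of_ok hB1 hb'' (by simp [Prog.Ok, Expr.Ok, Expr.val, h6'']; omega)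
        fun l' hl' => ⟨?_, ?_, M₃, hM₃, hC₃.congr (by simp [Prog.eval]) (fun _ _ _ => rfl)
          fun _ => Iff.rfl⟩
      · simp [Prog.eval, Expr.val, Op.eval, h6'']
      · simp only [Prog.time, Expr.cost] at hl'
        omega
    refine Run.seq (Run.mono_frame (Q := fun l σ'' => l ≤ 20 ∧ σ''.reg 27 = I.vx v ∧
      σ''.reg 28 = e ∧ σ''.reg 29 = I.vx (tl e)) hb
      (Run.of_ok hB1 hb (by simp [Prog.Ok, Expr.Ok]) fun l hl => ⟨?_, ?_, ?_, ?_⟩) ?_)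
    · simp only [Prog.time, Expr.cost] at hl
      omega
    · simp [Prog.eval, Expr.val, e6, h2]
    · simp [Prog.eval, Expr.val, e6, h3]
    · simp [Prog.eval, Expr.val, e6, h3, h20']
    rintro l₁ σ₂ ⟨hl₁, e27, e28, e29⟩ hb₂ hf₂
    have hS₂ := hS'.frame hf₂ (by decide) (by decide)
    have e6₂ : σ₂.reg 6 = j := by rw [hf₂.reg 6 (by decide), e6]
    have hC₂ := hC.congr (hf₂.reg 11 (by decide)) (fun a _ _ => hf₂.arr a (by simp [warrs]))
      fun _ => Iff.rfl
    have hr₂ : ∀ v, σ₂.arr 18 (I.vx v) = rank v := by rw [hf₂.arr 18 (by decide), h18]; exact hr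
    have h5 := hS₂.base.input.r5
    have h1 := hS₂.base.input.r1
    refine Run.seq (Run.cond hB1 hb₂ ?_ (fun hp => ?_) fun hp => ?_)
    · have l1 : ∀ x y, Op.lt.eval x y ≤ 1 := fun x y => by simp only [Op.eval]; split_ifs <;> omega
      have l2 : ∀ x y, Op.eq.eval x y ≤ 1 := fun x y => by simp only [Op.eval]; split_ifs <;> omega
      simp only [Expr.Ok, and_true, true_and]
      exact lt_of_le_of_lt (add_le_add (l1 _ _) ((Nat.sub_le _ _).trans (l2 _ _))) (by omega)
    · have hle : toLex (anc v, rank v) ≤ toLex (anc (tl e), rank (tl e)) := by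
        rw [Prod.Lex.toLex_le_toLex]
        by_contra hne
        simp only [Expr.val, Op.eval, e27, e29, hS₂.anc_eq, hr₂] at hp
        split_ifs at hp <;> simp at hp hne <;> omega
      refine (imp_run (a := e) (b := I.m + I.vx v + (I.m + I.n)) hB1 hb₂ hC₂ (by omega) ?_ ?_ ?_
        ?_ ?_ (by omega) (by omega)).mono_frame hb₂ ?_
      · simp [Prog.Ok, Expr.Ok, Prog.eval, Expr.val, Op.eval, h5, h1, e27, e28]
        omega
      · simp [Prog.eval, Expr.val, e28]
      · simp [Prog.eval, Expr.val, Op.eval, e27, h1, h5]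
      · rw [neg_of_lt (by omega)]
        simp [Prog.eval, Expr.val, Op.eval, e28, h5]
      · simp [Prog.eval, Expr.val, Op.eval, e27, h1, neg_add_self]
      rintro l σ'' ⟨hl, hC''⟩ hb'' hf''
      obtain ⟨fr, fa⟩ := imp_frame hf''
      refine fin _ _ _ hl₁ hb'' (by rw [fr _ (by omega), e6₂]) ?_
        ⟨M' + 2, by omega, hC''.congr rfl (fun _ _ _ => rfl) fun τ => ?_⟩
      · simp only [Expr.cost] at hl ⊢
        omega
      · rw [hsucc, lit_edge, lit_not_vert, hΨ, and_assoc]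
        tauto
    · refine Run.of_ok hB1 hb₂ trivial fun l hl => fin _ _ _ hl₁ hb₂ e6₂ ?_
        ⟨M', by omega, hC₂.congr rfl (fun _ _ _ => rfl) fun τ => ?_⟩
      · simp only [Prog.time, Expr.cost] at hl ⊢
        omega
      · rw [hsucc, hΨ]
        have : ¬ toLex (anc v, rank v) ≤ toLex (anc (tl e), rank (tl e)) := by
          rw [Prod.Lex.toLex_le_toLex]
          intro hne
          simp only [Expr.val, Op.eval, e27, e29, hS₂.anc_eq, hr₂] at hp
          split_ifs at hp <;> simp at hp hne <;> omega
        tauto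
  · rintro k σ' ⟨l, rfl, -, hl, M', hM', hC⟩
    exact ⟨by omega, M', by omega, hC.congr rfl (fun _ _ _ => rfl) (by simp [Ψ])⟩

end SelfDeletingGraph.Presentation

/-! ### Correctness of the clauses -/

namespace SearchTree

/-- The constraints speak of edges of the graph only, while a set `z` may contain other pairs, which
an assignment cannot encode. -/
theorem IsFlow.congr {V : Type*} {G : SimpleGraph V} {s t : V} {T : SearchTree G s}
    {z z' : Set (Sym2 V)} (h : IsFlow T t z) (hz : ∀ e ∈ G.edgeSet, e ∈ z' ↔ e ∈ z) :
    IsFlow T t z' := by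
  have hp : ∀ c ∈ T.verts, c ≠ s → (s(c, T.par c) ∈ z' ↔ s(c, T.par c) ∈ z) := fun c hc hs =>
    hz _ (T.adj c hc hs).symm
  have hn : ∀ u w, T.NonTree u w → (s(u, w) ∈ z' ↔ s(u, w) ∈ z) := fun u w h => hz _ h.1
  refine ⟨fun c hc hs ht u w h1 h2 h3 => ?_, fun c hc hs ht h1 => ?_,
    fun c hc hs ht u w h1 h2 h3 => ?_⟩
  · rw [hp c hc hs, hn u w h1]
    exact h.xor c hc hs ht u w h1 h2 h3
  · rw [hp c hc hs]
    exact h.bridge c hc hs ht h1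
  · rw [hp c hc hs, hn u w h1]
    exact h.side c hc hs ht u w h1 h2 h3

end SearchTree

namespace SelfDeletingGraph.Presentation

open Ram Ram.Expr Ram.Prog SearchTree

variable {V : Type*} {S : SelfDeletingGraph V} {I : S.Presentation} {s t : V}
  {T : SearchTree S.graph s} {B : ℕ} {anc : V → ℕ}

theorem hi_lo_eq {i : Fin I.m} {u w : V} (hi : (I.edge i : Sym2 V) = s(u, w))
    (h : anc w < anc u) : I.hi anc i = u ∧ I.lo anc i = w := by
  rw [I.edge_eq] at hi
  rcases Sym2.eq_iff.1 hi with ⟨rfl, rfl⟩ | ⟨rfl, rfl⟩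
  · rw [Presentation.hi, lo, if_neg (by omega), if_neg (by omega)]
    exact ⟨rfl, rfl⟩
  · rw [Presentation.hi, lo, if_pos h, if_pos h]
    exact ⟨rfl, rfl⟩

theorem anc_lo_le (anc : V → ℕ) (i : Fin I.m) : anc (I.lo anc i) ≤ anc (I.hi anc i) := by
  rw [Presentation.hi, lo]
  split_ifs <;> omega

theorem mem_coverPairs_iff {i : Fin I.m} {c : V} : (i, c) ∈ I.coverPairs T anc I.m ↔
    ∃ u w, (I.edge i : Sym2 V) = s(u, w) ∧ T.NonTree u w ∧ T.Sub c u ∧ ¬ T.Sub c w := by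
  constructor
  · rintro ⟨-, h, ⟨h1, h2⟩ | ⟨h1, h2⟩⟩
    · exact ⟨_, _, edge_hi_lo anc i, h, h1, h2⟩
    · exact ⟨_, _, (edge_hi_lo anc i).trans Sym2.eq_swap, h.symm, h1, h2⟩
  · rintro ⟨u, w, h1, h2, h3, h4⟩
    refine ⟨i.2, ?_⟩
    rw [edge_hi_lo anc] at h1
    simp only
    rcases Sym2.eq_iff.1 h1 with ⟨h5, h6⟩ | ⟨h5, h6⟩
    · rw [h5, h6]
      exact ⟨h2, Or.inl ⟨h3, h4⟩⟩
    · rw [h5, h6]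
      exact ⟨h2.symm, Or.inr ⟨h3, h4⟩⟩

/-- The arrays `17`, `18` and `20` contain all keys and tails. Ranks are `n - num` for turned
vertices and `n + num` for the others, so a turned vertex precedes its parent and any other one
follows it, whether or not the parent is turned. -/
theorem exists_pathKeys {σ : State} (hG : S.graph.IsCactus)
    (hS : Setup I T t anc σ) (ha : ∀ v, T.Sub v t → anc v = T.num v)
    (ha' : ∀ v ∈ T.verts, v ≠ s → ¬ T.Sub v t → anc v = anc (T.par v))
    (h : CoverRep I T t (I.lo anc) (I.coverPairs T anc I.m) (I.upVerts T t anc I.m)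
      (I.nonTreeEdges T anc I.m) σ) :
    ∃ K : PathKeys T t, K.anc = anc ∧ (∀ v, σ.arr 18 (I.vx v) = K.rank v) ∧
      ∀ i : Fin I.m, σ.arr 20 i = I.vx (K.tail (I.edge i)) := by
  classical
  have hn : ∀ v ∈ T.verts, T.num v < I.n := fun v hv =>
    (hS.base.tree.num_lt v hv).trans_le hS.base.tree.qt_le
  choose tl htl using fun i : ℕ => exists_vx (I := I) (h.tail_lt i)
  -- The value `s` for pairs that are not edges is immaterial.
  let tail (e : Sym2 V) : V := if he : e ∈ S.graph.edgeSet then tl (I.edge.symm ⟨e, he⟩) else s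
  have htail : ∀ i : Fin I.m, tail (I.edge i) = tl i := fun i => by
    simp [tail]
  have hedge : ∀ e ∈ S.graph.edgeSet, ∀ v, (∀ i : Fin I.m, (I.edge i : Sym2 V) = e →
      σ.arr 20 i = I.vx v) → tail e = v := by
    intro e he v hv
    have h1 := hv (I.edge.symm ⟨e, he⟩) (by simp)
    rw [← htl, vx_inj] at h1
    simp only [tail, dif_pos he, h1]
  have hpar : ∀ c ∈ T.verts, c ≠ s → s(c, T.par c) ∈ S.graph.edgeSet := fun c hc hs =>
    (T.adj c hc hs).symm
  refine ⟨⟨anc, fun c => c ∈ I.upVerts T t anc I.m, tail, fun v => σ.arr 18 (I.vx v), ha, ha',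
    ?_, ?_, ?_, ?_, ?_, ?_, ?_, ?_⟩, rfl, fun v => rfl, fun i => ?_⟩
  · intro c hc hs hct u w hN hlt hu hw
    obtain ⟨i, hi⟩ := exists_edge (I := I) hN.1
    obtain ⟨h1, h2⟩ := hi_lo_eq hi hlt
    exact ⟨hct, i, i.2, by rw [h1, h2]; exact ⟨hN, hu, hw⟩⟩
  -- A turned vertex lies above the later end of an edge `i`. By uniqueness of the covering edge,
  -- `i` would be the present edge with its ends exchanged, against the order of `anc`.
  · rintro c hc hs hct u w hN hlt hu hw ⟨-, i, -, hN', h1, h2⟩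
    obtain ⟨e1, e2⟩ := cover_unique hG hc hs hN' h1 h2 hN.symm hw hu
    have := anc_lo_le anc i
    rw [e1, e2] at this
    omega
  · exact fun c hc hs hct => hedge _ (hpar c hc hs) _ (h.tail_not_up c hc hs fun h => h.1 hct)
  · exact fun c hc hs hct hup => hedge _ (hpar c hc hs) _ (h.tail_up c hc hs hup)
  · exact fun c hc hs hct hup => hedge _ (hpar c hc hs) _ (h.tail_not_up c hc hs hup)
  · intro u w hN hlt
    refine hedge _ hN.1 _ fun i hi => ?_
    obtain ⟨h1, h2⟩ := hi_lo_eq hi hlt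
    rw [← h2]
    exact (h.tail_lo i ⟨i.2, by rw [h1, h2]; exact hN⟩).2
  · intro c hc hs hct hup
    have h1 := T.num_par c hc hs
    have h2 := hn c hc
    rw [h.rank_up c hc hup]
    by_cases hp : T.par c ∈ I.upVerts T t anc I.m
    · rw [h.rank_up _ (T.par_mem c hc hs) hp]
      omega
    · rw [h.rank_not_up _ (T.par_mem c hc hs) hp]
      omega
  · intro c hc hs hct hup
    have h1 := T.num_par c hc hs
    rw [h.rank_not_up c hc hup]
    by_cases hp : T.par c ∈ I.upVerts T t anc I.m
    · rw [h.rank_up _ (T.par_mem c hc hs) hp]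
      omega
    · rw [h.rank_not_up _ (T.par_mem c hc hs) hp]
      omega
  · rw [← htl, vx_inj]
    exact (htail i).symm

/-- The vertices in no cover pair are exactly those whose tree edge is a bridge, and the two halves
of `CoverClause` are `xor` and `side`. -/
theorem isFlow_iff {τ : ℕ → Prop} :
    ((∀ p ∈ I.coverPairs T anc I.m, CoverClause I T t p.1 p.2 τ) ∧
      ∀ c ∈ T.verts, c ≠ s → T.Sub c t → c ∉ {c | ∃ i, (i, c) ∈ I.coverPairs T anc I.m} →
        s(c, T.par c) ∈ I.edgesOf τ) ↔ IsFlow T t (I.edgesOf τ) := by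
  constructor
  · rintro ⟨h1, h2⟩
    refine ⟨fun c hc hs ht u w hN hu hw => ?_, fun c hc hs ht h => h2 c hc hs ht ?_,
      fun c hc hs ht u w hN hu hw => ?_⟩
    · obtain ⟨i, hi⟩ := exists_edge (I := I) hN.1
      rw [← hi]
      exact (h1 (i, c) (mem_coverPairs_iff.2 ⟨u, w, hi, hN, hu, hw⟩)).1 ht
    · rintro ⟨i, hi⟩
      obtain ⟨u, w, -, hN, hu, hw⟩ := mem_coverPairs_iff.1 hi
      exact hw (h u w hN hu)
    · obtain ⟨i, hi⟩ := exists_edge (I := I) hN.1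
      rw [← hi]
      exact (h1 (i, c) (mem_coverPairs_iff.2 ⟨u, w, hi, hN, hu, hw⟩)).2 ht
  · intro h
    refine ⟨?_, fun c hc hs ht hA => h.bridge c hc hs ht fun u w hN hu => ?_⟩
    · rintro ⟨i, c⟩ hp
      obtain ⟨u, w, hi, hN, hu, hw⟩ := mem_coverPairs_iff.1 hp
      have hc : c ∈ T.verts := hu.mem hN.mem_left
      have hs : c ≠ s := by
        rintro rfl
        exact hw (sub_root hN.mem_right)
      rw [CoverClause]
      simp only [hi]
      exact ⟨fun ht => h.xor c hc hs ht u w hN hu hw, fun ht => h.side c hc hs ht u w hN hu hw⟩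
    · by_contra hw
      obtain ⟨i, hi⟩ := exists_edge (I := I) hN.1
      exact hA ⟨i, mem_coverPairs_iff.2 ⟨u, w, hi, hN, hu, hw⟩⟩

theorem edge_delEdge (j : Fin I.k) : (I.edge (I.delEdge j) : Sym2 V) = (I.deletion j).2 := by
  simp [delEdge]

/-- The clauses describe the conforming paths. -/
theorem exists_assignment_iff (hG : S.graph.IsCactus) (ht : t ∈ T.verts) (K : PathKeys T t) :
    (∃ τ, IsFlow T t (I.edgesOf τ) ∧
      (∀ i : Fin I.m, (I.edge i : Sym2 V) ∈ I.edgesOf τ → K.tail (I.edge i) ∈ I.vertsOf τ) ∧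
      ∀ j : Fin I.k, K.key (I.delVertex j) ≤ K.key (K.tail (I.edge (I.delEdge j))) →
        (I.edge (I.delEdge j) : Sym2 V) ∈ I.edgesOf τ → I.delVertex j ∉ I.vertsOf τ) ↔
    S.HasConformingPath s t := by
  have := I.finite_vertex
  rw [hasConformingPath_iff K hG ht]
  constructor
  · rintro ⟨τ, h1, h2, h3⟩
    refine ⟨I.edgesOf τ, I.vertsOf τ, h1, fun e he => ?_, fun v e he => ?_⟩
    · have := h2 (I.edge.symm ⟨e, he⟩)
      simpa using this
    · obtain ⟨j, hj⟩ := I.deletion.surjective ⟨v, e, he⟩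
      have := h3 j
      rw [edge_delEdge, delVertex, hj] at this
      exact this
  · rintro ⟨z, y, h1, h2, h3⟩
    -- The two alternatives do not interfere, as edge variables are below `m` and vertex variables
    -- are not.
    let τ (x : ℕ) : Prop := (∃ i : Fin I.m, x = i ∧ (I.edge i : Sym2 V) ∈ z) ∨
      ∃ v, x = I.m + I.vx v ∧ v ∈ y
    have e1 : ∀ i : Fin I.m, (I.edge i : Sym2 V) ∈ I.edgesOf τ ↔ (I.edge i : Sym2 V) ∈ z := by
      intro i
      rw [edge_mem_edgesOf]
      constructor
      · rintro (⟨j, hj, hz⟩ | ⟨v, hv, -⟩)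
        · rwa [Fin.ext hj]
        · omega
      · exact fun hz => Or.inl ⟨i, rfl, hz⟩
    have e2 : ∀ v, v ∈ I.vertsOf τ ↔ v ∈ y := by
      intro v
      constructor
      · rintro (⟨j, hj, -⟩ | ⟨w, hw, hy⟩)
        · omega
        · rwa [vx_inj.1 (Nat.add_left_cancel hw)]
      · exact fun hy => Or.inr ⟨v, rfl, hy⟩
    refine ⟨τ, h1.congr fun e he => ?_, fun i => ?_, fun j => ?_⟩
    · have := e1 (I.edge.symm ⟨e, he⟩)
      simpa using this
    · rw [e1, e2]
      exact h2 _ (I.edge i).2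
    · rw [e1, e2, edge_delEdge]
      exact h3 _ _ (I.deletion j).2.2

end SelfDeletingGraph.Presentation

/-! ### The algorithm -/

namespace SelfDeletingGraph.Presentation

open Ram Ram.Expr Ram.Prog SearchTree

variable {V : Type*} {S : SelfDeletingGraph V} {I : S.Presentation} {s t : V}
  {T : SearchTree S.graph s} {B : ℕ} {anc : V → ℕ}

/-- Add the clauses and solve them. -/
def encode : Prog :=
  cover ⨟ bridges ⨟ tails ⨟ deletions ⨟ solve ⨟ set 0 (bin .eq (reg 15) (const 0))

/-- There are at most `6n + 2m + 2k` implications over `m + n` variables: four per covered vertex,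
two per bridge, two per edge and two per deletion. The bounds on words and on time follow from this
count. -/
theorem encode_run {σ : State} (hG : S.graph.IsCactus) (ht : t ∈ T.verts)
    (hB : 10 * (I.n + I.m + I.k) + 10 < B) (hσ : σ.Bdd B) (hS : Setup I T t anc σ)
    (ha : ∀ v, T.Sub v t → anc v = T.num v)
    (ha' : ∀ v ∈ T.verts, v ≠ s → ¬ T.Sub v t → anc v = anc (T.par v))
    (h18 : ∀ v ∈ T.verts, σ.arr 18 (I.vx v) = I.n + T.num v)
    (h20 : ∀ v ∈ T.verts, v ≠ s → ∀ i : Fin I.m, (I.edge i : Sym2 V) = s(v, T.par v) →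
      σ.arr 20 i = I.vx (T.par v)) (h20' : ∀ i, σ.arr 20 i < I.n)
    (hz : ∀ a, 21 ≤ a → ∀ i, σ.arr a i = 0) (h11 : σ.reg 11 = 0) :
    Run B encode σ fun k σ' => k ≤ 13000 * (I.n + I.m + I.k) + 2500 ∧
      (S.HasConformingPath s t → σ'.reg 0 = 1) ∧ (¬ S.HasConformingPath s t → σ'.reg 0 = 0) := by
  have hB1 : 1 < B := by omega
  have hC₀ : Clauses (I.m + I.n) 0 (fun _ => True) σ := by
    refine ⟨h11, ⟨⟨fun v => by simp [hz, ptr], by simp⟩, by simp⟩, ⟨by simp, by simp, by simp⟩, ?_⟩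
    simp [Sat]
  refine Run.seq ((cover_run hG (by omega) hσ hS h18 h20 h20' (hz 21 (by omega)) hC₀).mono_frame
    hσ ?_)
  rintro k₁ σ₁ ⟨hk₁, hR⟩ hb₁ hf₁
  have hS₁ := hS.frame hf₁ (by decide) (by decide)
  obtain ⟨K, hK, hrank, htail⟩ := exists_pathKeys hG hS₁ ha ha' hR
  obtain ⟨M₁, hM₁, hC₁⟩ := hR.clauses
  have hle := I.ncard_le (Prod.snd '' I.coverPairs T anc I.m)
  refine Run.seq ((bridges_run (A := {c | ∃ i, (i, c) ∈ I.coverPairs T anc I.m}) (by omega)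
    (by omega) hb₁ hS₁ hR.cov_pos hR.cov_neg hC₁).mono_frame hb₁ ?_)
  rintro k₂ σ₂ ⟨hk₂, M₂, hM₂, hC₂⟩ hb₂ hf₂
  have hS₂ := hS₁.frame hf₂ (by decide) (by decide)
  have e20 : σ₂.arr 20 = σ₁.arr 20 := hf₂.arr 20 (by decide)
  refine Run.seq ((tails_run (tl := fun i => K.tail (I.edge i)) (by omega) (by omega) hb₂ hS₂
    (by rw [e20]; exact htail) hC₂).mono_frame hb₂ ?_)
  rintro k₃ σ₃ ⟨hk₃, hC₃⟩ hb₃ hf₃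
  have hS₃ := hS₂.frame hf₃ (by decide) (by decide)
  have f20 : σ₃.arr 20 = σ₁.arr 20 := (hf₃.arr 20 (by decide)).trans e20
  have f18 : σ₃.arr 18 = σ₁.arr 18 := (hf₃.arr 18 (by decide)).trans (hf₂.arr 18 (by decide))
  refine Run.seq ((deletions_run (tl := fun i => K.tail (I.edge i)) (rank := K.rank) (by omega)
    (by omega) hb₃ hS₃ (by rw [f20]; exact htail) (by rw [f18]; exact hrank) hC₃).mono_frame hb₃ ?_)
  rintro k₄ σ₄ ⟨hk₄, M₄, hM₄, hC₄⟩ hb₄ hf₄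
  have hS₄ := hS₃.frame hf₄ (by decide) (by decide)
  have hz' : ∀ a, 28 ≤ a → ∀ i, σ₄.arr a i = 0 := by
    have key : ∀ {P : Prog} {σ σ' : State}, Frame P σ σ' → (∀ b ∈ P.warrs, b < 28) → ∀ a, 28 ≤ a →
        σ'.arr a = σ.arr a := fun hf h a ha => hf.arr a fun h' => by have := h a h'; omega
    intro a ha
    rw [key hf₄ (by decide) a ha, key hf₃ (by decide) a ha, key hf₂ (by decide) a ha,
      key hf₁ (by decide) a ha]
    exact hz a (by omega)
  refine Run.seq ((solve_run hB1 hb₄ (by omega) hS₄.base.input.r5 hC₄.rep hC₄.skew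
    (hz' 50 (by omega)) (hz' 30 (by omega)) (hz' 40 (by omega))).mono_frame hb₄ ?_)
  rintro k₅ σ₅ ⟨h15, hk₅⟩ hb₅ -
  have hiff : σ₅.reg 15 = 0 ↔ S.HasConformingPath s t := by
    rw [h15, ← exists_assignment_iff (I := I) hG ht K]
    refine exists_congr fun τ => ?_
    rw [hC₄.sat, isFlow_iff, and_assoc]
    simp only [PathKeys.key, hK]
  refine Run.of_ok hB1 hb₅ (by simp [Prog.Ok, Expr.Ok]; omega) fun k₆ hk₆ => ⟨?_, ?_, ?_⟩
  · simp only [Prog.time, Expr.cost] at hk₆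
    omega
  · intro h
    simp [Prog.eval, Expr.val, Op.eval, hiff.2 h]
  · intro h
    simp [Prog.eval, Expr.val, Op.eval, mt hiff.1 h]

/-- The case that `t` is in the component of `s`. -/
def search : Prog := markPath ⨟ setKeys ⨟ setTree ⨟ encode

theorem search_run {σ : State} (hG : S.graph.IsCactus) (ht : t ∈ T.verts)
    (hB : 10 * (I.n + I.m + I.k) + 10 < B) (hσ : σ.Bdd B) (h : Base I T t σ)
    (hz : ∀ a, 16 ≤ a → ∀ i, σ.arr a i = 0) (h11 : σ.reg 11 = 0) :
    Run B search σ fun k σ' => k ≤ 13100 * (I.n + I.m + I.k) + 2600 ∧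
      (S.HasConformingPath s t → σ'.reg 0 = 1) ∧ (¬ S.HasConformingPath s t → σ'.reg 0 = 0) := by
  have hB1 : 1 < B := by omega
  refine Run.seq ((markPath_run hB1 hσ h ht (hz 16 (by omega))).mono_frame hσ ?_)
  rintro k₁ σ₁ ⟨hk₁, hP₁⟩ hb₁ hf₁
  have h₁ := h.frame hf₁ (by decide) (by decide)
  refine Run.seq ((setKeys_run (by omega) hb₁ h₁ ht hP₁).mono_frame hb₁ ?_)
  rintro k₂ σ₂ ⟨hk₂, hA₂, h18⟩ hb₂ hf₂
  have h₂ := h₁.frame hf₂ (by decide) (by decide)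
  have hz₂ : ∀ a, 19 ≤ a → ∀ i, σ₂.arr a i = 0 := by
    intro a ha
    rw [hf₂.arr a fun h' => by
        have := (by decide : ∀ b ∈ setKeys.warrs, b < 19) a h'; omega,
      hf₁.arr a fun h' => by have := (by decide : ∀ b ∈ markPath.warrs, b < 19) a h'; omega]
    exact hz a (by omega)
  refine Run.seq ((setTree_run (by omega) hb₂ h₂ (hz₂ 19 (by omega))
    (hz₂ 20 (by omega))).mono_frame hb₂ ?_)
  rintro k₃ σ₃ ⟨hk₃, h19, h20, h20'⟩ hb₃ hf₃
  have h₃ := h₂.frame hf₃ (by decide) (by decide)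
  have hn : ∀ v ∈ T.verts, T.num v < I.n := fun v hv =>
    (h.tree.num_lt v hv).trans_le h.tree.qt_le
  have e16 : σ₃.arr 16 = σ₁.arr 16 := (hf₃.arr 16 (by decide)).trans (hf₂.arr 16 (by decide))
  have e17 : σ₃.arr 17 = σ₂.arr 17 := hf₃.arr 17 (by decide)
  have e18 : σ₃.arr 18 = σ₂.arr 18 := hf₃.arr 18 (by decide)
  refine (encode_run (anc := fun v => σ₂.arr 17 (I.vx v)) hG ht hB hb₃
    ⟨h₃, hP₁.congr e16, fun v => by rw [e17], h19⟩ (fun v hv => ?_) (fun v hv => ?_) ?_ h20 h20'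
    ?_ ?_).mono ?_
  · exact hA₂.pos v (hv.mem ht) (hn v (hv.mem ht)) hv
  · exact hA₂.neg v hv (hn v hv)
  · rw [e18]; exact h18
  · intro a ha
    rw [hf₃.arr a fun h' => by have := (by decide : ∀ b ∈ setTree.warrs, b < 21) a h'; omega]
    exact hz₂ a (by omega)
  · rw [hf₃.reg 11 (by decide), hf₂.reg 11 (by decide), hf₁.reg 11 (by decide), h11]
  · rintro k σ' ⟨hk, h1⟩
    exact ⟨by omega, h1⟩

/-- The algorithm. -/
def algorithm : Prog :=
  (set 5 (bin .add (reg 1) (reg 0)) ⨟ set 12 (const 1)) ⨟ build ⨟ explore ⨟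
  cond (bin .eq (get 10 (reg 4)) (const 1)) search (set 0 (const 0))

theorem toArr_lt {l b : ℕ} {g : Fin l → ℕ} (hb : 0 < b) (h : ∀ i, g i < b) (i : ℕ) :
    toArr g i < b := by
  rw [toArr]
  split_ifs
  exacts [h _, hb]

theorem toArr_val {l : ℕ} (g : Fin l → ℕ) (i : Fin l) : toArr g i = g i := by
  simp [toArr]

theorem input_bdd (hB : I.n + I.m + I.k < B) : (I.input s t).Bdd B := by
  refine ⟨fun x => ?_, fun a i => ?_⟩
  · rcases x with _ | _ | _ | _ | _ | x
    · change I.n < B; omega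
    · change I.m < B; omega
    · change I.k < B; omega
    · have := (I.vertex s).2; change (I.vertex s : ℕ) < B; omega
    · have := (I.vertex t).2; change (I.vertex t : ℕ) < B; omega
    · change 0 < B; omega
  · rcases a with _ | _ | _ | _ | a
    · exact toArr_lt (b := B) (by omega) (fun j => (I.vertex _).2.trans_le (by omega)) i
    · exact toArr_lt (b := B) (by omega) (fun j => (I.vertex _).2.trans_le (by omega)) i
    · exact toArr_lt (b := B) (by omega) (fun j => (I.vertex _).2.trans_le (by omega)) i
    · exact toArr_lt (b := B) (g := fun i => I.delEdge i) (by omega)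
        (fun j => (I.delEdge j).2.trans_le (by omega)) i
    · change 0 < B; omega

theorem input_arr {a : ℕ} (ha : 4 ≤ a) (i : ℕ) : (I.input s t).arr a i = 0 := by
  rcases a with _ | _ | _ | _ | a
  all_goals first | omega | rfl

theorem size_eq [Fintype V] (I : S.Presentation) : S.size = I.n + I.m + I.k := by
  have h1 : Fintype.card V = I.n := by rw [← Nat.card_eq_fintype_card, I.card_vertex]
  have h2 : S.graph.edgeSet.ncard = I.m := by
    rw [← Nat.card_coe_set_eq, ← Nat.card_congr I.edge, Nat.card_eq_fintype_card, Fintype.card_fin]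
  have h3 : ∑ v, (S.del v).ncard = I.k := by
    have : Nat.card (Σ v : V, S.del v) = I.k := by
      rw [← Nat.card_congr I.deletion, Nat.card_eq_fintype_card, Fintype.card_fin]
    rw [← this, Nat.card_sigma]
    exact Finset.sum_congr rfl fun v _ => (Nat.card_coe_set_eq _).symm
  rw [size, h1, h2, h3]

/-- If the search does not mark `t`, the answer is no, because the vertices of a walk from `s` stay
in the closed set of the tree. -/
theorem algorithm_run (hG : S.graph.IsCactus) (hB : 10 * (I.n + I.m + I.k) + 10 < B) :
    Run B algorithm (I.input s t) fun k σ' => k ≤ 14000 * (I.n + I.m + I.k) + 4000 ∧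
      (S.HasConformingPath s t → σ'.reg 0 = 1) ∧ (¬ S.HasConformingPath s t → σ'.reg 0 = 0) := by
  have hB1 : 1 < B := by omega
  have hb₀ : (I.input s t).Bdd B := input_bdd (by omega)
  have z₀ : ∀ a, 4 ≤ a → ∀ i, (I.input s t).arr a i = 0 := fun a ha i => input_arr ha i
  have r₀ : ∀ x, 5 ≤ x → (I.input s t).reg x = 0 := by
    intro x hx
    rcases x with _ | _ | _ | _ | _ | x
    all_goals first | omega | rfl
  refine Run.seq (Run.mono_frame (Q := fun k σ' => k ≤ 10 ∧ I.Input s t σ' ∧ σ'.reg 12 = 1) hb₀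
    (Run.of_ok hB1 hb₀ ?_ fun k hk => ⟨?_, ?_, ?_⟩) ?_)
  · simp [Prog.Ok, Expr.Ok, Expr.val, input]
    omega
  · simp only [Prog.time, Expr.cost] at hk
    omega
  · simp only [Prog.eval, Expr.val, Op.eval]
    exact ⟨rfl, rfl, rfl, rfl, rfl, rfl, toArr_val fun i => I.vx (I.fst i),
      toArr_val fun i => I.vx (I.snd i), toArr_val fun i => I.vx (I.delVertex i),
      toArr_val fun i => I.delEdge i⟩
  · simp [Prog.eval, Expr.val]
  rintro k₁ σ₁ ⟨hk₁, hI₁, h12⟩ hb₁ hf₁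
  have z₁ : ∀ a, 4 ≤ a → ∀ i, σ₁.arr a i = 0 := fun a ha i => by
    rw [hf₁.arr a (by simp [warrs]), z₀ a ha]
  have r₁ : ∀ x, 5 < x → x ≠ 12 → σ₁.reg x = 0 := fun x hx hx' => by
    rw [hf₁.reg x (by simp [wregs]; omega), r₀ x (by omega)]
  refine Run.seq ((build_run (by omega) hb₁ hI₁ (r₁ 6 (by omega) (by omega))
    (r₁ 17 (by omega) (by omega)) ⟨⟨⟨fun v => by simp [z₁, ptr], by simp⟩, by simp⟩, by simp,
      by simp, by simp, by simp, by simp, by simp⟩).mono_frame hb₁ ?_)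
  rintro k₂ σ₂ ⟨hk₂, hA₂⟩ hb₂ hf₂
  have a₂ : ∀ a, a < 4 ∨ 16 ≤ a ∨ a = 10 → σ₂.arr a = σ₁.arr a := fun a ha => hf₂.arr a fun h' => by
    have := (by decide : ∀ b ∈ build.warrs, 4 ≤ b ∧ b < 16 ∧ b ≠ 10) a h'
    omega
  have hI₂ : I.Input s t σ₂ := hI₁.congr (fun x hx => hf₂.reg x fun h' => by
    have := (by decide : ∀ b ∈ build.wregs, 6 ≤ b) x h'
    omega) fun a ha => a₂ a (by omega)
  refine Run.seq ((explore_run (by omega) (by omega) hb₂ hI₂ hA₂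
    (by rw [hf₂.reg 12 (by decide), h12]) (by rw [a₂ _ (by omega)]; exact z₁ 60 (by omega))
    (by rw [a₂ _ (by omega)]; exact z₁ 10 (by omega))).mono_frame hb₂ ?_)
  rintro k₃ σ₃ ⟨hk₃, T, hT⟩ hb₃ hf₃
  have a₃ : ∀ a, a < 4 ∨ 16 ≤ a → σ₃.arr a = σ₂.arr a := fun a ha => hf₃.arr a fun h' => by
    have := (by decide : ∀ b ∈ explore.warrs, 4 ≤ b ∧ b < 16) a h'
    omega
  have hI₃ : I.Input s t σ₃ := hI₂.congr (fun x hx => hf₃.reg x fun h' => by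
    have := (by decide : ∀ b ∈ explore.wregs, 6 ≤ b) x h'
    omega) fun a ha => a₃ a (by omega)
  have hmark := hT.mark t
  refine Run.cond hB1 hb₃ (by simp [Expr.Ok, hB1]) (fun hp => ?_) fun hp => ?_
  · have ht : t ∈ T.verts := by
      rw [← hmark]
      by_contra hne
      simp [Expr.val, Op.eval, hI₃.r4, hne] at hp
    refine (search_run hG ht hB hb₃ ⟨hI₃, hT⟩ (fun a ha => ?_) ?_).mono ?_
    · rw [a₃ a (by omega), a₂ a (by omega)]
      exact z₁ a (by omega)
    · rw [hf₃.reg 11 (by decide), hf₂.reg 11 (by decide), r₁ 11 (by omega) (by omega)]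
    · rintro k σ' ⟨hk, h1⟩
      exact ⟨by simp only [Expr.cost]; omega, h1⟩
  · have ht : t ∉ T.verts := by
      intro ht
      simp [Expr.val, Op.eval, hI₃.r4, hmark.2 ht] at hp
    have hno : ¬ S.HasConformingPath s t := fun ⟨p, _⟩ =>
      ht (mem_of_mem_support p T.root_mem p.end_mem_support)
    refine Run.of_ok hB1 hb₃ (by simp [Prog.Ok, Expr.Ok]; omega) fun k hk =>
      ⟨?_, fun h => absurd h hno, fun _ => by simp [Prog.eval, Expr.val]⟩
    simp only [Prog.time, Expr.cost] at hk ⊢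
    omega

end SelfDeletingGraph.Presentation

/-- There are one program and one constant `C` such that on every instance whose graph is a cactus,
however it is presented, the program halts after at most `C * (|V| + |E| + |f|)` steps, using only
words below `C * (|V| + |E| + |f|)`, with the correct answer (`1` for yes, `0` for no) in
register `0`. -/
theorem mainTheorem8 :
    ∃ (P : Ram.Prog) (C : ℕ), ∀ (V : Type*) [Fintype V] (S : SelfDeletingGraph V),
      S.graph.IsCactus → ∀ (s t : V) (I : S.Presentation),
        ∃ (k : ℕ) (σ : Ram.State),
          Ram.Exec (C * S.size) P (I.input s t) k σ ∧
          k ≤ C * S.size ∧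
          (S.HasConformingPath s t → σ.reg 0 = 1) ∧
          (¬ S.HasConformingPath s t → σ.reg 0 = 0) := by
  refine ⟨SelfDeletingGraph.Presentation.algorithm, 20000, fun V _ S hG s t I => ?_⟩
  -- The vertex `s` makes the size positive, so the additive constants are absorbed into the factor
  -- `20000`.
  have hn : 0 < I.n := (I.vertex s).pos
  rw [I.size_eq]
  obtain ⟨k, σ, h, hk, h1, h2⟩ :=
    SelfDeletingGraph.Presentation.algorithm_run (s := s) (t := t) (I := I)
      (B := 20000 * (I.n + I.m + I.k)) hG (by omega)
  exact ⟨k, σ, h, by omega, h1, h2⟩
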